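/- Let $\mathcal H=\{z=x+iy : y>0\}$, $d\mu = y^{-2}\,dx\,dy$, $\Delta = y^2(\partial_x^2+\partial_y^2)$, and let $\mathcal D=\{z\in\mathcal H : |z|\ge 1,\ |x|\le \tfrac12\}$ be the standard fundamental domain of $SL_2(\mathbb Z)$. Let $$\Theta=\sup\{\Re(\rho) : \zeta^*(\rho)=0\},\qquad \zeta^*(s)=\pi^{-s/2}\Gamma(s/2)\zeta(s),$$ be the supremum of the real parts of the nontrivial zeros of the Riemann zeta function. Let $f:\mathcal H\to\mathbb C$ be $SL_2(\mathbb Z)$-invariant and of rapid decay at the cusp, i.e. for every $N\ge 0$, $f(x+iy)=O(y^{-N})$ as $y\to\infty$, uniformly in $x$. Suppose that $f$ is twice differentiable, with $\Delta f$ locally integrable (which is automatic if $f$ is $C^2$), and that $\Delta f(x+iy)=O(y^{1/4})$ as $y\to\infty$, uniformly in $x$. Let $a_0(y)=\int_0^1 f(x+iy)\,dx$ be the constant Fourier term of $f$. Then, for every $\varepsilon>0$, $$a_0(y)= C+O\bigl(y^{1-\Theta/2-\varepsilon}\bigr)\qquad (y\to 0^+),\qquad C=\frac3\pi\int_{\mathcal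 D} f\,d\mu ,$$ where the implied constant may depend on $f$ and $\varepsilon$. -/

import Mathlib

open Filter Asymptotics MeasureTheory UpperHalfPlane
open scoped Topology UpperHalfPlane MatrixGroups Modular

noncomputable section

namespace Horocycle

/-- `f` is invariant under the action of `SL(2, ℤ)` on the upper half-plane. -/
def IsModularInvariant (f : ℍ → ℂ) : Prop :=
  ∀ (γ : SL(2, ℤ)) (z : ℍ), f (γ • z) = f z

/-- `f` is of rapid decay at the cusp: `f(x + iy) = O(y ^ (-N))` as `y → ∞`, uniformly in `x`,
for every `N`. -/
def IsRapidDecay (f : ℍ → ℂ) : Prop :=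
  ∀ N : ℕ, f =O[atImInfty] fun z : ℍ => (z.im ^ N)⁻¹

/-- `f`, as a function of the two real variables `(x, y)`, is twice differentiable at every
point of the upper half-plane. -/
def IsTwiceDifferentiable (f : ℍ → ℂ) : Prop :=
  DifferentiableOn ℝ (f ∘ ofComplex) upperHalfPlaneSet ∧
    DifferentiableOn ℝ (fderiv ℝ (f ∘ ofComplex)) upperHalfPlaneSet

/-- The hyperbolic Laplacian `y ^ 2 (∂²/∂x² + ∂²/∂y²) f`. -/
def hypLaplacian (f : ℍ → ℂ) (z : ℍ) : ℂ :=
  (z.im ^ 2 : ℝ) • Laplacian.laplacian (f ∘ ofComplex) (z : ℂ)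

/-- The constant Fourier term `a₀(y) = ∫₀¹ f(x + iy) dx`, meaningful for `y > 0`. -/
def constantTerm (f : ℍ → ℂ) (y : ℝ) : ℂ :=
  ∫ x in (0 : ℝ)..1, f (ofComplex (x + y * Complex.I))

/-- The nontrivial zeros of the Riemann zeta function, as the zeros of
`π ^ (-s / 2) Γ(s / 2) ζ(s)`. The poles `0` and `1` of this function are left out, since its
values there are only conventional. -/
def nontrivialZeros : Set ℂ :=
  {ρ : ℂ | ρ ≠ 0 ∧ ρ ≠ 1 ∧ completedRiemannZeta ρ = 0}

/-- `Θ`, the supremum of the real parts of the nontrivial zeros of the Riemann zeta function. -/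
def supRealPart : ℝ :=
  sSup (Complex.re '' nontrivialZeros)

end Horocycle

end

/-! Everything is read off from the Rankin–Selberg transform `R(s) = ∫₀^∞ a₀(y) y^(s-2) dy`, the
Mellin transform of the constant term at `s - 1`. By unfolding, integrating `f` over `𝒟` against the
theta series of the lattice `ℤz + ℤ`, without its constant term, gives a transform of `a₀` whose own
Mellin transform is `2 ζ*(2s) R(s)` (`integral_mul_theta_sub_one`, `mellin_thetaTransform`). The
modular relation `theta_inv` then continues `ζ*(2s) R(s)` to the plane, symmetric under `s ↦ 1 - s`,
with at most simple poles at `0` and `1`, the latter governed by `∫ f`. So on `Re s > Θ/2` the only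
possible pole of `R` is at `s = 1`, with residue `C`, and moving the Mellin inversion contour to `Re
s = σ₀ > Θ/2` gives `a₀(y) = C + O(y^(1-σ₀))`, provided that `R` decays integrably on vertical
lines.

The decay comes from the Laplacian. Since `y²(y^s)'' = s(s-1) y^s`, Green's formula on a period
strip formally gives `s(s-1) R(s) = ∫ Δf · y^s dμ`, hence quadratic decay just to the right of `Re s
= 1`. As `Δf` may grow at the cusp, the integral is cut off at heights `η` and `Y` that are powers
of `T = 1 + |Im s|`. Between them, `Δf` is invariant and integrable over `𝒟`, so unfolding bounds
its mass in the strip (`exists_setIntegral_strip_le`); outside, boundedness and rapid decay of `f`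
suffice. The outcome is `R = O(T^(-2+ε))` (`exists_norm_mellin_constantTerm_le`).

To go left, let `N` be `s(s-1)` times the completed transform `2 ζ*(2s) R(s)`: it is entire and
symmetric, and `π^s N(s)/Γ(s) = 2s(s-1) ζ(2s) R(s)`. This is `O(T^(1/16))` on `Re s = 17/16`, hence
`O(T^(19/16))` on `Re s = -1/16` by symmetry, hence `O(T^(9/8-σ))` between by convexity
(`exists_norm_transform_le`). Littlewood's bound `1/ζ = O(T^(1/16))` to the right of `Θ`
(`exists_norm_zeta_le_of_zero_free`) then gives `R = O(T^(-13/16-σ))`, integrable for `σ > 3/16`.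
Since `Θ ≥ 1/2` forces `σ > 1/4`, this is enough. That inequality requires a nontrivial zero to
exist, which is itself deduced from Littlewood's bound and the functional equation
(`nontrivialZeros_nonempty`). -/

noncomputable section

namespace Horocycle

/-! ### Convexity bounds in vertical strips -/

/-- A Gaussian centred at height `T` localises polynomial growth there, because `1 + |t| ≤ (1 +
|T|)(1 + |t - T|)` and the second factor is swallowed by the Gaussian. The constant does not depend
on `T`, so the three lines theorem can be applied anew for each `T`. -/
lemma one_add_abs_rpow_mul_exp_le {a : ℝ} (ha : 0 ≤ a) (t T : ℝ) :
    (1 + |t|) ^ a * Real.exp (-(t - T) ^ 2) ≤ Real.exp (a ^ 2) * (1 + |T|) ^ a := by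
  have h1 : 1 + |t| ≤ (1 + |T|) * (1 + |t - T|) := by
    have : |t| ≤ |T| + |t - T| := by
      calc |t| = |T + (t - T)| := by ring_nf
        _ ≤ _ := abs_add_le _ _
    nlinarith [abs_nonneg T, abs_nonneg (t - T)]
  have h2 : (1 + |t - T|) ^ a ≤ Real.exp (a * |t - T|) := by
    rw [mul_comm, Real.exp_mul]
    apply Real.rpow_le_rpow (by positivity) _ ha
    linarith [Real.add_one_le_exp |t - T|]
  have h3 : Real.exp (a * |t - T|) * Real.exp (-(t - T) ^ 2) ≤ Real.exp (a ^ 2) := by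
    rw [← Real.exp_add, Real.exp_le_exp, ← sq_abs (t - T)]
    nlinarith [sq_nonneg (a - |t - T|), sq_nonneg (|t - T|), sq_nonneg a]
  calc (1 + |t|) ^ a * Real.exp (-(t - T) ^ 2)
      ≤ ((1 + |T|) * (1 + |t - T|)) ^ a * Real.exp (-(t - T) ^ 2) := by
        gcongr
    _ = (1 + |T|) ^ a * ((1 + |t - T|) ^ a * Real.exp (-(t - T) ^ 2)) := by
        rw [Real.mul_rpow (by positivity) (by positivity)]; ring
    _ ≤ (1 + |T|) ^ a * (Real.exp (a * |t - T|) * Real.exp (-(t - T) ^ 2)) := by gcongr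
    _ ≤ (1 + |T|) ^ a * Real.exp (a ^ 2) := by gcongr
    _ = _ := mul_comm _ _

lemma norm_exp_sub_sq (z : ℂ) (T : ℝ) :
    ‖Complex.exp ((z - T * Complex.I) ^ 2)‖ =
      Real.exp (z.re ^ 2) * Real.exp (-(z.im - T) ^ 2) := by
  rw [Complex.norm_exp, ← Real.exp_add]
  congr 1
  simp [sq, Complex.mul_re]
  ring

/-- Polynomial bounds on the edges of a vertical strip interpolate to the interior, for functions
of at most exponential growth. -/
theorem exists_norm_le_of_vertical_strip {F : ℂ → ℂ} {l u a b A c : ℝ} (hlu : l < u)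
    (ha : 0 ≤ a) (hb : 0 ≤ b)
    (hF : DiffContOnCl ℂ F (Complex.HadamardThreeLines.verticalStrip l u))
    (hgrowth : ∀ z : ℂ, l ≤ z.re → z.re ≤ u → ‖F z‖ ≤ A * Real.exp (c * |z.im|))
    {Ca Cb : ℝ} (hl : ∀ z : ℂ, z.re = l → ‖F z‖ ≤ Ca * (1 + |z.im|) ^ a)
    (hu : ∀ z : ℂ, z.re = u → ‖F z‖ ≤ Cb * (1 + |z.im|) ^ b) :
    ∃ C, ∀ z : ℂ, l ≤ z.re → z.re ≤ u →
      ‖F z‖ ≤ C * (1 + |z.im|) ^ ((a * (u - z.re) + b * (z.re - l)) / (u - l)) := by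
  have hCa : 0 ≤ Ca := by
    have := (norm_nonneg _).trans (hl (l : ℂ) (by simp))
    simpa using this
  have hCb : 0 ≤ Cb := by
    have := (norm_nonneg _).trans (hu (u : ℂ) (by simp))
    simpa using this
  have hA : 0 ≤ A := by
    have := (norm_nonneg _).trans (hgrowth (l : ℂ) (by simp) (by simpa using hlu.le))
    simpa using this
  -- The added `1` makes both constants at least `1`, so that their powers with exponents in `[0,
  -- 1]` are bounded by the constants themselves.
  set C1 := Ca * (Real.exp (l ^ 2) * Real.exp (a ^ 2)) + 1 with hC1
  set C2 := Cb * (Real.exp (u ^ 2) * Real.exp (b ^ 2)) + 1 with hC2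
  have hC1p : 1 ≤ C1 := by rw [hC1]; have : 0 ≤ Ca * (Real.exp (l ^ 2) * Real.exp (a ^ 2)) := by positivity
                           linarith
  have hC2p : 1 ≤ C2 := by rw [hC2]; have : 0 ≤ Cb * (Real.exp (u ^ 2) * Real.exp (b ^ 2)) := by positivity
                           linarith
  refine ⟨C1 * C2, fun z hzl hzu => ?_⟩
  set T := z.im with hT
  -- The Gaussian factor is centred at the height of `z`, where its modulus is at least `1`. It
  -- makes the function bounded in the strip, and turns the edge bounds into bounds in `T` alone.
  set G : ℂ → ℂ := fun w => F w * Complex.exp ((w - T * Complex.I) ^ 2) with hG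
  have hGd : DiffContOnCl ℂ G (Complex.HadamardThreeLines.verticalStrip l u) := by
    have h2 : Differentiable ℂ (fun w : ℂ => Complex.exp ((w - T * Complex.I) ^ 2)) := by fun_prop
    simpa [hG, smul_eq_mul] using hF.smul h2.diffContOnCl
  have hGn : ∀ w, ‖G w‖ = ‖F w‖ * (Real.exp (w.re ^ 2) * Real.exp (-(w.im - T) ^ 2)) := by
    intro w; rw [hG]; simp only [norm_mul]; rw [norm_exp_sub_sq]
  have hbdd : BddAbove ((norm ∘ G) '' Complex.HadamardThreeLines.verticalClosedStrip l u) := by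
    refine ⟨A * (Real.exp (|c| * |T| + c ^ 2) * Real.exp (l ^ 2 + u ^ 2)), ?_⟩
    rintro _ ⟨w, hw, rfl⟩
    simp only [Complex.HadamardThreeLines.verticalClosedStrip, Set.mem_preimage, Set.mem_Icc] at hw
    simp only [Function.comp]
    rw [hGn]
    have e1 : Real.exp (w.re ^ 2) ≤ Real.exp (l ^ 2 + u ^ 2) := by
      rw [Real.exp_le_exp]
      rcases le_total 0 w.re with h | h
      · nlinarith [sq_nonneg l]
      · nlinarith [sq_nonneg u]
    have e2 : Real.exp (c * |w.im|) * Real.exp (-(w.im - T) ^ 2) ≤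
        Real.exp (|c| * |T| + c ^ 2) := by
      rw [← Real.exp_add, Real.exp_le_exp]
      have h1 : |w.im| ≤ |T| + |w.im - T| := by
        calc |w.im| = |T + (w.im - T)| := by ring_nf
          _ ≤ _ := abs_add_le _ _
      have h2 : c * |w.im| ≤ |c| * (|T| + |w.im - T|) :=
        mul_le_mul (le_abs_self c) h1 (abs_nonneg _) (abs_nonneg _)
      rw [← sq_abs (w.im - T), ← sq_abs c]
      nlinarith [sq_nonneg (|c| - |w.im - T|), sq_nonneg (|w.im - T|), sq_nonneg |c|]
    calc ‖F w‖ * (Real.exp (w.re ^ 2) * Real.exp (-(w.im - T) ^ 2))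
        ≤ (A * Real.exp (c * |w.im|)) * (Real.exp (l ^ 2 + u ^ 2) * Real.exp (-(w.im - T) ^ 2)) := by
          gcongr
          exact hgrowth w hw.1 hw.2
      _ = A * ((Real.exp (c * |w.im|) * Real.exp (-(w.im - T) ^ 2)) * Real.exp (l ^ 2 + u ^ 2)) := by
          ring
      _ ≤ _ := by gcongr
  have hla : ∀ w ∈ Complex.re ⁻¹' {l}, ‖G w‖ ≤ C1 * (1 + |T|) ^ a := by
    intro w hw
    have hw : w.re = l := hw
    rw [hGn, hw]
    calc ‖F w‖ * (Real.exp (l ^ 2) * Real.exp (-(w.im - T) ^ 2))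
        ≤ (Ca * (1 + |w.im|) ^ a) * (Real.exp (l ^ 2) * Real.exp (-(w.im - T) ^ 2)) := by
          gcongr; exact hl w hw
      _ = Ca * (Real.exp (l ^ 2) * ((1 + |w.im|) ^ a * Real.exp (-(w.im - T) ^ 2))) := by ring
      _ ≤ Ca * (Real.exp (l ^ 2) * (Real.exp (a ^ 2) * (1 + |T|) ^ a)) := by
          exact mul_le_mul_of_nonneg_left (mul_le_mul_of_nonneg_left
            (one_add_abs_rpow_mul_exp_le ha _ _) (Real.exp_pos _).le) hCa
      _ = (Ca * (Real.exp (l ^ 2) * Real.exp (a ^ 2))) * (1 + |T|) ^ a := by ring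
      _ ≤ C1 * (1 + |T|) ^ a := by gcongr; rw [hC1]; linarith
  have hub : ∀ w ∈ Complex.re ⁻¹' {u}, ‖G w‖ ≤ C2 * (1 + |T|) ^ b := by
    intro w hw
    have hw : w.re = u := hw
    rw [hGn, hw]
    calc ‖F w‖ * (Real.exp (u ^ 2) * Real.exp (-(w.im - T) ^ 2))
        ≤ (Cb * (1 + |w.im|) ^ b) * (Real.exp (u ^ 2) * Real.exp (-(w.im - T) ^ 2)) := by
          gcongr; exact hu w hw
      _ = Cb * (Real.exp (u ^ 2) * ((1 + |w.im|) ^ b * Real.exp (-(w.im - T) ^ 2))) := by ring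
      _ ≤ Cb * (Real.exp (u ^ 2) * (Real.exp (b ^ 2) * (1 + |T|) ^ b)) := by
          exact mul_le_mul_of_nonneg_left (mul_le_mul_of_nonneg_left
            (one_add_abs_rpow_mul_exp_le hb _ _) (Real.exp_pos _).le) hCb
      _ = (Cb * (Real.exp (u ^ 2) * Real.exp (b ^ 2))) * (1 + |T|) ^ b := by ring
      _ ≤ C2 * (1 + |T|) ^ b := by gcongr; rw [hC2]; linarith
  have key := Complex.HadamardThreeLines.norm_le_interp_of_mem_verticalClosedStrip' (z := z) hlu
    ⟨hzl, hzu⟩ hGd hbdd hla hub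
  set θ := (z.re - l) / (u - l) with hθ
  have hul : 0 < u - l := sub_pos.mpr hlu
  have hθ0 : 0 ≤ θ := div_nonneg (by linarith) hul.le
  have hθ1 : θ ≤ 1 := by rw [hθ, div_le_one hul]; linarith
  have hpos : (0 : ℝ) < 1 + |T| := by positivity
  have hFG : ‖F z‖ ≤ ‖G z‖ := by
    rw [hGn, sub_self]
    have : 1 ≤ Real.exp (z.re ^ 2) := Real.one_le_exp (sq_nonneg _)
    simpa using le_mul_of_one_le_right (norm_nonneg (F z)) this
  refine hFG.trans (key.trans ?_)
  rw [Real.mul_rpow (by positivity) (by positivity), Real.mul_rpow (by positivity) (by positivity),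
    ← Real.rpow_mul hpos.le, ← Real.rpow_mul hpos.le]
  have hexp : (a * (u - z.re) + b * (z.re - l)) / (u - l) = a * (1 - θ) + b * θ := by
    rw [hθ]; field_simp; ring
  rw [hexp, Real.rpow_add hpos]
  have h1 : C1 ^ (1 - θ) ≤ C1 := by
    calc C1 ^ (1 - θ) ≤ C1 ^ (1 : ℝ) := Real.rpow_le_rpow_of_exponent_le hC1p (by linarith)
      _ = C1 := Real.rpow_one _
  have h2 : C2 ^ θ ≤ C2 := by
    calc C2 ^ θ ≤ C2 ^ (1 : ℝ) := Real.rpow_le_rpow_of_exponent_le hC2p hθ1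
      _ = C2 := Real.rpow_one _
  calc C1 ^ (1 - θ) * (1 + |T|) ^ (a * (1 - θ)) * (C2 ^ θ * (1 + |T|) ^ (b * θ))
      = C1 ^ (1 - θ) * C2 ^ θ * ((1 + |T|) ^ (a * (1 - θ)) * (1 + |T|) ^ (b * θ)) := by ring
    _ ≤ C1 * C2 * ((1 + |T|) ^ (a * (1 - θ)) * (1 + |T|) ^ (b * θ)) := by gcongr

/-! ### Bounds for the Gamma function -/

lemma norm_Gamma_le_Gamma_re {s : ℂ} (hs : 0 < s.re) : ‖Complex.Gamma s‖ ≤ Real.Gamma s.re := by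
  rw [Complex.Gamma_eq_integral hs, Real.Gamma_eq_integral hs, Complex.GammaIntegral]
  refine (norm_integral_le_integral_norm _).trans (le_of_eq ?_)
  refine setIntegral_congr_fun measurableSet_Ioi fun x hx => ?_
  have hx : 0 < x := hx
  rw [norm_mul, Complex.norm_real, Complex.norm_cpow_eq_rpow_re_of_pos hx]
  simp [abs_of_pos (Real.exp_pos _)]

lemma exists_norm_Gamma_le {a b : ℝ} (ha : 0 < a) :
    ∃ C, ∀ s : ℂ, a ≤ s.re → s.re ≤ b → ‖Complex.Gamma s‖ ≤ C := by
  have hc : ContinuousOn Real.Gamma (Set.Icc a b) := by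
    intro x hx
    refine (Real.differentiableAt_Gamma ?_).continuousAt.continuousWithinAt
    intro m hm
    have : 0 < x := ha.trans_le hx.1
    have : (0 : ℝ) ≤ m := Nat.cast_nonneg m
    linarith
  obtain ⟨C, hC⟩ := isCompact_Icc.exists_bound_of_continuousOn hc
  refine ⟨C, fun s h1 h2 => (norm_Gamma_le_Gamma_re (ha.trans_le h1)).trans ?_⟩
  exact (le_abs_self _).trans (hC _ ⟨h1, h2⟩)

lemma norm_sin_le_exp (z : ℂ) : ‖Complex.sin z‖ ≤ Real.exp |z.im| := by
  rw [Complex.sin]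
  have h1 : ‖Complex.exp (-z * Complex.I)‖ ≤ Real.exp |z.im| := by
    rw [Complex.norm_exp, Real.exp_le_exp]; simpa using le_abs_self z.im
  have h2 : ‖Complex.exp (z * Complex.I)‖ ≤ Real.exp |z.im| := by
    rw [Complex.norm_exp, Real.exp_le_exp]; simpa using neg_le_abs z.im
  rw [norm_div, norm_mul, Complex.norm_I, mul_one, Complex.norm_two, div_le_iff₀ two_pos]
  calc _ ≤ _ := norm_sub_le _ _
    _ ≤ _ := by linarith

/-- `1 / Γ` has at most exponential growth in vertical strips. -/
theorem exists_norm_inv_Gamma_le :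
    ∃ A : ℝ, 0 ≤ A ∧ ∀ s : ℂ, -2 ≤ s.re → s.re ≤ 2 →
      ‖(Complex.Gamma s)⁻¹‖ ≤ A * Real.exp (Real.pi * |s.im|) := by
  obtain ⟨C, hC⟩ := exists_norm_Gamma_le (a := 1) (b := 5) one_pos
  have hC0 : 0 ≤ C := (norm_nonneg _).trans (hC 1 (by simp) (by norm_num))
  have hK : IsCompact (Set.Icc (-2 : ℝ) 2 ×ℂ Set.Icc (-1 : ℝ) 1) := isCompact_Icc.reProdIm isCompact_Icc
  obtain ⟨D, hD⟩ := hK.exists_bound_of_continuousOn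
    (Complex.differentiable_one_div_Gamma.continuous.continuousOn)
  have hD0 : 0 ≤ D := (norm_nonneg _).trans (hD 0 (by simp [Complex.mem_reProdIm]))
  refine ⟨C + D, by positivity, fun s h1 h2 => ?_⟩
  have hexp : 1 ≤ Real.exp (Real.pi * |s.im|) := Real.one_le_exp (by positivity)
  by_cases ht : |s.im| ≤ 1
  · calc ‖(Complex.Gamma s)⁻¹‖ ≤ D := hD s (by
          rw [Complex.mem_reProdIm]; exact ⟨⟨h1, h2⟩, abs_le.mp ht⟩)
      _ ≤ (C + D) * 1 := by linarith
      _ ≤ _ := by gcongr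
  · push Not at ht
    have him : s.im ≠ 0 := by rintro h; simp [h] at ht; linarith
    have hne : ∀ x : ℝ, (x : ℂ) - s ≠ 0 := by
      intro x h
      apply him
      have := congrArg Complex.im h
      simpa using this
    have hnorm : ∀ x : ℝ, 1 ≤ ‖(x : ℂ) - s‖ := by
      intro x
      calc (1 : ℝ) ≤ |((x : ℂ) - s).im| := by simpa using ht.le
        _ ≤ _ := Complex.abs_im_le_norm _
    have hn1 : (1 : ℂ) - s ≠ 0 := by simpa using hne 1
    have hn2 : (1 : ℂ) - s + 1 ≠ 0 := by
      have := hne 2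
      intro h; apply this; rw [← h]; push_cast; ring
    -- Two steps of the recursion bring the argument into `1 ≤ Re ≤ 5`, where `Γ` is bounded. The
    -- factors picked up have modulus at least `1` because `|Im s| > 1`.
    have hG : Complex.Gamma (1 - s + 1 + 1) = (1 - s + 1) * ((1 - s) * Complex.Gamma (1 - s)) := by
      rw [Complex.Gamma_add_one _ hn2, Complex.Gamma_add_one _ hn1]
    have hsin : Complex.sin (Real.pi * s) ≠ 0 := by
      rw [Ne, Complex.sin_eq_zero_iff]
      rintro ⟨k, hk⟩
      apply him
      have := congrArg Complex.im hk
      simp at this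
      exact this
    have hinv : (Complex.Gamma s)⁻¹ = Complex.Gamma (1 - s) * Complex.sin (Real.pi * s) / Real.pi := by
      have h := Complex.Gamma_mul_Gamma_one_sub s
      have hpi : (Real.pi : ℂ) ≠ 0 := by exact_mod_cast Real.pi_ne_zero
      have hG0 : Complex.Gamma s ≠ 0 := by
        intro h0; rw [h0, zero_mul] at h
        exact (div_ne_zero hpi hsin) h.symm
      rw [eq_div_iff hsin] at h
      rw [eq_div_iff hpi]
      calc (Complex.Gamma s)⁻¹ * Real.pi = (Complex.Gamma s)⁻¹ *
            (Complex.Gamma s * Complex.Gamma (1 - s) * Complex.sin (Real.pi * s)) := by rw [h]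
        _ = _ := by rw [mul_assoc, inv_mul_cancel_left₀ hG0]
    have hGle : ‖Complex.Gamma (1 - s)‖ ≤ C := by
      have h3 := hC (1 - s + 1 + 1) (by simp; linarith) (by simp; linarith)
      rw [hG, norm_mul, norm_mul] at h3
      have ha : 1 ≤ ‖(1 : ℂ) - s‖ := by simpa using hnorm 1
      have hb : 1 ≤ ‖(1 : ℂ) - s + 1‖ := by
        have := hnorm 2
        rwa [show ((2 : ℝ) : ℂ) - s = 1 - s + 1 by push_cast; ring] at this
      calc ‖Complex.Gamma (1 - s)‖ = 1 * (1 * ‖Complex.Gamma (1 - s)‖) := by ring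
        _ ≤ _ := by gcongr
        _ ≤ C := h3
    rw [hinv, norm_div, norm_mul, Complex.norm_real, Real.norm_eq_abs, abs_of_pos Real.pi_pos]
    have hs : ‖Complex.sin (Real.pi * s)‖ ≤ Real.exp (Real.pi * |s.im|) := by
      refine (norm_sin_le_exp _).trans ?_
      rw [Real.exp_le_exp]
      simp [abs_mul, abs_of_pos Real.pi_pos]
    rw [div_le_iff₀ Real.pi_pos]
    calc ‖Complex.Gamma (1 - s)‖ * ‖Complex.sin (Real.pi * s)‖
        ≤ (C + D) * Real.exp (Real.pi * |s.im|) := by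
          gcongr; linarith
      _ = (C + D) * Real.exp (Real.pi * |s.im|) * 1 := by ring
      _ ≤ _ := by
          gcongr
          linarith [Real.pi_gt_three]

/-- This replaces Stirling's formula: on suitable vertical lines the two Gamma factors of a
functional equation have conjugate arguments up to an integer shift, so their quotient has the
modulus of a polynomial. -/
lemma norm_Gamma_conj_eq {s w : ℂ} (h1 : s.re = w.re) (h2 : s.im = -w.im) :
    ‖Complex.Gamma s‖ = ‖Complex.Gamma w‖ := by
  have : s = (starRingEnd ℂ) w := Complex.ext (by simp [h1]) (by simp [h2])
  rw [this, Complex.Gamma_conj, RCLike.norm_conj]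

/-- The modulus of `Γ(1 - s) / Γ(s)` to the left of the critical line. -/
theorem exists_norm_Gamma_one_sub_le :
    ∃ C : ℝ, 0 ≤ C ∧ ∀ s : ℂ, -(1 / 2) ≤ s.re → s.re ≤ 1 / 2 →
      ‖Complex.Gamma (1 - s) * (Complex.Gamma s)⁻¹‖ ≤ C * (1 + |s.im|) ^ (1 - 2 * s.re) := by
  obtain ⟨A, hA0, hA⟩ := exists_norm_inv_Gamma_le
  obtain ⟨C, hC⟩ := exists_norm_Gamma_le (a := 1 / 2) (b := 3 / 2) (by norm_num)
  set X : ℂ → ℂ := fun s => Complex.Gamma (1 - s) * (Complex.Gamma s)⁻¹ with hX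
  have hdiff : ∀ s : ℂ, s.re < 1 → DifferentiableAt ℂ X s := by
    intro s hs
    refine DifferentiableAt.mul ?_ (Complex.differentiable_one_div_Gamma s)
    refine DifferentiableAt.comp s (Complex.differentiableAt_Gamma _ ?_) (by fun_prop)
    intro m hm
    have := congrArg Complex.re hm
    simp at this
    have h0 : (0 : ℝ) ≤ m := Nat.cast_nonneg m
    linarith
  have hlu : (-(1 / 2) : ℝ) < 1 / 2 := by norm_num
  have hd : DiffContOnCl ℂ X (Complex.HadamardThreeLines.verticalStrip (-(1 / 2)) (1 / 2)) := by
    apply DifferentiableOn.diffContOnCl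
    intro z hz
    refine (hdiff z ?_).differentiableWithinAt
    have hz' : z ∈ Complex.re ⁻¹' Set.Icc (-(1 / 2) : ℝ) (1 / 2) := by
      refine closure_minimal ?_ (isClosed_Icc.preimage Complex.continuous_re) hz
      exact Set.preimage_mono Set.Ioo_subset_Icc_self
    have := hz'.2
    linarith
  have hgr : ∀ z : ℂ, -(1 / 2) ≤ z.re → z.re ≤ 1 / 2 →
      ‖X z‖ ≤ C * A * Real.exp (Real.pi * |z.im|) := by
    intro z h1 h2
    rw [hX, norm_mul, mul_assoc]
    have h3 := hC (1 - z) (by simp; linarith) (by simp; linarith)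
    have h4 := hA z (by linarith) (by linarith)
    exact mul_le_mul h3 h4 (norm_nonneg _) ((norm_nonneg _).trans h3)
  -- On this line `1 - z` and `z + 2` are conjugate, so the quotient has modulus at most `|z(z +
  -- 1)|`; on `Re z = 1/2` it is at most `1`. Interpolating the exponents `2` and `0` yields `1 - 2
  -- Re s`.
  have hl : ∀ z : ℂ, z.re = -(1 / 2) → ‖X z‖ ≤ 1 * (1 + |z.im|) ^ (2 : ℝ) := by
    intro z hz
    have hz0 : z ≠ 0 := by rintro rfl; norm_num at hz
    have hz1 : z + 1 ≠ 0 := by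
      intro h; have := congrArg Complex.re h; simp [hz] at this; norm_num at this
    have e1 : Complex.Gamma (z + 1 + 1) = (z + 1) * (z * Complex.Gamma z) := by
      rw [Complex.Gamma_add_one _ hz1, Complex.Gamma_add_one _ hz0]
    have e2 : ‖Complex.Gamma (1 - z)‖ = ‖Complex.Gamma (z + 1 + 1)‖ :=
      norm_Gamma_conj_eq (by simp [hz]; norm_num) (by simp)
    rw [hX, norm_mul, e2, e1, norm_mul, norm_mul, norm_inv]
    have b1 : ‖z‖ ≤ 1 + |z.im| := by
      have := Complex.norm_le_abs_re_add_abs_im z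
      rw [hz, abs_neg, abs_of_pos (by norm_num : (0 : ℝ) < 1 / 2)] at this
      linarith
    have b2 : ‖z + 1‖ ≤ 1 + |z.im| := by
      have := Complex.norm_le_abs_re_add_abs_im (z + 1)
      simp only [Complex.add_re, hz, Complex.one_re, Complex.add_im, Complex.one_im, add_zero] at this
      rw [abs_of_pos (by norm_num : (0 : ℝ) < -(1 / 2) + 1)] at this
      linarith
    by_cases hG : ‖Complex.Gamma z‖ = 0
    · rw [hG]; simp; positivity
    · calc ‖z + 1‖ * (‖z‖ * ‖Complex.Gamma z‖) * ‖Complex.Gamma z‖⁻¹ = ‖z + 1‖ * ‖z‖ := by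
            field_simp
        _ ≤ (1 + |z.im|) * (1 + |z.im|) := by gcongr
        _ = _ := by rw [Real.rpow_two]; ring
  have hu : ∀ z : ℂ, z.re = 1 / 2 → ‖X z‖ ≤ 1 * (1 + |z.im|) ^ (0 : ℝ) := by
    intro z hz
    have e2 : ‖Complex.Gamma (1 - z)‖ = ‖Complex.Gamma z‖ :=
      norm_Gamma_conj_eq (by simp [hz]; norm_num) (by simp)
    rw [hX, norm_mul, e2, norm_inv, Real.rpow_zero, mul_one]
    exact mul_inv_le_one
  obtain ⟨K, hK⟩ := exists_norm_le_of_vertical_strip hlu (by norm_num) le_rfl hd hgr hl hu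
  refine ⟨K, ?_, fun s h1 h2 => ?_⟩
  · have := (norm_nonneg _).trans (hK 0 (by simp) (by simp))
    simpa using this
  · have := hK s h1 h2
    convert this using 3
    ring

/-! ### Polynomial growth of the zeta function -/

/-- A globally convergent Mellin transform is bounded in vertical strips. -/
lemma exists_norm_mellin_le {h : ℝ → ℂ} {a b : ℝ} (ha : MellinConvergent h (a : ℂ))
    (hb : MellinConvergent h (b : ℂ)) :
    ∃ C, ∀ s : ℂ, a ≤ s.re → s.re ≤ b → ‖mellin h s‖ ≤ C := by
  refine ⟨(∫ t in Set.Ioi (0 : ℝ), ‖(t : ℂ) ^ ((a : ℂ) - 1) • h t‖) +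
    ∫ t in Set.Ioi (0 : ℝ), ‖(t : ℂ) ^ ((b : ℂ) - 1) • h t‖, fun s h1 h2 => ?_⟩
  rw [← integral_add ha.norm hb.norm, mellin]
  refine norm_integral_le_of_norm_le (ha.norm.add hb.norm) ?_
  refine (ae_restrict_iff' measurableSet_Ioi).mpr (Eventually.of_forall fun t ht => ?_)
  have ht : 0 < t := ht
  simp only [norm_smul, Complex.norm_cpow_eq_rpow_re_of_pos ht, Complex.sub_re, Complex.one_re,
    Complex.ofReal_re]
  rw [← add_mul]
  gcongr
  rcases le_total t 1 with h | h
  · calc t ^ (s.re - 1) ≤ t ^ (a - 1) := Real.rpow_le_rpow_of_exponent_ge ht h (by linarith)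
      _ ≤ _ := le_add_of_nonneg_right (by positivity)
  · calc t ^ (s.re - 1) ≤ t ^ (b - 1) := Real.rpow_le_rpow_of_exponent_le h (by linarith)
      _ ≤ _ := le_add_of_nonneg_left (by positivity)

/-- `Λ₀` is the Mellin transform of a kernel decaying rapidly at both `0` and `∞`, so it converges
absolutely for every `s`, and `|t^(s-1)|` depends only on `Re s`. -/
lemma exists_norm_completed_le (P : WeakFEPair ℂ) (a b : ℝ) :
    ∃ C, ∀ s : ℂ, a ≤ s.re → s.re ≤ b → ‖P.Λ₀ s‖ ≤ C :=
  exists_norm_mellin_le (P.isStrongFEPair_toStrongFEPair.hasMellin a).1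
    (P.isStrongFEPair_toStrongFEPair.hasMellin b).1

/-- The entire function `s (s - 1) Λ(s)`, where `Λ` is the completed Riemann zeta function. -/
def xiFun (s : ℂ) : ℂ := s * (s - 1) * completedRiemannZeta₀ s + 1

lemma differentiable_xiFun : Differentiable ℂ xiFun := by
  unfold xiFun
  have := differentiable_completedZeta₀
  fun_prop

lemma xiFun_eq {s : ℂ} (h0 : s ≠ 0) (h1 : s ≠ 1) :
    xiFun s = s * (s - 1) * completedRiemannZeta s := by
  have h1' : 1 - s ≠ 0 := sub_ne_zero.mpr h1.symm
  rw [xiFun, completedRiemannZeta_eq]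
  field_simp
  ring

lemma exists_norm_xiFun_le (a b : ℝ) :
    ∃ C, 0 ≤ C ∧ ∀ s : ℂ, a ≤ s.re → s.re ≤ b → ‖xiFun s‖ ≤ C * Real.exp (2 * |s.im|) := by
  obtain ⟨C, hC⟩ := exists_norm_completed_le (HurwitzZeta.hurwitzEvenFEPair 0) (a / 2) (b / 2)
  have hC' : ∀ s : ℂ, a ≤ s.re → s.re ≤ b → ‖completedRiemannZeta₀ s‖ ≤ |C| := by
    intro s h1 h2
    have e : completedRiemannZeta₀ s = (HurwitzZeta.hurwitzEvenFEPair 0).Λ₀ (s / 2) / 2 := rfl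
    have := hC (s / 2) (by simp; linarith) (by simp; linarith)
    rw [e, norm_div, Complex.norm_two]
    have h3 := le_abs_self C
    have h4 := abs_nonneg C
    linarith
  set M := |a| + |b| + 1 with hM
  have hM0 : 1 ≤ M := by rw [hM]; linarith [abs_nonneg a, abs_nonneg b]
  refine ⟨(M + 1) ^ 2 * |C| + 1, by positivity, fun s h1 h2 => ?_⟩
  have hre : |s.re| ≤ M - 1 := by
    rw [abs_le, hM]
    constructor
    · linarith [neg_abs_le a, abs_nonneg b]
    · linarith [le_abs_self b, abs_nonneg a]
  have hs : ‖s‖ ≤ (M + 1) * Real.exp |s.im| := by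
    have e1 := Complex.norm_le_abs_re_add_abs_im s
    have e2 := Real.add_one_le_exp |s.im|
    nlinarith [abs_nonneg s.im]
  have hs1 : ‖s - 1‖ ≤ (M + 1) * Real.exp |s.im| := by
    have e0 : ‖s - 1‖ ≤ ‖s‖ + 1 := by simpa using norm_sub_le s 1
    have e1 := Complex.norm_le_abs_re_add_abs_im s
    have e2 := Real.add_one_le_exp |s.im|
    nlinarith [abs_nonneg s.im]
  have hexp : Real.exp (2 * |s.im|) = Real.exp |s.im| * Real.exp |s.im| := by
    rw [← Real.exp_add]; ring_nf
  have h1e : 1 ≤ Real.exp (2 * |s.im|) := Real.one_le_exp (by positivity)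
  calc ‖xiFun s‖ ≤ ‖s‖ * ‖s - 1‖ * ‖completedRiemannZeta₀ s‖ + 1 := by
        rw [xiFun, ← norm_mul, ← norm_mul]
        simpa using norm_add_le (s * (s - 1) * completedRiemannZeta₀ s) 1
    _ ≤ ((M + 1) * Real.exp |s.im|) * ((M + 1) * Real.exp |s.im|) * |C| + 1 := by
        gcongr; exact hC' s h1 h2
    _ = (M + 1) ^ 2 * |C| * Real.exp (2 * |s.im|) + 1 := by rw [hexp]; ring
    _ ≤ _ := by rw [add_mul, one_mul]; linarith

/-- The entire function `(s - 1) ζ(s)`. -/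
def subOneMulZeta (s : ℂ) : ℂ :=
  xiFun s * (Real.pi : ℂ) ^ (s / 2) / 2 * (Complex.Gamma (s / 2 + 1))⁻¹

lemma differentiable_subOneMulZeta : Differentiable ℂ subOneMulZeta := by
  unfold subOneMulZeta
  have h1 := differentiable_xiFun
  have h2 : Differentiable ℂ fun s : ℂ => (Complex.Gamma (s / 2 + 1))⁻¹ :=
    Complex.differentiable_one_div_Gamma.comp (by fun_prop : Differentiable ℂ fun s : ℂ => s / 2 + 1)
  have h3 : Differentiable ℂ fun s : ℂ => (Real.pi : ℂ) ^ (s / 2) := by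
    intro s
    refine DifferentiableAt.const_cpow (by fun_prop) (Or.inl ?_)
    exact_mod_cast Real.pi_ne_zero
  exact ((h1.mul h3).div_const 2).mul h2

lemma subOneMulZeta_eq {s : ℂ} (h1 : s ≠ 1) : subOneMulZeta s = (s - 1) * riemannZeta s := by
  have h1' : 1 - s ≠ 0 := sub_ne_zero.mpr h1.symm
  have hpi : (Real.pi : ℂ) ≠ 0 := by exact_mod_cast Real.pi_ne_zero
  have hpi2 : (Real.pi : ℂ) ^ (s / 2) ≠ 0 := by simp [Complex.cpow_eq_zero_iff, hpi]
  have : s * completedRiemannZeta₀ s - 1 - s / (1 - s) = xiFun s / (s - 1) := by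
    have h2 : s - 1 ≠ 0 := sub_ne_zero.mpr h1
    rw [xiFun]
    field_simp
    ring
  rw [riemannZeta_eq_mul_completedRiemannZeta₀, this, subOneMulZeta, neg_div, Complex.cpow_neg]
  have h2 : s - 1 ≠ 0 := sub_ne_zero.mpr h1
  field_simp

lemma norm_zeta_le_of_three_halves_le {s : ℂ} (hs : 3 / 2 ≤ s.re) :
    ‖riemannZeta s‖ ≤ ∑' n : ℕ, 1 / ((n : ℝ) + 1) ^ (3 / 2 : ℝ) := by
  rw [zeta_eq_tsum_one_div_nat_add_one_cpow (by linarith)]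
  have hsum : Summable fun n : ℕ => 1 / ((n : ℝ) + 1) ^ (3 / 2 : ℝ) := by
    have := (summable_nat_add_iff 1).mpr
      (Real.summable_one_div_nat_rpow.mpr (by norm_num : (1 : ℝ) < 3 / 2))
    simpa using this
  refine tsum_of_norm_bounded hsum.hasSum fun n => ?_
  have hn : (0 : ℝ) < (n : ℝ) + 1 := by positivity
  rw [norm_div, norm_one]
  have : ((n : ℂ) + 1) = ((n + 1 : ℝ) : ℂ) := by push_cast; ring
  rw [this, Complex.norm_cpow_eq_rpow_re_of_pos hn]
  gcongr
  linarith [(Nat.cast_nonneg n : (0 : ℝ) ≤ n)]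

/-- The functional equation in the form of a relation of absolute values. -/
lemma norm_zeta_functional {s : ℂ} (h : ∀ n : ℤ, s ≠ n) :
    ‖riemannZeta s‖ = ‖riemannZeta (1 - s)‖ * (Real.pi ^ (s.re - 1 / 2) *
      (‖Complex.Gamma ((1 - s) / 2)‖ * ‖(Complex.Gamma (s / 2))⁻¹‖)) := by
  have h0 : s ≠ 0 := by simpa using h 0
  have h1 : 1 - s ≠ 0 := by
    rw [sub_ne_zero]; simpa using (h 1).symm
  have hG : Complex.Gammaℝ (1 - s) ≠ 0 := by
    rw [Ne, Complex.Gammaℝ_eq_zero_iff]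
    rintro ⟨n, hn⟩
    apply h (1 + 2 * n)
    push_cast
    linear_combination -hn
  rw [riemannZeta_def_of_ne_zero h0, riemannZeta_def_of_ne_zero h1, completedRiemannZeta_one_sub,
    norm_div, norm_div, Complex.Gammaℝ_def, Complex.Gammaℝ_def] at *
  rw [norm_mul, norm_mul, Complex.norm_cpow_eq_rpow_re_of_pos Real.pi_pos,
    Complex.norm_cpow_eq_rpow_re_of_pos Real.pi_pos, norm_inv]
  have hG2 : ‖Complex.Gamma ((1 - s) / 2)‖ ≠ 0 := by
    rw [norm_ne_zero_iff]; exact right_ne_zero_of_mul hG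
  have e : Real.pi ^ (s.re - 1 / 2) = Real.pi ^ ((-(1 - s) / 2).re) / Real.pi ^ ((-s / 2).re) := by
    rw [← Real.rpow_sub Real.pi_pos]
    congr 1
    simp
    ring
  have hp1 : Real.pi ^ ((-(1 - s) / 2).re) ≠ 0 := (Real.rpow_pos_of_pos Real.pi_pos _).ne'
  rw [e]
  by_cases hg : ‖Complex.Gamma (s / 2)‖ = 0
  · simp [hg]
  · field_simp

lemma ne_int_of_re {s : ℂ} {x : ℝ} (hx : s.re = x) (hx' : ∀ n : ℤ, x ≠ n) (n : ℤ) : s ≠ n := by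
  rintro rfl
  exact hx' n (by simpa using hx.symm)

/-- The right edge is controlled by the Dirichlet series, the left one by the functional equation.
The abscissa `-5/2` lies beyond `-2` and avoids the integers, and there the Gamma quotient is a
product of three linear factors; with `s - 1` this makes exponent `4`. The same exponent is wasted
on the right edge, so that interpolation leaves it constant. -/
lemma exists_norm_subOneMulZeta_le : ∃ C A : ℝ, 0 ≤ A ∧ ∀ s : ℂ, -(5 / 2) ≤ s.re → s.re ≤ 3 / 2 →
      ‖subOneMulZeta s‖ ≤ C * (1 + |s.im|) ^ A := by
  obtain ⟨A, hA0, hA⟩ := exists_norm_inv_Gamma_le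
  obtain ⟨B, hB0, hB⟩ := exists_norm_xiFun_le (-(5 / 2)) (3 / 2)
  set Z := ∑' n : ℕ, 1 / ((n : ℝ) + 1) ^ (3 / 2 : ℝ) with hZ
  have hZ0 : 0 ≤ Z := tsum_nonneg fun n => by positivity
  have hlu : (-(5 / 2) : ℝ) < 3 / 2 := by norm_num
  have hgr : ∀ z : ℂ, -(5 / 2) ≤ z.re → z.re ≤ 3 / 2 →
      ‖subOneMulZeta z‖ ≤ (B * Real.pi * A) * Real.exp ((2 + Real.pi) * |z.im|) := by
    intro z h1 h2
    rw [subOneMulZeta, norm_mul, norm_div, norm_mul, Complex.norm_two,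
      Complex.norm_cpow_eq_rpow_re_of_pos Real.pi_pos]
    have e1 := hB z h1 h2
    have e2 := hA (z / 2 + 1) (by simp; linarith) (by simp; linarith)
    have e3 : Real.pi ^ (z / 2).re ≤ Real.pi := by
      calc Real.pi ^ (z / 2).re ≤ Real.pi ^ (1 : ℝ) :=
            Real.rpow_le_rpow_of_exponent_le (by linarith [Real.pi_gt_three]) (by simp; linarith)
        _ = _ := Real.rpow_one _
    have e4 : Real.exp (Real.pi * |(z / 2 + 1).im|) ≤ Real.exp (Real.pi * |z.im|) := by
      rw [Real.exp_le_exp]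
      have : |(z / 2 + 1).im| ≤ |z.im| := by
        simp [abs_div]
      exact mul_le_mul_of_nonneg_left this Real.pi_pos.le
    have h0 := Real.pi_pos
    calc ‖xiFun z‖ * Real.pi ^ (z / 2).re / 2 * ‖(Complex.Gamma (z / 2 + 1))⁻¹‖
        ≤ ‖xiFun z‖ * Real.pi ^ (z / 2).re * ‖(Complex.Gamma (z / 2 + 1))⁻¹‖ := by
          gcongr
          exact half_le_self (by positivity)
      _ ≤ (B * Real.exp (2 * |z.im|)) * Real.pi * (A * Real.exp (Real.pi * |z.im|)) := by
          gcongr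
          exact e2.trans (by gcongr)
      _ = (B * Real.pi * A) * (Real.exp (2 * |z.im|) * Real.exp (Real.pi * |z.im|)) := by ring
      _ = _ := by rw [← Real.exp_add, add_mul]
  have hl : ∀ z : ℂ, z.re = -(5 / 2) → ‖subOneMulZeta z‖ ≤ (40 * Z) * (1 + |z.im|) ^ (4 : ℝ) := by
    intro z hz
    have hz' : ∀ n : ℤ, z ≠ n := ne_int_of_re hz (by
      intro n hn
      have : (-5 : ℝ) = 2 * n := by linarith
      have : (-5 : ℤ) = 2 * n := by exact_mod_cast this
      omega)
    have hfun := norm_zeta_functional hz'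
    have hne : ∀ x : ℝ, x ≠ 5 / 4 → z / 2 + x ≠ 0 := by
      intro x hx h
      have := congrArg Complex.re h
      simp [hz] at this
      apply hx; linarith
    have g1 : Complex.Gamma (z / 2 + 1 + 1 + 1) =
        (z / 2 + 1 + 1) * ((z / 2 + 1) * (z / 2 * Complex.Gamma (z / 2))) := by
      rw [Complex.Gamma_add_one, Complex.Gamma_add_one, Complex.Gamma_add_one]
      · simpa using hne 0 (by norm_num)
      · simpa using hne 1 (by norm_num)
      · have := hne 2 (by norm_num)
        intro h; apply this; rw [← h]; push_cast; ring
    have g2 : ‖Complex.Gamma ((1 - z) / 2)‖ = ‖Complex.Gamma (z / 2 + 1 + 1 + 1)‖ :=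
      norm_Gamma_conj_eq (by simp [hz]; norm_num) (by simp; ring)
    have b0 : ∀ x : ℝ, 0 ≤ x → x ≤ 2 → ‖z / 2 + x‖ ≤ 2 * (1 + |z.im|) := by
      intro x hx hx2
      have h1 := Complex.norm_le_abs_re_add_abs_im (z / 2 + x)
      have h2 : |(z / 2 + x).re| ≤ 2 := by
        simp [hz]; rw [abs_le]; constructor <;> linarith
      have h3 : |(z / 2 + x).im| ≤ |z.im| := by simp [abs_div]
      linarith [abs_nonneg z.im]
    have c0 : ‖z / 2‖ ≤ 2 * (1 + |z.im|) := by simpa using b0 0 le_rfl (by norm_num)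
    have c1 : ‖z / 2 + 1‖ ≤ 2 * (1 + |z.im|) := by simpa using b0 1 (by norm_num) (by norm_num)
    have c2 : ‖z / 2 + 1 + 1‖ ≤ 2 * (1 + |z.im|) := by
      have := b0 2 (by norm_num) (by norm_num)
      rwa [show z / 2 + ((2 : ℝ) : ℂ) = z / 2 + 1 + 1 by push_cast; ring] at this
    have hGr : ‖Complex.Gamma ((1 - z) / 2)‖ * ‖(Complex.Gamma (z / 2))⁻¹‖ ≤
        (2 * (1 + |z.im|)) * ((2 * (1 + |z.im|)) * (2 * (1 + |z.im|))) := by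
      rw [g2, g1, norm_mul, norm_mul, norm_mul, norm_inv]
      by_cases hG : ‖Complex.Gamma (z / 2)‖ = 0
      · rw [hG]; simp; positivity
      · calc _ = ‖z / 2 + 1 + 1‖ * (‖z / 2 + 1‖ * ‖z / 2‖) := by field_simp
          _ ≤ _ := by gcongr
    have hpi : Real.pi ^ (z.re - 1 / 2) ≤ 1 :=
      Real.rpow_le_one_of_one_le_of_nonpos (by linarith [Real.pi_gt_three]) (by rw [hz]; norm_num)
    have hz1 : ‖riemannZeta (1 - z)‖ ≤ Z := norm_zeta_le_of_three_halves_le (by simp [hz]; norm_num)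
    have hz2 : ‖z - 1‖ ≤ 4 * (1 + |z.im|) := by
      have h1 := Complex.norm_le_abs_re_add_abs_im (z - 1)
      have h2 : |(z - 1).re| ≤ 4 := by simp [hz]; rw [abs_le]; constructor <;> linarith
      have h3 : |(z - 1).im| = |z.im| := by simp
      linarith [abs_nonneg z.im]
    rw [subOneMulZeta_eq (by simpa using hz' 1), norm_mul, hfun]
    calc ‖z - 1‖ * (‖riemannZeta (1 - z)‖ * (Real.pi ^ (z.re - 1 / 2) *
          (‖Complex.Gamma ((1 - z) / 2)‖ * ‖(Complex.Gamma (z / 2))⁻¹‖)))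
        ≤ (4 * (1 + |z.im|)) * (Z * (1 *
          ((2 * (1 + |z.im|)) * ((2 * (1 + |z.im|)) * (2 * (1 + |z.im|)))))) := by gcongr
      _ = (32 * Z) * (1 + |z.im|) ^ 4 := by ring
      _ ≤ (40 * Z) * (1 + |z.im|) ^ 4 := by gcongr; norm_num
      _ = _ := by norm_cast
  have hu : ∀ z : ℂ, z.re = 3 / 2 → ‖subOneMulZeta z‖ ≤ Z * (1 + |z.im|) ^ (4 : ℝ) := by
    intro z hz
    have hz1 : z ≠ 1 := by rintro rfl; norm_num at hz
    rw [subOneMulZeta_eq hz1, norm_mul, mul_comm]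
    have h1 : ‖z - 1‖ ≤ (1 + |z.im|) ^ (4 : ℝ) := by
      have h1 := Complex.norm_le_abs_re_add_abs_im (z - 1)
      have h2 : |(z - 1).re| ≤ 1 := by simp [hz]; rw [abs_le]; constructor <;> linarith
      have h3 : |(z - 1).im| = |z.im| := by simp
      calc ‖z - 1‖ ≤ (1 + |z.im|) ^ (1 : ℝ) := by rw [Real.rpow_one]; linarith
        _ ≤ _ := Real.rpow_le_rpow_of_exponent_le (by linarith [abs_nonneg z.im]) (by norm_num)
    have h2 := norm_zeta_le_of_three_halves_le hz.ge
    gcongr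
  obtain ⟨K, hK⟩ := exists_norm_le_of_vertical_strip hlu (by norm_num : (0 : ℝ) ≤ 4)
    (by norm_num : (0 : ℝ) ≤ 4) differentiable_subOneMulZeta.diffContOnCl hgr hl hu
  refine ⟨K, 4, by norm_num, fun s h1 h2 => ?_⟩
  have := hK s h1 h2
  convert this using 3
  field_simp
  ring

/-- Polynomial growth of the zeta function away from the real axis. -/
theorem exists_norm_zeta_le : ∃ C A : ℝ, 1 ≤ C ∧ 0 ≤ A ∧ ∀ s : ℂ, -(5 / 2) ≤ s.re → 1 ≤ |s.im| →
    ‖riemannZeta s‖ ≤ C * (1 + |s.im|) ^ A := by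
  obtain ⟨C, A, hA, hC⟩ := exists_norm_subOneMulZeta_le
  set Z := ∑' n : ℕ, 1 / ((n : ℝ) + 1) ^ (3 / 2 : ℝ) with hZ
  have hZ0 : 0 ≤ Z := tsum_nonneg fun n => by positivity
  refine ⟨|C| + Z + 1, A, by linarith [abs_nonneg C], hA, fun s h1 h2 => ?_⟩
  have hone : 1 ≤ (1 + |s.im|) ^ A := Real.one_le_rpow (by linarith) hA
  by_cases h3 : s.re ≤ 3 / 2
  · have hs1 : s ≠ 1 := by rintro rfl; norm_num at h2
    have h4 := hC s h1 h3
    rw [subOneMulZeta_eq hs1, norm_mul] at h4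
    have h5 : 1 ≤ ‖s - 1‖ := h2.trans (by simpa using Complex.abs_im_le_norm (s - 1))
    calc ‖riemannZeta s‖ = 1 * ‖riemannZeta s‖ := (one_mul _).symm
      _ ≤ ‖s - 1‖ * ‖riemannZeta s‖ := by gcongr
      _ ≤ C * (1 + |s.im|) ^ A := h4
      _ ≤ _ := by gcongr; linarith [le_abs_self C]
  · push Not at h3
    calc ‖riemannZeta s‖ ≤ Z := norm_zeta_le_of_three_halves_le h3.le
      _ = Z * 1 := (mul_one _).symm
      _ ≤ (|C| + Z + 1) * (1 + |s.im|) ^ A := by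
        gcongr; linarith [abs_nonneg C]

/-! ### Subpolynomial growth of zeta in zero-free half-planes -/

/-- `L` is a primitive of `h'/h` on the disc, normalised at the centre; then `exp(-L) h` has zero
derivative and equals `1`. -/
lemma exists_log_on_ball {h : ℂ → ℂ} {c : ℂ} {R : ℝ} (hR : 0 < R)
    (hd : DifferentiableOn ℂ h (Metric.ball c R)) (h0 : ∀ z ∈ Metric.ball c R, h z ≠ 0) :
    ∃ L : ℂ → ℂ, DifferentiableOn ℂ L (Metric.ball c R) ∧ L c = Complex.log (h c) ∧
      ∀ z ∈ Metric.ball c R, Complex.exp (L z) = h z := by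
  have hd' : DifferentiableOn ℂ (fun z => deriv h z / h z) (Metric.ball c R) :=
    (hd.deriv Metric.isOpen_ball).div hd h0
  obtain ⟨L, hLc, hL⟩ := hd'.isExactOn_ball.with_val_at c (Complex.log (h c))
  refine ⟨L, fun z hz => (hL z hz).differentiableAt.differentiableWithinAt, hLc, ?_⟩
  have hc : c ∈ Metric.ball c R := Metric.mem_ball_self hR
  set q : ℂ → ℂ := fun z => Complex.exp (-L z) * h z with hq
  have hqd : ∀ z ∈ Metric.ball c R, HasDerivAt q 0 z := by
    intro z hz
    have h1 := ((hL z hz).neg.cexp).mul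
      ((hd.differentiableAt (Metric.isOpen_ball.mem_nhds hz)).hasDerivAt)
    have h2 : Complex.exp (-L z) * -(deriv h z / h z) * h z + Complex.exp (-L z) * deriv h z = 0 := by
      have := h0 z hz
      field_simp
      ring
    rw [← h2]
    exact h1
  have hconst : ∀ z ∈ Metric.ball c R, q z = q c := by
    intro z hz
    refine (convex_ball c R).is_const_of_fderivWithin_eq_zero (𝕜 := ℂ) (f := q) ?_ ?_ hz hc
    · exact fun w hw => (hqd w hw).differentiableAt.differentiableWithinAt
    · intro w hw
      rw [fderivWithin_of_isOpen Metric.isOpen_ball hw]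
      ext
      simp [(hqd w hw).hasFDerivAt.fderiv]
  intro z hz
  have h1 := hconst z hz
  have h2 : q c = 1 := by
    rw [hq]; simp only
    rw [hLc, Complex.exp_neg, Complex.exp_log (h0 c hc), inv_mul_cancel₀ (h0 c hc)]
  rw [h2, hq] at h1
  simp only [Complex.exp_neg] at h1
  have h3 := Complex.exp_ne_zero (L z)
  field_simp at h1
  exact h1.symm

/-- **Hadamard three circles theorem**. -/
theorem three_circles {L : ℂ → ℂ} {c z : ℂ} {r₁ r₃ R M₁ M₃ : ℝ} (hr₁ : 0 < r₁) (h13 : r₁ < r₃)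
    (h3R : r₃ < R) (hL : DifferentiableOn ℂ L (Metric.ball c R))
    (hM₁ : ∀ w, ‖w - c‖ = r₁ → ‖L w‖ ≤ M₁) (hM₃ : ∀ w, ‖w - c‖ = r₃ → ‖L w‖ ≤ M₃)
    (hz₁ : r₁ ≤ ‖z - c‖) (hz₃ : ‖z - c‖ ≤ r₃) :
    ‖L z‖ ≤ M₁ ^ (1 - (Real.log ‖z - c‖ - Real.log r₁) / (Real.log r₃ - Real.log r₁)) *
      M₃ ^ ((Real.log ‖z - c‖ - Real.log r₁) / (Real.log r₃ - Real.log r₁)) := by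
  have hr₃ : 0 < r₃ := hr₁.trans h13
  have hzc : 0 < ‖z - c‖ := hr₁.trans_le hz₁
  have hlog : Real.log r₁ < Real.log r₃ := Real.log_lt_log hr₁ h13
  -- The substitution `w = c + exp u` carries vertical lines to circles about `c`, reducing the
  -- statement to the three lines theorem.
  set h : ℂ → ℂ := fun u => L (c + Complex.exp u) with hh
  have hre : ∀ u : ℂ, ‖c + Complex.exp u - c‖ = Real.exp u.re := by
    intro u; rw [add_sub_cancel_left, Complex.norm_exp]
  have hmaps : ∀ u : ℂ, u.re ≤ Real.log r₃ → c + Complex.exp u ∈ Metric.closedBall c r₃ := by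
    intro u hu
    rw [Metric.mem_closedBall, dist_eq_norm, hre]
    rw [← Real.exp_log hr₃]
    exact Real.exp_le_exp.mpr hu
  have hcb : Metric.closedBall c r₃ ⊆ Metric.ball c R := Metric.closedBall_subset_ball h3R
  have hclos : ∀ u ∈ closure (Complex.HadamardThreeLines.verticalStrip (Real.log r₁) (Real.log r₃)),
      u.re ≤ Real.log r₃ := by
    intro u hu
    have hu' : u ∈ Complex.re ⁻¹' Set.Icc (Real.log r₁) (Real.log r₃) := by
      refine closure_minimal ?_ (isClosed_Icc.preimage Complex.continuous_re) hu
      exact Set.preimage_mono Set.Ioo_subset_Icc_self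
    exact hu'.2
  have hd : DiffContOnCl ℂ h
      (Complex.HadamardThreeLines.verticalStrip (Real.log r₁) (Real.log r₃)) := by
    apply DifferentiableOn.diffContOnCl
    refine hL.comp (by fun_prop) ?_
    intro u hu
    exact hcb (hmaps u (hclos u hu))
  have hbdd : BddAbove ((norm ∘ h) '' Complex.HadamardThreeLines.verticalClosedStrip
      (Real.log r₁) (Real.log r₃)) := by
    obtain ⟨B, hB⟩ := (isCompact_closedBall c r₃).exists_bound_of_continuousOn
      (hL.continuousOn.mono hcb)
    refine ⟨B, ?_⟩
    rintro _ ⟨u, hu, rfl⟩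
    exact hB _ (hmaps u hu.2)
  have hzne : z - c ≠ 0 := norm_pos_iff.mp hzc
  have hlre : (Complex.log (z - c)).re = Real.log ‖z - c‖ := Complex.log_re _
  have key := Complex.HadamardThreeLines.norm_le_interp_of_mem_verticalClosedStrip'
    (z := Complex.log (z - c)) (a := M₁) (b := M₃) hlog ?_ hd hbdd ?_ ?_
  · rw [hlre] at key
    simpa [hh, Complex.exp_log hzne] using key
  · constructor
    · rw [hlre]; exact Real.log_le_log hr₁ hz₁
    · rw [hlre]; exact Real.log_le_log hzc hz₃
  · intro u hu
    have hu : u.re = Real.log r₁ := hu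
    exact hM₁ _ (by rw [hre, hu, Real.exp_log hr₁])
  · intro u hu
    have hu : u.re = Real.log r₃ := hu
    exact hM₃ _ (by rw [hre, hu, Real.exp_log hr₃])

/-- Borel–Carathéodory for a disc with arbitrary centre. -/
lemma norm_le_of_re_le {L : ℂ → ℂ} {c z : ℂ} {R M r K : ℝ} (hM : 0 < M)
    (hL : DifferentiableOn ℂ L (Metric.ball c R)) (hre : ∀ w ∈ Metric.ball c R, (L w).re ≤ M)
    (hK : ‖L c‖ ≤ K) (hr : r < R) (hz : ‖z - c‖ ≤ r) :
    ‖L z‖ ≤ (2 * M * R + 2 * K * R) / (R - r) := by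
  have hr0 : 0 ≤ r := (norm_nonneg _).trans hz
  have hR : 0 < R := hr0.trans_lt hr
  have hK0 : 0 ≤ K := (norm_nonneg _).trans hK
  set f : ℂ → ℂ := fun w => L (c + w) with hf
  have hmaps : ∀ w ∈ Metric.ball (0 : ℂ) R, c + w ∈ Metric.ball c R := by
    intro w hw
    simpa [Metric.mem_ball, dist_eq_norm] using hw
  have hfd : DifferentiableOn ℂ f (Metric.ball 0 R) := hL.comp (by fun_prop) hmaps
  have hzr : z - c ∈ Metric.ball (0 : ℂ) R := by
    rw [Metric.mem_ball, dist_zero_right]; linarith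
  have key := Complex.borelCaratheodory hM hfd (fun w hw => hre _ (hmaps w hw)) hR hzr
  simp only [hf, add_sub_cancel, add_zero] at key
  have hRr : 0 < R - r := sub_pos.mpr hr
  refine key.trans ?_
  rw [← add_div]
  have h1 : 2 * M * ‖z - c‖ + ‖L c‖ * (R + ‖z - c‖) ≤ 2 * M * R + 2 * K * R := by
    have : ‖L c‖ * (R + ‖z - c‖) ≤ K * (R + R) := by gcongr; linarith
    nlinarith
  exact div_le_div₀ (by positivity) h1 hRr (by linarith)

/-- The tail of the Dirichlet series is at most `π²/6 - 1 < 2/3`, so `ζ` stays in a disc about `1`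
on which the principal logarithm is bounded. -/
lemma norm_zeta_sub_one_le {s : ℂ} (hs : 2 ≤ s.re) : ‖riemannZeta s - 1‖ ≤ 2 / 3 := by
  have hsum : Summable fun n : ℕ => 1 / ((n : ℝ) + 1) ^ 2 := by
    have := (summable_nat_add_iff 1).mpr
      (Real.summable_one_div_nat_pow.mpr (by norm_num : 1 < 2))
    simpa using this
  have htot : ∑' n : ℕ, 1 / ((n : ℝ) + 1) ^ 2 = Real.pi ^ 2 / 6 := by
    have h := hasSum_zeta_two
    have h2 := (hasSum_nat_add_iff' (f := fun n : ℕ => 1 / (n : ℝ) ^ 2) 1).mpr h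
    simp at h2
    rw [← h2.tsum_eq]; simp
  have hsum' := (summable_nat_add_iff 1).mpr hsum
  have htail : ∑' n : ℕ, 1 / (((n + 1 : ℕ) : ℝ) + 1) ^ 2 = Real.pi ^ 2 / 6 - 1 := by
    rw [← htot, hsum.tsum_eq_zero_add]; simp
  have hterm : ∀ n : ℕ, ‖1 / ((n : ℂ) + 1) ^ s‖ ≤ 1 / ((n : ℝ) + 1) ^ 2 := by
    intro n
    have hn : (0 : ℝ) < (n : ℝ) + 1 := by positivity
    rw [norm_div, norm_one]
    have : ((n : ℂ) + 1) = ((n + 1 : ℝ) : ℂ) := by push_cast; ring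
    rw [this, Complex.norm_cpow_eq_rpow_re_of_pos hn]
    rw [← Real.rpow_natCast]
    gcongr
    · linarith [(Nat.cast_nonneg n : (0 : ℝ) ≤ n)]
    · simpa using hs
  have hsc : Summable fun n : ℕ => 1 / ((n : ℂ) + 1) ^ s := Summable.of_norm_bounded hsum hterm
  rw [zeta_eq_tsum_one_div_nat_add_one_cpow (by linarith), hsc.tsum_eq_zero_add]
  simp only [Nat.cast_zero, zero_add, Complex.one_cpow, div_one, add_sub_cancel_left]
  refine (tsum_of_norm_bounded hsum'.hasSum fun n => hterm (n + 1)).trans ?_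
  rw [htail]
  have h1 := Real.pi_lt_d2
  have h2 := Real.pi_gt_three
  nlinarith

lemma exists_norm_log_zeta_le : ∃ K : ℝ, 0 ≤ K ∧ ∀ s : ℂ, 2 ≤ s.re →
    ‖Complex.log (riemannZeta s)‖ ≤ K := by
  refine ⟨2, by norm_num, fun s hs => ?_⟩
  have h1 := norm_zeta_sub_one_le hs
  have h2 := Complex.norm_log_one_add_le (z := riemannZeta s - 1) (by linarith)
  rw [add_sub_cancel] at h2
  have h4 : (1 - ‖riemannZeta s - 1‖)⁻¹ ≤ 3 := by
    rw [inv_le_comm₀ (by linarith) (by norm_num)]; linarith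
  have h5 : ‖riemannZeta s - 1‖ ^ 2 ≤ (2 / 3) ^ 2 := by gcongr
  have h6 : ‖riemannZeta s - 1‖ ^ 2 * (1 - ‖riemannZeta s - 1‖)⁻¹ ≤ (2 / 3) ^ 2 * 3 :=
    mul_le_mul h5 h4 (inv_nonneg.mpr (by linarith)) (by norm_num)
  linarith

/-- With `x` of size `log T`, this turns a bound `(log T)^a`, `a < 1`, for `log ζ` into `ε log T +
K`, that is, into `T^ε` for `ζ` itself. -/
lemma exists_rpow_le_mul_add {a ε : ℝ} (ha0 : 0 ≤ a) (ha1 : a < 1) (hε : 0 < ε) :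
    ∃ K : ℝ, 0 ≤ K ∧ ∀ x : ℝ, 0 ≤ x → x ^ a ≤ ε * x + K := by
  set X := (ε⁻¹) ^ (1 / (1 - a)) with hX
  have hXp : 0 < X := Real.rpow_pos_of_pos (inv_pos.mpr hε) _
  refine ⟨X ^ a, by positivity, fun x hx => ?_⟩
  rcases le_total x X with h | h
  · calc x ^ a ≤ X ^ a := Real.rpow_le_rpow hx h ha0
      _ ≤ _ := le_add_of_nonneg_left (by positivity)
  · have hx0 : 0 < x := hXp.trans_le h
    have h1 : x ^ (a - 1) ≤ ε := by
      calc x ^ (a - 1) ≤ X ^ (a - 1) := Real.rpow_le_rpow_of_nonpos hXp h (by linarith)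
        _ = ε := by
          rw [hX, ← Real.rpow_mul (inv_pos.mpr hε).le]
          have h1a : 1 - a ≠ 0 := by linarith
          have : 1 / (1 - a) * (a - 1) = -1 := by field_simp; ring
          rw [this, Real.rpow_neg_one, inv_inv]
    calc x ^ a = x ^ (a - 1) * x := by rw [← Real.rpow_add_one hx0.ne']; ring_nf
      _ ≤ ε * x := by gcongr
      _ ≤ _ := le_add_of_nonneg_right (by positivity)

set_option maxHeartbeats 1000000 in
/-- **Littlewood**: in a half-plane in which zeta has no zeros away from the real axis, zeta and
its reciprocal are of subpolynomial growth. -/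
theorem exists_norm_zeta_le_of_zero_free {Θ₀ : ℝ} (hΘ : -2 ≤ Θ₀) (hΘ1 : Θ₀ ≤ 1)
    (hz : ∀ s : ℂ, Θ₀ < s.re → 1 ≤ |s.im| → riemannZeta s ≠ 0) {δ ε : ℝ} (hδ : 0 < δ)
    (hε : 0 < ε) :
    ∃ C : ℝ, 0 < C ∧ ∀ s : ℂ, Θ₀ + δ ≤ s.re → s.re ≤ 3 → 6 ≤ |s.im| →
      ‖riemannZeta s‖ ≤ C * (1 + |s.im|) ^ ε ∧ ‖(riemannZeta s)⁻¹‖ ≤ C * (1 + |s.im|) ^ ε := by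
  wlog hδ1 : δ ≤ 1 generalizing δ
  · obtain ⟨C, hC0, hC⟩ := this one_pos le_rfl
    exact ⟨C, hC0, fun s h1 h2 h3 => hC s (by push Not at hδ1; linarith) h2 h3⟩
  obtain ⟨C, A, hC1, hA0, hC⟩ := exists_norm_zeta_le
  obtain ⟨K₀, hK₀, hK⟩ := exists_norm_log_zeta_le
  -- The disc of radius `R₀` about `3 + iT` touches the line `Re = Θ₀`. As `R₀ ≤ 5` and `|T| ≥ 6`,
  -- it stays at `|Im| ≥ 1`, away from the pole and inside the zero-free region, so `log ζ` exists
  -- on it.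
  set R₀ := 3 - Θ₀ with hR₀
  have hR₀5 : R₀ ≤ 5 := by linarith
  have hR₀2 : 2 ≤ R₀ := by linarith
  set r₂ := R₀ - δ with hr₂
  set r₃ := R₀ - δ / 2 with hr₃
  set M₁ : ℝ := (2 * 1 * 1 + 2 * K₀ * 1) / (1 - 1 / 2) with hM₁
  have hM₁1 : 1 ≤ M₁ := by rw [hM₁]; norm_num; linarith
  -- The three circles exponent at radius `r₂`, for the inner radius `1/2` and outer radius `r₃`. It
  -- is below `1` because `r₂ < r₃`, and this is the whole gain.
  set a := (Real.log r₂ - Real.log (1 / 2)) / (Real.log r₃ - Real.log (1 / 2)) with ha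
  have hl12 : Real.log (1 / 2) < Real.log r₂ := Real.log_lt_log (by norm_num) (by linarith)
  have hl23 : Real.log r₂ < Real.log r₃ := Real.log_lt_log (by linarith) (by linarith)
  have ha0 : 0 ≤ a := div_nonneg (by linarith) (by linarith)
  have ha1 : a < 1 := by rw [ha, div_lt_one (by linarith)]; linarith
  set β : ℝ := (2 * A * R₀) / (R₀ - r₃) with hβ
  have hRr : 0 < R₀ - r₃ := by rw [hr₃]; linarith
  have hβ0 : 0 ≤ β := by positivity
  -- Chosen so that the final coefficient `M₁ ε' β` of `log (1 + |T|)` is at most `ε`.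
  set ε' := ε / (M₁ * (β + 1)) with hε'
  have hε'0 : 0 < ε' := by positivity
  obtain ⟨K₁, hK₁0, hK₁⟩ := exists_rpow_le_mul_add ha0 ha1 hε'0
  set α : ℝ := M₁ + (2 * (Real.log C + A * Real.log 6 + 1) * R₀ + 2 * K₀ * R₀) / (R₀ - r₃) with hα
  have hlogC : 0 ≤ Real.log C := Real.log_nonneg hC1
  have hlog6 : 0 ≤ Real.log 6 := Real.log_nonneg (by norm_num)
  have hα0 : M₁ ≤ α := by rw [hα]; exact le_add_of_nonneg_right (by positivity)
  set K₂ := M₁ * (ε' * α + K₁) with hK₂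
  have hbase : 0 ≤ M₁ * (ε' * α + K₁) := by positivity
  refine ⟨Real.exp (K₂ + M₁), Real.exp_pos _, fun s hs1 hs2 hs3 => ?_⟩
  set T := s.im with hT
  set c : ℂ := ⟨3, T⟩ with hc
  have hball : ∀ w ∈ Metric.ball c R₀, Θ₀ < w.re ∧ 1 ≤ |w.im| ∧ |w.im| ≤ |T| + 5 := by
    intro w hw
    rw [Metric.mem_ball, dist_eq_norm] at hw
    have h1 : |w.re - 3| < R₀ := (Complex.abs_re_le_norm (w - c)).trans_lt hw
    have h2 : |w.im - T| < R₀ := (Complex.abs_im_le_norm (w - c)).trans_lt hw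
    refine ⟨by have := (abs_lt.mp h1).1; linarith, ?_, ?_⟩
    · have : |T| ≤ |w.im| + |w.im - T| := by
        calc |T| = |w.im - (w.im - T)| := by ring_nf
          _ ≤ _ := abs_sub _ _
      linarith
    · have : |w.im| ≤ |T| + |w.im - T| := by
        calc |w.im| = |T + (w.im - T)| := by ring_nf
          _ ≤ _ := abs_add_le _ _
      linarith
  have hne : ∀ w ∈ Metric.ball c R₀, riemannZeta w ≠ 0 := fun w hw =>
    hz w (hball w hw).1 (hball w hw).2.1
  have hdz : DifferentiableOn ℂ riemannZeta (Metric.ball c R₀) := by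
    intro w hw
    refine (differentiableAt_riemannZeta ?_).differentiableWithinAt
    rintro rfl
    have := (hball 1 hw).2.1
    norm_num at this
  obtain ⟨L, hLd, hLc, hLexp⟩ := exists_log_on_ball (by linarith : 0 < R₀) hdz hne
  have hLre : ∀ w ∈ Metric.ball c R₀, (L w).re = Real.log ‖riemannZeta w‖ := by
    intro w hw
    rw [← hLexp w hw, Complex.norm_exp, Real.log_exp]
  have hLcK : ‖L c‖ ≤ K₀ := by rw [hLc]; exact hK c (by norm_num [hc])
  have hTpos : 0 < 1 + |T| := by positivity
  set M := Real.log C + A * (Real.log 6 + Real.log (1 + |T|)) + 1 with hM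
  have hlogT : 0 ≤ Real.log (1 + |T|) := Real.log_nonneg (by linarith [abs_nonneg T])
  have hMpos : 0 < M := by positivity
  have hreM : ∀ w ∈ Metric.ball c R₀, (L w).re ≤ M := by
    intro w hw
    obtain ⟨h1, h2, h3⟩ := hball w hw
    rw [hLre w hw]
    have h4 := hC w (by linarith) h2
    have h5 : Real.log ‖riemannZeta w‖ ≤ Real.log (C * (6 * (1 + |T|)) ^ A) := by
      apply Real.log_le_log (norm_pos_iff.mpr (hne w hw))
      refine h4.trans ?_
      gcongr
      linarith
    have h6 : Real.log (C * (6 * (1 + |T|)) ^ A) =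
        Real.log C + A * (Real.log 6 + Real.log (1 + |T|)) := by
      rw [Real.log_mul (by linarith) (by positivity), Real.log_rpow (by positivity),
        Real.log_mul (by norm_num) (by positivity)]
    linarith
  have hsub : Metric.ball c 1 ⊆ Metric.ball c R₀ := Metric.ball_subset_ball (by linarith)
  have hre1 : ∀ w ∈ Metric.ball c 1, (L w).re ≤ 1 := by
    intro w hw
    rw [hLre w (hsub hw)]
    have h1 : |w.re - 3| < 1 := by
      rw [Metric.mem_ball, dist_eq_norm] at hw
      exact (Complex.abs_re_le_norm (w - c)).trans_lt hw
    have h2 := norm_zeta_sub_one_le (s := w) (by have := (abs_lt.mp h1).1; linarith)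
    have h3 : ‖riemannZeta w‖ ≤ 2 := by
      calc ‖riemannZeta w‖ = ‖(riemannZeta w - 1) + 1‖ := by ring_nf
        _ ≤ ‖riemannZeta w - 1‖ + ‖(1 : ℂ)‖ := norm_add_le _ _
        _ ≤ 2 := by rw [norm_one]; linarith
    calc Real.log ‖riemannZeta w‖ ≤ ‖riemannZeta w‖ - 1 :=
          Real.log_le_sub_one_of_pos (norm_pos_iff.mpr (hne w (hsub hw)))
      _ ≤ 1 := by linarith
  have hin : ∀ w, ‖w - c‖ ≤ 1 / 2 → ‖L w‖ ≤ M₁ := fun w hw =>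
    norm_le_of_re_le one_pos (hLd.mono hsub) hre1 hLcK (by norm_num) hw
  -- Borel–Carathéodory, fed with the polynomial bound for `ζ`, gives `log ζ = O(log T)` on the
  -- circle of radius `r₃`; on the inner disc `log ζ` is bounded by `M₁`, independently of `T`.
  set M₃ := α + β * Real.log (1 + |T|) with hM₃
  have hM13 : M₁ ≤ M₃ := by rw [hM₃]; have : 0 ≤ β * Real.log (1 + |T|) := by positivity
                            linarith
  have hout : ∀ w, ‖w - c‖ ≤ r₃ → ‖L w‖ ≤ M₃ := by
    intro w hw
    refine (norm_le_of_re_le hMpos hLd hreM hLcK (by linarith : r₃ < R₀) hw).trans ?_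
    rw [hM₃, hα, hβ, hM]
    have : (2 * (Real.log C + A * (Real.log 6 + Real.log (1 + |T|)) + 1) * R₀ + 2 * K₀ * R₀) /
        (R₀ - r₃) = (2 * (Real.log C + A * Real.log 6 + 1) * R₀ + 2 * K₀ * R₀) / (R₀ - r₃) +
        2 * A * R₀ / (R₀ - r₃) * Real.log (1 + |T|) := by ring
    rw [this]
    linarith
  have hsc : ‖s - c‖ = 3 - s.re := by
    have : s - c = ((s.re - 3 : ℝ) : ℂ) := by
      apply Complex.ext <;> simp [hc, hT]
    rw [this, Complex.norm_real, Real.norm_eq_abs, abs_sub_comm, abs_of_nonneg (by linarith)]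
  have hsr₂ : ‖s - c‖ ≤ r₂ := by rw [hsc]; linarith
  have hM₁0 : 0 < M₁ := by linarith
  have hM₃0 : 0 < M₃ := by linarith
  have hLs : ‖L s‖ ≤ M₁ + M₁ * M₃ ^ a := by
    by_cases hsm : ‖s - c‖ ≤ 1 / 2
    · exact (hin s hsm).trans (le_add_of_nonneg_right (by positivity))
    · push Not at hsm
      have h13 : (1 / 2 : ℝ) < r₃ := by linarith
      have key := three_circles (z := s) (by norm_num : (0 : ℝ) < 1 / 2) h13
        (by linarith : r₃ < R₀) hLd (fun w hw => hin w hw.le) (fun w hw => hout w hw.le) hsm.le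
        (by linarith)
      set θ := (Real.log ‖s - c‖ - Real.log (1 / 2)) / (Real.log r₃ - Real.log (1 / 2)) with hθ
      have hθ0 : 0 ≤ θ := div_nonneg
        (sub_nonneg.mpr (Real.log_le_log (by norm_num) hsm.le)) (by linarith)
      have hθa : θ ≤ a := by
        rw [hθ, ha]
        have : 0 < Real.log r₃ - Real.log (1 / 2) := by linarith
        gcongr
      have h1 : M₁ ^ (1 - θ) ≤ M₁ := by
        calc M₁ ^ (1 - θ) ≤ M₁ ^ (1 : ℝ) :=
              Real.rpow_le_rpow_of_exponent_le hM₁1 (by linarith)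
          _ = M₁ := Real.rpow_one _
      have h2 : M₃ ^ θ ≤ M₃ ^ a := Real.rpow_le_rpow_of_exponent_le (by linarith) hθa
      calc ‖L s‖ ≤ M₁ ^ (1 - θ) * M₃ ^ θ := key
        _ ≤ M₁ * M₃ ^ a := by gcongr
        _ ≤ _ := le_add_of_nonneg_left hM₁0.le
  have hfin : ‖L s‖ ≤ (K₂ + M₁) + ε * Real.log (1 + |T|) := by
    have h1 := hK₁ M₃ hM₃0.le
    have h2 : M₁ * M₃ ^ a ≤ M₁ * (ε' * M₃ + K₁) := by gcongr
    have h3 : M₁ * (ε' * M₃ + K₁) = K₂ + M₁ * ε' * β * Real.log (1 + |T|) := by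
      rw [hM₃, hK₂]; ring
    have h4 : M₁ * ε' * β ≤ ε := by
      rw [hε']
      have : M₁ * (ε / (M₁ * (β + 1))) * β = ε * (β / (β + 1)) := by field_simp
      rw [this]
      have : β / (β + 1) ≤ 1 := by rw [div_le_one (by positivity)]; linarith
      exact mul_le_of_le_one_right hε.le this
    have h5 : M₁ * ε' * β * Real.log (1 + |T|) ≤ ε * Real.log (1 + |T|) := by gcongr
    linarith
  have hsball : s ∈ Metric.ball c R₀ := by
    rw [Metric.mem_ball, dist_eq_norm]; linarith
  have hE : Real.exp ((K₂ + M₁) + ε * Real.log (1 + |T|)) =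
      Real.exp (K₂ + M₁) * (1 + |T|) ^ ε := by
    rw [Real.exp_add, Real.rpow_def_of_pos hTpos, mul_comm ε]
  rw [← hE, ← hLexp s hsball, ← Complex.exp_neg, Complex.norm_exp, Complex.norm_exp,
    Real.exp_le_exp, Real.exp_le_exp]
  exact ⟨((Complex.re_le_norm _).trans hfin),
    ((Complex.re_le_norm _).trans (by rw [norm_neg]; exact hfin))⟩

/-! ### Nontrivial zeros -/

/-- The Riemann zeta function has a nontrivial zero. -/
theorem nontrivialZeros_nonempty : nontrivialZeros.Nonempty := by
  by_contra hempty
  rw [Set.not_nonempty_iff_eq_empty] at hempty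
  -- Without nontrivial zeros, `ζ` could vanish only on the real axis, so Littlewood's bound would
  -- hold in all of `Re s ≥ -1`.
  have hz : ∀ s : ℂ, (-2 : ℝ) < s.re → 1 ≤ |s.im| → riemannZeta s ≠ 0 := by
    intro s _ him hs
    have h0 : s ≠ 0 := by rintro rfl; norm_num at him
    have h1 : s ≠ 1 := by rintro rfl; norm_num at him
    have hG : Complex.Gammaℝ s ≠ 0 := by
      rw [Ne, Complex.Gammaℝ_eq_zero_iff]
      rintro ⟨n, rfl⟩
      norm_num at him
    rw [riemannZeta_def_of_ne_zero h0, div_eq_zero_iff] at hs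
    have : s ∈ nontrivialZeros := ⟨h0, h1, hs.resolve_right hG⟩
    rw [hempty] at this
    exact this
  obtain ⟨C, hC0, hC⟩ := exists_norm_zeta_le_of_zero_free le_rfl (by norm_num) hz
    (δ := 1) (ε := 1 / 4) one_pos (by norm_num)
  -- On `Re s = -1/2` the functional equation gives `|ζ(s)| / |ζ(1 - s)| = |s| / (2π)` exactly. This
  -- grows linearly, whereas the bounds with exponent `1/4` for `ζ` and `1/ζ` would allow only a
  -- square root.
  have hlow : ∀ s : ℂ, s.re = -(1 / 2) → 6 ≤ |s.im| →
      Real.pi ^ (-1 : ℝ) * (|s.im| / 2) ≤ (C * (1 + |s.im|) ^ (1 / 4 : ℝ)) * (C * (1 + |s.im|) ^ (1 / 4 : ℝ)) := by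
    intro s hs him
    have hs' : ∀ n : ℤ, s ≠ n := ne_int_of_re hs (by
      intro n hn
      have : (-1 : ℝ) = 2 * n := by linarith
      have : (-1 : ℤ) = 2 * n := by exact_mod_cast this
      omega)
    have hfun := norm_zeta_functional hs'
    have hs2 : s / 2 ≠ 0 := by simpa using hs' 0
    have g1 : Complex.Gamma (s / 2 + 1) = s / 2 * Complex.Gamma (s / 2) :=
      Complex.Gamma_add_one _ hs2
    have g2 : ‖Complex.Gamma ((1 - s) / 2)‖ = ‖Complex.Gamma (s / 2 + 1)‖ :=
      norm_Gamma_conj_eq (by simp [hs]; norm_num) (by simp; ring)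
    have hG0 : Complex.Gamma (s / 2) ≠ 0 := by
      apply Complex.Gamma_ne_zero
      intro m hm
      have := hs' (-2 * m)
      apply this
      push_cast
      linear_combination 2 * hm
    rw [g2, g1, norm_mul, norm_inv, mul_assoc, mul_inv_cancel₀ (norm_ne_zero_iff.mpr hG0), mul_one,
      hs] at hfun
    have b1 := (hC s (by rw [hs]; norm_num) (by rw [hs]; norm_num) him).1
    have b2 := (hC (1 - s) (by simp [hs]; norm_num) (by simp [hs]; norm_num) (by simpa using him)).2
    have him' : |(1 - s).im| = |s.im| := by simp
    rw [him'] at b2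
    have hne : riemannZeta (1 - s) ≠ 0 := hz _ (by simp [hs]; norm_num) (by rw [him']; linarith)
    have e1 : |s.im| / 2 ≤ ‖s / 2‖ := by
      rw [norm_div, Complex.norm_two]
      have := Complex.abs_im_le_norm s
      linarith
    have hne' : 0 < ‖riemannZeta (1 - s)‖ := norm_pos_iff.mpr hne
    calc Real.pi ^ (-1 : ℝ) * (|s.im| / 2)
        ≤ Real.pi ^ (-1 : ℝ) * ‖s / 2‖ := by gcongr
      _ = ‖riemannZeta s‖ * ‖(riemannZeta (1 - s))⁻¹‖ := by
          rw [hfun, norm_inv]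
          field_simp
          norm_num
      _ ≤ _ := by gcongr
  -- The comparison at height `Y` forces `Y ≤ (4πC²)²`; the summand `6` both contradicts this and
  -- puts `Y` in the range of the bound.
  set Y : ℝ := (4 * Real.pi * C ^ 2) ^ 2 + 6 with hY
  have hYp : 6 ≤ Y := by rw [hY]; linarith [sq_nonneg (4 * Real.pi * C ^ 2)]
  have h := hlow ⟨-(1 / 2), Y⟩ rfl (by simpa [abs_of_nonneg (by linarith : (0 : ℝ) ≤ Y)] using hYp)
  simp only [abs_of_nonneg (by linarith : (0 : ℝ) ≤ Y)] at h
  have e1 : (C * (1 + Y) ^ (1 / 4 : ℝ)) * (C * (1 + Y) ^ (1 / 4 : ℝ)) = C ^ 2 * Real.sqrt (1 + Y) := by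
    have : (1 + Y) ^ (1 / 4 : ℝ) * (1 + Y) ^ (1 / 4 : ℝ) = Real.sqrt (1 + Y) := by
      rw [← Real.rpow_add (by linarith), Real.sqrt_eq_rpow]; norm_num
    rw [← this]; ring
  rw [e1, Real.rpow_neg_one] at h
  have hpi := Real.pi_pos
  have h2 : Y ≤ 2 * Real.pi * C ^ 2 * Real.sqrt (1 + Y) := by
    have : Real.pi⁻¹ * (Y / 2) = Y / (2 * Real.pi) := by field_simp
    rw [this, div_le_iff₀ (by positivity)] at h
    linarith
  have h3 : Real.sqrt (1 + Y) ≤ Real.sqrt (4 * Y) := Real.sqrt_le_sqrt (by linarith)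
  have h4 : Real.sqrt (4 * Y) = 2 * Real.sqrt Y := by
    rw [Real.sqrt_mul (by norm_num)]
    have : Real.sqrt 4 = 2 := by rw [show (4 : ℝ) = 2 ^ 2 by norm_num]; simp
    rw [this]
  have h5 : Real.sqrt Y * Real.sqrt Y ≤ 4 * Real.pi * C ^ 2 * Real.sqrt Y := by
    rw [Real.mul_self_sqrt (by linarith)]
    calc Y ≤ 2 * Real.pi * C ^ 2 * (2 * Real.sqrt Y) := by
          refine h2.trans ?_
          rw [← h4]; gcongr
      _ = _ := by ring
  have hsY : 0 < Real.sqrt Y := Real.sqrt_pos.mpr (by linarith)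
  have h6 : Real.sqrt Y ≤ 4 * Real.pi * C ^ 2 := le_of_mul_le_mul_right h5 hsY
  have h7 : Y ≤ (4 * Real.pi * C ^ 2) ^ 2 := by
    calc Y = Real.sqrt Y ^ 2 := (Real.sq_sqrt (by linarith)).symm
      _ ≤ _ := by gcongr
  linarith

lemma re_lt_one_of_mem_nontrivialZeros {s : ℂ} (hs : s ∈ nontrivialZeros) : s.re < 1 := by
  by_contra! h
  apply riemannZeta_ne_zero_of_one_le_re h
  rw [riemannZeta_def_of_ne_zero hs.1, hs.2.2, zero_div]

lemma bddAbove_re_nontrivialZeros : BddAbove (Complex.re '' nontrivialZeros) := by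
  refine ⟨1, ?_⟩
  rintro _ ⟨s, hs, rfl⟩
  exact (re_lt_one_of_mem_nontrivialZeros hs).le

lemma supRealPart_le_one : supRealPart ≤ 1 := by
  refine csSup_le (nontrivialZeros_nonempty.image _) ?_
  rintro _ ⟨s, hs, rfl⟩
  exact (re_lt_one_of_mem_nontrivialZeros hs).le

/-- The symmetry `ρ ↦ 1 - ρ` puts one of each pair on or to the right of the critical line.
Existence of a zero is essential, since the supremum of the empty set of reals is `0` by convention.
-/
lemma half_le_supRealPart : 1 / 2 ≤ supRealPart := by
  obtain ⟨s, hs⟩ := nontrivialZeros_nonempty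
  have hs' : 1 - s ∈ nontrivialZeros := by
    refine ⟨sub_ne_zero.mpr hs.2.1.symm, fun h => hs.1 (by linear_combination -h), ?_⟩
    rw [completedRiemannZeta_one_sub, hs.2.2]
  have h1 := le_csSup bddAbove_re_nontrivialZeros (Set.mem_image_of_mem Complex.re hs)
  have h2 := le_csSup bddAbove_re_nontrivialZeros (Set.mem_image_of_mem Complex.re hs')
  simp only [Complex.sub_re, Complex.one_re] at h2
  change _ ≤ supRealPart at h1 h2
  linarith

lemma xiFun_ne_zero {s : ℂ} (hs : supRealPart < s.re) : xiFun s ≠ 0 := by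
  have h0 : s ≠ 0 := by rintro rfl; simp at hs; linarith [half_le_supRealPart]
  rcases eq_or_ne s 1 with rfl | h1
  · simp [xiFun]
  · rw [xiFun_eq h0 h1]
    refine mul_ne_zero (mul_ne_zero h0 (sub_ne_zero.mpr h1)) fun h => ?_
    have := le_csSup bddAbove_re_nontrivialZeros
      (Set.mem_image_of_mem Complex.re (⟨h0, h1, h⟩ : s ∈ nontrivialZeros))
    exact absurd hs (not_lt.mpr this)

lemma zeta_ne_zero_of_supRealPart_lt {s : ℂ} (hs : supRealPart < s.re) (h1 : s ≠ 1) :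
    riemannZeta s ≠ 0 := by
  have h0 : s ≠ 0 := by rintro rfl; simp at hs; linarith [half_le_supRealPart]
  rw [riemannZeta_def_of_ne_zero h0]
  refine div_ne_zero (fun h => xiFun_ne_zero hs ?_)
    (Complex.Gammaℝ_ne_zero_of_re_pos (by linarith [half_le_supRealPart]))
  rw [xiFun_eq h0 h1, h, mul_zero]

/-! ### Contour shift in Mellin inversion -/

lemma integrable_one_add_abs_rpow {η : ℝ} (hη : 0 < η) :
    Integrable fun t : ℝ => (1 + |t|) ^ (-1 - η) := by
  have h := integrable_one_add_norm (E := ℝ) (μ := volume) (r := 1 + η) (by simp; linarith)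
  simpa [Real.norm_eq_abs, neg_add, sub_eq_add_neg, add_comm] using h

/-- Cauchy's theorem on the rectangles `|Im s| ≤ T`: the horizontal sides vanish as `T → ∞`. -/
lemma integral_vertical_eq_of_decay {G : ℂ → ℂ} {σ₀ σ₁ C η : ℝ} (h01 : σ₀ ≤ σ₁) (hη : 0 < η)
    (hG : DifferentiableOn ℂ G (Complex.re ⁻¹' Set.Icc σ₀ σ₁))
    (hb : ∀ s : ℂ, σ₀ ≤ s.re → s.re ≤ σ₁ → ‖G s‖ ≤ C * (1 + |s.im|) ^ (-1 - η)) :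
    ∫ t : ℝ, G (σ₁ + t * Complex.I) = ∫ t : ℝ, G (σ₀ + t * Complex.I) := by
  have hC : 0 ≤ C := by
    have := (norm_nonneg _).trans (hb (σ₀ : ℂ) (by simp) (by simpa using h01))
    simpa using this
  have hint : ∀ σ, σ₀ ≤ σ → σ ≤ σ₁ → Integrable fun t : ℝ => G (σ + t * Complex.I) := by
    intro σ h1 h2
    refine ((integrable_one_add_abs_rpow hη).const_mul C).mono' ?_ ?_
    · have : Continuous fun t : ℝ => G (σ + t * Complex.I) := by
        refine hG.continuousOn.comp_continuous (by fun_prop) fun t => ?_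
        simpa using ⟨h1, h2⟩
      exact this.aestronglyMeasurable
    · refine Eventually.of_forall fun t => ?_
      simpa using hb (σ + t * Complex.I) (by simpa using h1) (by simpa using h2)
  have hlim : ∀ σ, σ₀ ≤ σ → σ ≤ σ₁ → Tendsto (fun T : ℝ => ∫ t in -T..T, G (σ + t * Complex.I))
      atTop (𝓝 (∫ t : ℝ, G (σ + t * Complex.I))) := fun σ h1 h2 =>
    intervalIntegral_tendsto_integral (hint σ h1 h2) tendsto_neg_atTop_atBot tendsto_id
  have hhor : ∀ ε : ℝ, (ε = 1 ∨ ε = -1) →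
      Tendsto (fun T : ℝ => ∫ x in σ₀..σ₁, G (x + (ε * T : ℝ) * Complex.I)) atTop (𝓝 0) := by
    intro ε hε
    have hε' : |ε| = 1 := by rcases hε with rfl | rfl <;> simp
    have hz : Tendsto (fun T : ℝ => C * (1 + |T|) ^ (-1 - η) * |σ₁ - σ₀|) atTop (𝓝 0) := by
      have h1 : Tendsto (fun T : ℝ => (1 + |T|) ^ (-(1 + η))) atTop (𝓝 0) := by
        refine (tendsto_rpow_neg_atTop (by linarith)).comp ?_
        exact tendsto_atTop_add_const_left _ _ tendsto_abs_atTop_atTop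
      have h2 := (h1.const_mul C).mul_const |σ₁ - σ₀|
      simpa [neg_add, sub_eq_add_neg, add_comm] using h2
    refine squeeze_zero_norm (fun T => ?_) hz
    refine intervalIntegral.norm_integral_le_of_norm_le_const fun x hx => ?_
    rw [Set.uIoc_of_le h01] at hx
    have := hb (x + (ε * T : ℝ) * Complex.I) (by simpa using hx.1.le) (by simpa using hx.2)
    have him : ((x : ℂ) + (ε * T : ℝ) * Complex.I).im = ε * T := by
      rw [Complex.add_im, Complex.im_ofReal_mul]; simp
    rwa [him, abs_mul, hε', one_mul] at this
  have hrect : ∀ T : ℝ, (∫ x in σ₀..σ₁, G (x + ((-1 : ℝ) * T : ℝ) * Complex.I)) -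
      (∫ x in σ₀..σ₁, G (x + ((1 : ℝ) * T : ℝ) * Complex.I)) +
      Complex.I • (∫ t in -T..T, G (σ₁ + t * Complex.I)) -
      Complex.I • (∫ t in -T..T, G (σ₀ + t * Complex.I)) = 0 := by
    intro T
    have := Complex.integral_boundary_rect_eq_zero_of_differentiableOn G
      ⟨σ₀, -T⟩ ⟨σ₁, T⟩ (hG.mono ?_)
    · simpa using this
    · intro s hs
      rw [Complex.mem_reProdIm, Set.uIcc_of_le h01] at hs
      exact hs.1
  have hT := (((hhor (-1) (Or.inr rfl)).sub (hhor 1 (Or.inl rfl))).add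
    ((hlim σ₁ h01 le_rfl).const_smul Complex.I)).sub ((hlim σ₀ le_rfl h01).const_smul Complex.I)
  simp only [hrect] at hT
  have h0 := tendsto_nhds_unique hT tendsto_const_nhds
  rw [sub_zero, zero_add, ← smul_sub, smul_eq_zero] at h0
  exact sub_eq_zero.mp (h0.resolve_left Complex.I_ne_zero)

/-- If the Mellin transform of `α` continues to the left with integrable decay on vertical lines,
then `α` is correspondingly small at `0`. -/
theorem exists_norm_le_of_mellin_continuation {α : ℝ → ℂ} {H : ℂ → ℂ} {σ₀ σ₁ C η : ℝ}
    (h01 : σ₀ ≤ σ₁) (hη : 0 < η) (hcont : ContinuousOn α (Set.Ioi 0))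
    (hconv : MellinConvergent α (σ₁ : ℂ))
    (hH : DifferentiableOn ℂ H (Complex.re ⁻¹' Set.Icc σ₀ σ₁))
    (heq : ∀ s : ℂ, s.re = σ₁ → mellin α s = H s)
    (hb : ∀ s : ℂ, σ₀ ≤ s.re → s.re ≤ σ₁ → ‖H s‖ ≤ C * (1 + |s.im|) ^ (-1 - η)) :
    ∃ K : ℝ, ∀ y : ℝ, 0 < y → ‖α y‖ ≤ K * y ^ (-σ₀) := by
  have hC : 0 ≤ C := by
    have := (norm_nonneg _).trans (hb (σ₀ : ℂ) (by simp) (by simpa using h01))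
    simpa using this
  have hI := integrable_one_add_abs_rpow hη
  refine ⟨‖(1 / (2 * Real.pi) : ℝ)‖ * (C * ∫ t : ℝ, (1 + |t|) ^ (-1 - η)), fun y hy => ?_⟩
  have hy0 : (y : ℂ) ≠ 0 := by exact_mod_cast hy.ne'
  set G : ℂ → ℂ := fun s => (y : ℂ) ^ (-s) * H s with hGdef
  have hpow : ∀ s : ℂ, ‖(y : ℂ) ^ (-s)‖ = y ^ (-s.re) := fun s => by
    rw [Complex.norm_cpow_eq_rpow_re_of_pos hy]; simp
  have hGd : DifferentiableOn ℂ G (Complex.re ⁻¹' Set.Icc σ₀ σ₁) := by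
    refine DifferentiableOn.mul (fun s _ => ?_) hH
    exact (DifferentiableAt.const_cpow (by fun_prop) (Or.inl hy0)).differentiableWithinAt
  have hGb : ∀ s : ℂ, σ₀ ≤ s.re → s.re ≤ σ₁ →
      ‖G s‖ ≤ ((y ^ (-σ₀) + y ^ (-σ₁)) * C) * (1 + |s.im|) ^ (-1 - η) := by
    intro s h1 h2
    rw [hGdef, norm_mul, hpow, mul_assoc]
    refine mul_le_mul ?_ (hb s h1 h2) (norm_nonneg _) (by positivity)
    rcases le_total y 1 with h | h
    · calc y ^ (-s.re) ≤ y ^ (-σ₁) := Real.rpow_le_rpow_of_exponent_ge hy h (by linarith)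
        _ ≤ _ := le_add_of_nonneg_left (by positivity)
    · calc y ^ (-s.re) ≤ y ^ (-σ₀) := Real.rpow_le_rpow_of_exponent_le h (by linarith)
        _ ≤ _ := le_add_of_nonneg_right (by positivity)
  have hvert : Complex.VerticalIntegrable (mellin α) σ₁ := by
    have e : (fun t : ℝ => mellin α (σ₁ + t * Complex.I)) = fun t : ℝ => H (σ₁ + t * Complex.I) := by
      funext t; exact heq _ (by simp)
    rw [Complex.VerticalIntegrable, e]
    refine (hI.const_mul C).mono' ?_ ?_
    · have : Continuous fun t : ℝ => H (σ₁ + t * Complex.I) := by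
        refine hH.continuousOn.comp_continuous (by fun_prop) fun t => ?_
        simpa using h01
      exact this.aestronglyMeasurable
    · refine Eventually.of_forall fun t => ?_
      simpa using hb (σ₁ + t * Complex.I) (by simpa using h01) (by simp)
  have hinv := mellinInv_mellin_eq σ₁ α hy hconv hvert (hcont.continuousAt (Ioi_mem_nhds hy))
  have hmi : mellinInv σ₁ (mellin α) y = (1 / (2 * Real.pi) : ℝ) •
      ∫ t : ℝ, G (σ₁ + t * Complex.I) := by
    rw [mellinInv]
    congr 1
    refine integral_congr_ae (Eventually.of_forall fun t => ?_)
    simp only [hGdef, smul_eq_mul]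
    rw [heq _ (by simp)]
  -- Inversion takes place on `Re s = σ₁`, where the Mellin transform converges. After the shift
  -- only `H` remains, and `|y^(-s)| = y^(-σ₀)` is constant on the new line.
  rw [← hinv, hmi, integral_vertical_eq_of_decay h01 hη hGd hGb, norm_smul, mul_assoc]
  refine mul_le_mul_of_nonneg_left ?_ (norm_nonneg _)
  refine (norm_integral_le_of_norm_le ((hI.const_mul (y ^ (-σ₀) * C))) ?_).trans (le_of_eq ?_)
  · refine Eventually.of_forall fun t => ?_
    rw [hGdef]
    simp only [norm_mul]
    rw [hpow, mul_assoc]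
    have h1 := hb (σ₀ + t * Complex.I) (by simp) (by simpa using h01)
    simp only [Complex.add_re, Complex.ofReal_re, Complex.mul_re, Complex.I_re, mul_zero,
      Complex.ofReal_im, Complex.I_im, mul_one, sub_self, add_zero, Complex.add_im, Complex.mul_im,
      zero_add] at h1 ⊢
    gcongr
  · rw [integral_const_mul]; ring

/-! ### Invariance of the hyperbolic Laplacian -/

lemma laplacian_eq_fderiv_fderiv (F : ℂ → ℂ) (z : ℂ) :
    Laplacian.laplacian F z =
      fderiv ℝ (fderiv ℝ F) z 1 1 + fderiv ℝ (fderiv ℝ F) z Complex.I Complex.I := by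
  rw [InnerProductSpace.laplacian_eq_iteratedFDeriv_complexPlane]
  simp [iteratedFDeriv_two_apply]

/-- Multiplication by a complex number as a real-linear map. -/
def mulMap : ℂ →L[ℝ] (ℂ →L[ℝ] ℂ) := ContinuousLinearMap.mul ℝ ℂ

lemma hasFDerivAt_real_of_deriv {φ : ℂ → ℂ} {w a : ℂ} (h : HasDerivAt φ a w) :
    HasFDerivAt φ (mulMap a) w := by
  have := h.complexToReal_fderiv
  convert this using 1
  ext v; simp [mulMap]

/-- The Laplacian of the composition of a twice differentiable function with a holomorphic one. -/
theorem laplacian_comp_holomorphic {F φ : ℂ → ℂ} {z : ℂ} (hφ : AnalyticAt ℂ φ z)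
    (hF : ∀ᶠ w in 𝓝 (φ z), DifferentiableAt ℝ F w)
    (hF2 : DifferentiableAt ℝ (fderiv ℝ F) (φ z)) :
    Laplacian.laplacian (F ∘ φ) z = (‖deriv φ z‖ ^ 2 : ℝ) • Laplacian.laplacian F (φ z) := by
  have hφd : ∀ᶠ w in 𝓝 z, HasFDerivAt φ (mulMap (deriv φ w)) w := by
    filter_upwards [hφ.eventually_analyticAt] with w hw
    exact hasFDerivAt_real_of_deriv hw.differentiableAt.hasDerivAt
  have h1 : fderiv ℝ (F ∘ φ) =ᶠ[𝓝 z] fun w => (fderiv ℝ F (φ w)).comp (mulMap (deriv φ w)) := by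
    filter_upwards [hφd, hφ.continuousAt.eventually hF] with w hw hFw
    exact (hFw.hasFDerivAt.comp w hw).fderiv
  have hc : HasFDerivAt (fun w => fderiv ℝ F (φ w))
      ((fderiv ℝ (fderiv ℝ F) (φ z)).comp (mulMap (deriv φ z))) z :=
    hF2.hasFDerivAt.comp z hφd.self_of_nhds
  have hd : HasFDerivAt (fun w => mulMap (deriv φ w))
      (mulMap.comp (mulMap (deriv (deriv φ) z))) z :=
    mulMap.hasFDerivAt.comp z
      (hasFDerivAt_real_of_deriv hφ.deriv.differentiableAt.hasDerivAt)
  have h2 := (hc.clm_comp hd).congr_of_eventuallyEq h1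
  set D := fderiv ℝ (fderiv ℝ F) (φ z) with hD
  rw [laplacian_eq_fderiv_fderiv, h2.fderiv, laplacian_eq_fderiv_fderiv]
  simp only [add_apply, ContinuousLinearMap.comp_apply,
    ContinuousLinearMap.flip_apply, ContinuousLinearMap.compL_apply, mulMap,
    ContinuousLinearMap.mul_apply', mul_one]
  set a := deriv φ z with ha
  set b := deriv (deriv φ) z
  -- The terms with `φ''` cancel because `1² + i² = 0`. In `D(a, a) + D(ia, ia)` the mixed terms
  -- cancel in pairs, without any appeal to symmetry of the second derivative.
  have hII : b * Complex.I * Complex.I = -b := by rw [mul_assoc, Complex.I_mul_I]; ring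
  have ea : a = a.re • (1 : ℂ) + a.im • Complex.I := by
    apply Complex.ext <;> simp
  have eaI : a * Complex.I = (-a.im) • (1 : ℂ) + a.re • Complex.I := by
    apply Complex.ext <;> simp
  have hn : ‖a‖ ^ 2 = a.re * a.re + a.im * a.im := by
    rw [← Complex.normSq_eq_norm_sq, Complex.normSq_apply]
  have e1 : D a a = (a.re * a.re) • D 1 1 + (a.re * a.im) • D 1 Complex.I +
      (a.im * a.re) • D Complex.I 1 + (a.im * a.im) • D Complex.I Complex.I := by
    conv_lhs => rw [ea]
    simp only [map_add, map_smul, add_apply, smul_apply]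
    module
  have e2 : D (a * Complex.I) (a * Complex.I) = (a.im * a.im) • D 1 1 - (a.re * a.im) • D 1 Complex.I -
      (a.im * a.re) • D Complex.I 1 + (a.re * a.re) • D Complex.I Complex.I := by
    rw [eaI]
    simp only [map_add, map_smul, add_apply, smul_apply]
    module
  rw [hII, map_neg, e1, e2, hn]
  module

/-- The action is holomorphic with `|γ'(z)| = Im(γz) / Im z`, so the factor `y²` exactly compensates
the change of the Euclidean Laplacian. Invariance is what allows `Δf` to be unfolded. -/
lemma hypLaplacian_invariant {f : ℍ → ℂ} (hmod : IsModularInvariant f)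
    (hdiff : IsTwiceDifferentiable f) : IsModularInvariant (hypLaplacian f) := by
  intro γ τ
  set g : GL (Fin 2) ℝ := (γ : GL (Fin 2) ℝ) with hg
  have hdet : g.val.det = 1 :=
    ((Matrix.SpecialLinearGroup.map (Int.castRingHom ℝ)) γ).det_coe
  have hpos : 0 < g.val.det := by rw [hdet]; exact one_pos
  set φ : ℂ → ℂ := fun z => ((g • ofComplex z : ℍ) : ℂ) with hφ
  have hφτ : φ τ = ((γ • τ : ℍ) : ℂ) := by simp only [hφ, ofComplex_apply]; rfl
  have hcomp : (f ∘ ofComplex) ∘ φ = f ∘ ofComplex := by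
    funext z
    simp only [Function.comp, hφ, ofComplex_apply]
    exact hmod γ _
  have hmem : φ τ ∈ upperHalfPlaneSet := by rw [hφτ]; exact (γ • τ).im_pos
  have hopen := isOpen_upperHalfPlaneSet
  have hF : ∀ᶠ w in 𝓝 (φ τ), DifferentiableAt ℝ (f ∘ ofComplex) w := by
    filter_upwards [hopen.mem_nhds hmem] with w hw
    exact hdiff.1.differentiableAt (hopen.mem_nhds hw)
  have hF2 := hdiff.2.differentiableAt (hopen.mem_nhds hmem)
  have key := laplacian_comp_holomorphic (analyticAt_smul hpos τ) hF hF2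
  rw [hcomp, deriv_smul hpos, hdet] at key
  rw [ofComplex_apply, show g • τ = γ • τ from rfl] at key
  rw [hypLaplacian, hypLaplacian, key, smul_smul]
  congr 1
  have him : (γ • τ).im = τ.im / Complex.normSq (denom g τ) := by
    have := im_smul_eq_div_normSq g τ
    rw [show ((γ • τ : ℍ)) = g • τ from rfl, this]
    simp [hg]
  rw [him, Complex.normSq_eq_norm_sq]
  simp only [Complex.ofReal_one, norm_div, norm_one, norm_pow]
  ring

/-! ### The hyperbolic measure in real coordinates -/

/-- The real coordinates of a point of the upper half-plane. -/
def reIm (z : ℍ) : ℝ × ℝ := (z.re, z.im)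

/-- The point with given real coordinates. -/
def ofReIm (q : ℝ × ℝ) : ℍ := ofComplex (q.1 + q.2 * Complex.I)

lemma coe_ofReIm {q : ℝ × ℝ} (hq : 0 < q.2) : (ofReIm q : ℂ) = q.1 + q.2 * Complex.I := by
  rw [ofReIm, ofComplex_apply_of_im_pos (by simpa using hq)]

lemma ofReIm_re {q : ℝ × ℝ} (hq : 0 < q.2) : (ofReIm q).re = q.1 := by
  rw [← coe_re, coe_ofReIm hq]; simp

lemma ofReIm_im {q : ℝ × ℝ} (hq : 0 < q.2) : (ofReIm q).im = q.2 := by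
  rw [← coe_im, coe_ofReIm hq]; simp

@[simp] lemma ofReIm_reIm (z : ℍ) : ofReIm (reIm z) = z := by
  apply UpperHalfPlane.ext
  rw [coe_ofReIm z.im_pos]
  apply Complex.ext <;> simp [reIm]

lemma measurableEmbedding_reIm : MeasurableEmbedding reIm :=
  Complex.measurableEquivRealProd.measurableEmbedding.comp measurableEmbedding_coe

lemma continuousOn_ofReIm : ContinuousOn ofReIm {q | 0 < q.2} := by
  rw [isOpenEmbedding_coe.isEmbedding.continuousOn_iff]
  refine ContinuousOn.congr (f := fun q : ℝ × ℝ => (q.1 + q.2 * Complex.I : ℂ)) (by fun_prop) ?_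
  intro q hq
  exact coe_ofReIm hq

lemma measurePreserving_reIm : MeasurePreserving reIm volume
    ((volume.restrict {q : ℝ × ℝ | 0 < q.2}).withDensity
      fun q => ((1 / ‖q.2‖₊) ^ 2 : NNReal)) := by
  refine ⟨measurableEmbedding_reIm.measurable, ?_⟩
  have hm : MeasurableSet {q : ℝ × ℝ | 0 < q.2} := measurableSet_lt measurable_const measurable_snd
  ext s hs
  rw [Measure.map_apply measurableEmbedding_reIm.measurable hs, volume_eq_lintegral,
    withDensity_apply _ hs, Measure.restrict_restrict hs]
  have : (UpperHalfPlane.coe '' (reIm ⁻¹' s)) =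
      Complex.measurableEquivRealProd ⁻¹' (s ∩ {q | 0 < q.2}) := by
    ext z
    simp only [Set.mem_image, Set.mem_preimage, Set.mem_inter_iff, Set.mem_ofPred_eq,
      Complex.measurableEquivRealProd_apply]
    constructor
    · rintro ⟨τ, hτ, rfl⟩
      exact ⟨hτ, τ.im_pos⟩
    · rintro ⟨h1, h2⟩
      exact ⟨⟨z, h2⟩, h1, rfl⟩
  rw [this]
  exact Complex.volume_preserving_equiv_real_prod.setLIntegral_comp_preimage_emb
    Complex.measurableEquivRealProd.measurableEmbedding
    (fun q : ℝ × ℝ => (((1 / ‖q.2‖₊) ^ 2 : NNReal) : ENNReal)) _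

lemma measurePreserving_reIm_restrict {A : Set (ℝ × ℝ)} (hA : MeasurableSet A)
    (hA0 : ∀ q ∈ A, 0 < q.2) :
    MeasurePreserving reIm (volume.restrict (reIm ⁻¹' A)) ((volume.restrict A).withDensity
      fun q => ((1 / ‖q.2‖₊) ^ 2 : NNReal)) := by
  have := measurePreserving_reIm.restrict_preimage_emb measurableEmbedding_reIm A
  have hs : A ∩ {q : ℝ × ℝ | 0 < q.2} = A := Set.inter_eq_self_of_subset_left hA0
  rwa [restrict_withDensity hA, Measure.restrict_restrict hA, hs] at this

lemma measurable_density : Measurable fun q : ℝ × ℝ => ((1 / ‖q.2‖₊) ^ 2 : NNReal) := by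
  fun_prop

lemma integrableOn_preimage_iff {A : Set (ℝ × ℝ)} (hA : MeasurableSet A)
    (hA0 : ∀ q ∈ A, 0 < q.2) {E : Type*} [NormedAddCommGroup E] [NormedSpace ℝ E] (h : ℍ → E) :
    IntegrableOn h (reIm ⁻¹' A) ↔ IntegrableOn (fun q => ((q.2 ^ 2)⁻¹ : ℝ) • h (ofReIm q)) A := by
  have := (measurePreserving_reIm_restrict hA hA0).integrable_comp_emb measurableEmbedding_reIm
    (g := fun q => h (ofReIm q))
  rw [integrable_withDensity_iff_integrable_smul measurable_density] at this
  rw [IntegrableOn, IntegrableOn]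
  have e : (fun q : ℝ × ℝ => ((q.2 ^ 2)⁻¹ : ℝ) • h (ofReIm q)) =
      fun q => ((1 / ‖q.2‖₊) ^ 2 : NNReal) • h (ofReIm q) := by
    funext q
    rw [NNReal.smul_def]
    simp
  have e' : (fun q => h (ofReIm q)) ∘ reIm = h := by funext z; simp
  rw [e, ← this, e']

lemma setIntegral_preimage {A : Set (ℝ × ℝ)} (hA : MeasurableSet A)
    (hA0 : ∀ q ∈ A, 0 < q.2) {E : Type*} [NormedAddCommGroup E] [NormedSpace ℝ E] (h : ℍ → E) :
    ∫ z in reIm ⁻¹' A, h z = ∫ q in A, ((q.2 ^ 2)⁻¹ : ℝ) • h (ofReIm q) := by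
  have := (measurePreserving_reIm_restrict hA hA0).integral_comp measurableEmbedding_reIm
    (g := fun q => h (ofReIm q))
  rw [integral_withDensity_eq_integral_smul measurable_density] at this
  have e : (fun q : ℝ × ℝ => ((q.2 ^ 2)⁻¹ : ℝ) • h (ofReIm q)) =
      fun q => ((1 / ‖q.2‖₊) ^ 2 : NNReal) • h (ofReIm q) := by
    funext q
    rw [NNReal.smul_def]
    simp
  simp only [ofReIm_reIm] at this
  rw [e, this]

/-! ### Unfolding -/

lemma measurePreserving_modular (γ : SL(2, ℤ)) :
    MeasurePreserving (fun z : ℍ => γ • z) volume volume :=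
  measurePreserving_smul (γ : GL (Fin 2) ℝ) (volume : Measure ℍ)

lemma measurableEmbedding_modular (γ : SL(2, ℤ)) :
    MeasurableEmbedding (fun z : ℍ => γ • z) :=
  measurableEmbedding_const_smul (γ : GL (Fin 2) ℝ)

lemma volume_fd_sdiff_fdo : volume (ModularGroup.fd \ ModularGroup.fdo) = 0 := by
  set A : Set (ℝ × ℝ) := {q | (|q.1| = 1 / 2 ∨ q.1 ^ 2 + q.2 ^ 2 = 1)} with hA
  have hAm : MeasurableSet A :=
    ((isClosed_eq (by fun_prop) (by fun_prop)).union
      (isClosed_eq (by fun_prop) (by fun_prop))).measurableSet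
  have hA0 : (volume : Measure (ℝ × ℝ)) A = 0 := by
    rw [Measure.volume_eq_prod, Measure.measure_prod_null hAm]
    have h1 : ∀ᵐ x : ℝ, x ∉ ({1 / 2, -(1 / 2)} : Set ℝ) :=
      ((Set.toFinite _).measure_zero volume : volume ({1 / 2, -(1 / 2)} : Set ℝ) = 0)
        |> measure_eq_zero_iff_ae_notMem.mp
    filter_upwards [h1] with x hx
    refine measure_mono_null (t := {√(1 - x ^ 2), -√(1 - x ^ 2)}) ?_
      ((Set.toFinite _).measure_zero _)
    intro y hy
    rcases hy with h | h
    · exact absurd (by simpa using eq_or_eq_neg_of_abs_eq h) hx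
    · have h : x ^ 2 + y ^ 2 = 1 := h
      have : |y| = √(1 - x ^ 2) := by rw [← Real.sqrt_sq_eq_abs]; congr 1; linarith
      simpa using eq_or_eq_neg_of_abs_eq this
  refine measure_mono_null (t := reIm ⁻¹' A) ?_ ?_
  · rintro z ⟨⟨h1, h2⟩, h3⟩
    simp only [A, reIm, Set.mem_preimage, Set.mem_ofPred_eq]
    by_contra! hc
    refine h3 ⟨lt_of_le_of_ne h1 fun h => hc.2 ?_, lt_of_le_of_ne h2 hc.1⟩
    rw [Complex.normSq_apply] at h
    simp only [coe_re, coe_im] at h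
    nlinarith
  · rw [measurePreserving_reIm.measure_preimage hAm.nullMeasurableSet]
    exact withDensity_absolutelyContinuous _ _
      (le_antisymm ((Measure.restrict_apply_le _ _).trans hA0.le) zero_le)

instance : Countable SL(2, ℤ) :=
  haveI : Countable (Matrix (Fin 2) (Fin 2) ℤ) := inferInstanceAs (Countable (Fin 2 → Fin 2 → ℤ))
  Subtype.coe_injective.countable

lemma ae_exists_smul_mem_fdo : ∀ᵐ w : ℍ, ∃ g : SL(2, ℤ), g • w ∈ ModularGroup.fdo := by
  have h : ∀ᵐ w : ℍ, ∀ g : SL(2, ℤ), g • w ∉ ModularGroup.fd \ ModularGroup.fdo := by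
    rw [ae_all_iff]
    intro g
    exact measure_eq_zero_iff_ae_notMem.mp
      ((measurePreserving_modular g).quasiMeasurePreserving.preimage_null volume_fd_sdiff_fdo)
  filter_upwards [h] with w hw
  obtain ⟨g, hg⟩ := ModularGroup.exists_smul_mem_fd w
  exact ⟨g, by_contra fun hn => hw g ⟨hg, hn⟩⟩

/-- Generic orbits meet `𝒟` once, but `γ` and `-γ` act alike, so a sum over the whole of `SL(2, ℤ)`
counts everything twice. The factors `2` in the unfolding formulas come from here. -/
lemma tsum_indicator_fd {w : ℍ} (hw : ∃ g : SL(2, ℤ), g • w ∈ ModularGroup.fdo) :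
    ∑' γ : SL(2, ℤ), (ModularGroup.fd.indicator 1 (γ⁻¹ • w) : ENNReal) = 2 := by
  obtain ⟨g, hg⟩ := hw
  have hne : g⁻¹ ≠ -g⁻¹ := by
    intro h
    have h2 : (g⁻¹).1 = -(g⁻¹).1 := congrArg Subtype.val h
    have h3 : (g⁻¹).1 = 0 := by
      ext i j
      have := congrFun (congrFun h2 i) j
      simp only [Matrix.neg_apply] at this
      simp only [Matrix.zero_apply]
      omega
    have := (g⁻¹).2
    rw [h3] at this
    simp at this
  have hmem : ∀ γ : SL(2, ℤ), γ⁻¹ • w ∈ ModularGroup.fd ↔ γ ∈ ({g⁻¹, -g⁻¹} : Finset SL(2, ℤ)) := by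
    intro γ
    have e : γ⁻¹ • w = (γ⁻¹ * g⁻¹) • (g • w) := by rw [smul_smul]; simp
    simp only [Finset.mem_insert, Finset.mem_singleton]
    constructor
    · intro h
      rw [e] at h
      rcases ModularGroup.eq_one_or_neg_one_of_mem_fdo_mem_fd hg h with h' | h'
      · left
        have := congrArg (γ * ·) h'
        simpa [eq_comm] using this
      · right
        have := congrArg (γ * ·) h'
        simp only [mul_inv_cancel_left, mul_neg, mul_one] at this
        rw [this, neg_neg]
    · rintro (rfl | rfl)
      · simpa using ModularGroup.fdo_subset_fd hg
      · rw [e]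
        have : (-g⁻¹)⁻¹ * g⁻¹ = -1 := by
          rw [inv_mul_eq_iff_eq_mul]; simp
        rw [this, ModularGroup.SL_neg_smul, one_smul]
        exact ModularGroup.fdo_subset_fd hg
  rw [tsum_eq_sum (s := {g⁻¹, -g⁻¹}), Finset.sum_pair hne]
  · rw [Set.indicator_of_mem ((hmem _).mpr (by simp)), Set.indicator_of_mem ((hmem _).mpr (by simp))]
    simp [one_add_one_eq_two]
  · intro γ hγ
    exact Set.indicator_of_notMem (fun h => hγ ((hmem γ).mp h)) _

/-- The tiling of `ℍ` by translates of `𝒟`, as an identity of measures: unfolding for nonnegative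
and for integrable functions both follow from it. -/
theorem sum_map_restrict_fd :
    Measure.sum (fun γ : SL(2, ℤ) => (volume.restrict ModularGroup.fd).map (fun z : ℍ => γ • z)) =
      (2 : ENNReal) • (volume : Measure ℍ) := by
  have hfd : MeasurableSet ModularGroup.fd := ModularGroup.isClosed_fd.measurableSet
  ext s hs
  rw [Measure.sum_apply _ hs]
  have h1 : ∀ γ : SL(2, ℤ), (volume.restrict ModularGroup.fd).map (fun z : ℍ => γ • z) s =
      ∫⁻ w in s, ModularGroup.fd.indicator 1 (γ⁻¹ • w) := by
    intro γ
    have hpre : MeasurableSet ((fun z : ℍ => γ⁻¹ • z) ⁻¹' ModularGroup.fd) :=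
      (measurePreserving_modular γ⁻¹).measurable hfd
    rw [Measure.map_apply (measurePreserving_modular γ).measurable hs,
      Measure.restrict_apply ((measurePreserving_modular γ).measurable hs),
      ← (measurePreserving_modular γ⁻¹).measure_preimage
        (((measurePreserving_modular γ).measurable hs).inter hfd).nullMeasurableSet]
    have : (fun w : ℍ => (ModularGroup.fd.indicator 1 (γ⁻¹ • w) : ENNReal)) =
        ((fun z : ℍ => γ⁻¹ • z) ⁻¹' ModularGroup.fd).indicator 1 := by
      funext w; rfl
    rw [this, lintegral_indicator_one hpre, Measure.restrict_apply hpre, Set.inter_comm]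
    congr 1
    ext w
    simp [and_comm]
  simp_rw [h1]
  rw [← lintegral_tsum]
  · rw [lintegral_congr_ae (g := fun _ => 2)]
    · simp
    · filter_upwards [ae_restrict_of_ae ae_exists_smul_mem_fdo] with w hw
      exact tsum_indicator_fd hw
  · intro γ
    exact ((measurable_const.indicator hfd).comp
      (measurePreserving_modular γ⁻¹).measurable).aemeasurable

theorem lintegral_unfold {h : ℍ → ENNReal} (hh : AEMeasurable h) :
    ∫⁻ z in ModularGroup.fd, ∑' γ : SL(2, ℤ), h (γ • z) = 2 * ∫⁻ z, h z := by
  rw [lintegral_tsum]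
  · rw [← smul_eq_mul, ← lintegral_smul_measure, ← sum_map_restrict_fd, lintegral_sum_measure]
    congr 1
    funext γ
    rw [(measurableEmbedding_modular γ).lintegral_map]
  · intro γ
    exact (hh.comp_quasiMeasurePreserving
      (measurePreserving_modular γ).quasiMeasurePreserving).restrict

theorem integral_unfold {h : ℍ → ℂ} (hh : Integrable h) :
    ∫ z in ModularGroup.fd, ∑' γ : SL(2, ℤ), h (γ • z) = 2 * ∫ z, h z := by
  have h2 : Integrable h (Measure.sum (fun γ : SL(2, ℤ) =>
      (volume.restrict ModularGroup.fd).map (fun z : ℍ => γ • z))) := by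
    rw [sum_map_restrict_fd]
    exact hh.smul_measure (by simp)
  rw [integral_tsum]
  · have := integral_sum_measure h2
    rw [sum_map_restrict_fd, integral_smul_measure] at this
    rw [show (2 : ℂ) * ∫ z, h z = (2 : ENNReal).toReal • ∫ z, h z by simp, this]
    congr 1
    funext γ
    rw [(measurableEmbedding_modular γ).integral_map]
  · intro γ
    exact (hh.1.comp_quasiMeasurePreserving
      (measurePreserving_modular γ).quasiMeasurePreserving).restrict
  · rw [← lintegral_tsum, lintegral_unfold hh.1.enorm]
    · exact ENNReal.mul_ne_top (by simp) hh.2.ne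
    · intro γ
      exact (hh.1.enorm.comp_quasiMeasurePreserving
        (measurePreserving_modular γ).quasiMeasurePreserving).restrict

open EisensteinSeries in
/-- The primitive vectors of `ℤ²`. -/
abbrev Primitive : Type := gammaSet 1 1 0

lemma Primitive.isCoprime (v : Primitive) : IsCoprime (v.1 0) (v.1 1) :=
  (EisensteinSeries.mem_gammaSet_one _).mp v.2

/-- The positive definite quadratic form `|mz + n|² / Im z`. -/
def quadForm (z : ℍ) (v : Fin 2 → ℤ) : ℝ :=
  Complex.normSq (v 0 * z + v 1) / z.im

lemma eq_of_bottom_row_eq {γ γ' : SL(2, ℤ)} (h : γ 1 = γ' 1) :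
    ∃ n : ℤ, γ' = ModularGroup.T ^ n * γ := by
  have h0 := congrFun h 0
  have h1 := congrFun h 1
  have d := γ.det_coe
  have d' := γ'.det_coe
  rw [Matrix.det_fin_two] at d d'
  -- The upper right entry of `γ' γ⁻¹`.
  refine ⟨γ' 0 0 * -(γ 0 1) + γ' 0 1 * γ 0 0, ?_⟩
  ext i j
  simp only [Matrix.SpecialLinearGroup.coe_mul, ModularGroup.coe_T_zpow]
  fin_cases i <;> fin_cases j <;> simp [Matrix.mul_apply, Fin.sum_univ_two]
  · rw [← h0, ← h1] at d'
    linear_combination γ 0 0 * d' - γ' 0 0 * d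
  · rw [← h0, ← h1] at d'
    linear_combination γ 0 1 * d' - γ' 0 1 * d
  · exact h0.symm
  · exact h1.symm

/-- The strip `0 ≤ Re z < 1`. -/
def unitStrip : Set ℍ := {z | 0 ≤ z.re ∧ z.re < 1}

/-- Elements of the modular group moving `z` into the unit strip, by their bottom rows. -/
lemma bijective_bottom_row (z : ℍ) : Function.Bijective
    (fun γ : {γ : SL(2, ℤ) | γ • z ∈ unitStrip} =>
      (⟨γ.1 1, (EisensteinSeries.mem_gammaSet_one _).mpr
        (ModularGroup.bottom_row_coprime γ.1)⟩ : Primitive)) := by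
  constructor
  · rintro ⟨γ, hγ⟩ ⟨γ', hγ'⟩ h
    obtain ⟨n, rfl⟩ := eq_of_bottom_row_eq (congrArg Subtype.val h)
    have h1 : 0 ≤ (γ • z).re ∧ (γ • z).re < 1 := hγ
    have h2 : 0 ≤ ((ModularGroup.T ^ n * γ) • z).re ∧ ((ModularGroup.T ^ n * γ) • z).re < 1 := hγ'
    rw [mul_smul, ModularGroup.re_T_zpow_smul] at h2
    have h3 : (-1 : ℝ) < n := by linarith
    have h4 : (n : ℝ) < 1 := by linarith
    have h5 : -1 < n := by exact_mod_cast h3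
    have h6 : n < 1 := by exact_mod_cast h4
    obtain rfl : n = 0 := by omega
    simp
  · rintro ⟨v, hv⟩
    obtain ⟨γ, -, hγ⟩ := ModularGroup.bottom_row_surj (R := ℤ)
      ((EisensteinSeries.mem_gammaSet_one v).mp hv)
    refine ⟨⟨ModularGroup.T ^ (-⌊(γ • z).re⌋) * γ, ?_⟩, ?_⟩
    · have : 0 ≤ ((ModularGroup.T ^ (-⌊(γ • z).re⌋) * γ) • z).re ∧
          ((ModularGroup.T ^ (-⌊(γ • z).re⌋) * γ) • z).re < 1 := by
        rw [mul_smul, ModularGroup.re_T_zpow_smul]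
        push_cast
        constructor
        · linarith [Int.floor_le (γ • z).re]
        · linarith [Int.lt_floor_add_one (γ • z).re]
      exact this
    · apply Subtype.ext
      simp only [← hγ]
      funext j
      simp only [Matrix.SpecialLinearGroup.coe_mul, ModularGroup.coe_T_zpow]
      fin_cases j <;> simp [Matrix.mul_apply, Fin.sum_univ_two]

lemma quadForm_pos (z : ℍ) {v : Fin 2 → ℤ} (hv : v ≠ 0) : 0 < quadForm z v := by
  refine div_pos (Complex.normSq_pos.mpr ?_) z.im_pos
  have := linear_ne_zero (cd := fun i => (v i : ℝ)) z (by
    intro h; apply hv; funext i; simpa using congrFun h i)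
  simpa using this

lemma im_smul_eq_inv_quadForm (γ : SL(2, ℤ)) (z : ℍ) : (γ • z).im = (quadForm z (γ 1))⁻¹ := by
  rw [ModularGroup.im_smul_eq_div_normSq, quadForm, inv_div, ModularGroup.denom_apply]

/-- Summing an invariant-height function on the unit strip over the modular group amounts to
summing over primitive vectors. -/
theorem tsum_unitStrip_indicator {M : Type*} [AddCommMonoid M] [TopologicalSpace M]
    (w : ℝ → M) (z : ℍ) :
    ∑' γ : SL(2, ℤ), unitStrip.indicator (fun τ => w τ.im) (γ • z) =
      ∑' v : Primitive, w (quadForm z v)⁻¹ := by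
  rw [← (Equiv.ofBijective _ (bijective_bottom_row z)).tsum_eq]
  have h1 : ∀ γ : SL(2, ℤ), unitStrip.indicator (fun τ => w τ.im) (γ • z) =
      {γ : SL(2, ℤ) | γ • z ∈ unitStrip}.indicator
        (fun γ : SL(2, ℤ) => w (quadForm z (γ 1))⁻¹) γ := by
    intro γ
    by_cases h : γ • z ∈ unitStrip
    · rw [Set.indicator_of_mem h, Set.indicator_of_mem (by exact h), im_smul_eq_inv_quadForm]
    · rw [Set.indicator_of_notMem h, Set.indicator_of_notMem (by exact h)]
  simp_rw [h1]
  rw [← tsum_subtype]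
  rfl

/-! ### Integrability near the real axis -/

/-- On `𝒟` one has `x² ≤ 1/4` and `y² ≥ 3/4`, so the cross term cannot cancel more than half of the
diagonal form `(c²y² + d²)/y`. -/
lemma quadForm_ge_of_mem_fd {z : ℍ} (hz : z ∈ ModularGroup.fd) (v : Fin 2 → ℤ) :
    ((v 0 : ℝ) ^ 2 * z.im ^ 2 + (v 1 : ℝ) ^ 2) / (2 * z.im) ≤ quadForm z v := by
  have h1 := ModularGroup.three_le_four_mul_im_sq_of_mem_fd hz
  have h2 : |z.re| ≤ 1 / 2 := hz.2
  have h3 : z.re ^ 2 ≤ 1 / 4 := by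
    rw [← sq_abs]; nlinarith [abs_nonneg z.re]
  have hy := z.im_pos
  rw [quadForm, div_le_div_iff₀ (by positivity) hy, Complex.normSq_apply]
  simp only [Complex.add_re, Complex.mul_re, Complex.intCast_re, Complex.intCast_im, coe_re, coe_im,
    Complex.add_im, Complex.mul_im, zero_mul, sub_zero, add_zero]
  set c : ℝ := (v 0 : ℝ)
  set d : ℝ := (v 1 : ℝ)
  have h4 : c ^ 2 * z.im ^ 2 + d ^ 2 ≤ 2 * ((c * z.re + d) * (c * z.re + d) +
      c * z.im * (c * z.im)) := by
    nlinarith [sq_nonneg (2 * c * z.re + d), mul_nonneg (sq_nonneg c) (sub_nonneg.mpr h3),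
      mul_nonneg (sq_nonneg c) (sub_nonneg.mpr h1)]
  nlinarith

/-- When `c` and `d` are both nonzero, the inequality `c²y² + d² ≥ 2|cd|y` makes `y` disappear and
bounds the form below by `|cd|`. If `c = 0`, the inverse is `y` itself and only the truncation at
`Y` helps; if `d = 0`, then `c = ±1` and the inverse is at most `3`. A bound of product shape lets
the double sum factor. -/
lemma inv_quadForm_le_of_mem_fd {z : ℍ} (hz : z ∈ ModularGroup.fd) (v : Primitive) {Y : ℝ}
    (hY : (quadForm z v)⁻¹ ≤ Y) :
    (quadForm z v)⁻¹ ≤ max 3 Y * ((max 1 |((v.1 0 : ℤ) : ℝ)|)⁻¹ * (max 1 |((v.1 1 : ℤ) : ℝ)|)⁻¹) := by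
  have h1 := ModularGroup.three_le_four_mul_im_sq_of_mem_fd hz
  have hq := quadForm_ge_of_mem_fd hz v
  have hy := z.im_pos
  have hcop := v.isCoprime
  have hY2 : Y ≤ max 3 Y := le_max_right _ _
  have h22 : 3 ≤ max 3 Y := le_max_left _ _
  by_cases h0 : v.1 0 = 0
  · have : |((v.1 1 : ℤ) : ℝ)| = 1 := by
      rw [h0, isCoprime_zero_left] at hcop
      rcases Int.isUnit_iff.mp hcop with h | h <;> simp [h]
    rw [this, h0]
    simpa using Or.inr hY
  by_cases h0' : v.1 1 = 0
  · have h5 : |((v.1 0 : ℤ) : ℝ)| = 1 := by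
      rw [h0', isCoprime_zero_right] at hcop
      rcases Int.isUnit_iff.mp hcop with h | h <;> simp [h]
    have h6 : ((v.1 0 : ℤ) : ℝ) ^ 2 = 1 := by rw [← sq_abs, h5]; norm_num
    rw [h5, h0']
    rw [h0', h6] at hq
    have h7 : z.im / 2 ≤ quadForm z v := by
      refine le_trans (le_of_eq ?_) hq
      simp only [Int.cast_zero]
      field_simp
      ring
    have h8 : 2 / 3 ≤ z.im := by nlinarith
    calc (quadForm z v)⁻¹ ≤ (1 / 3 : ℝ)⁻¹ := inv_anti₀ (by norm_num) (by linarith)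
      _ ≤ max 3 Y := by simp
      _ = _ := by simp
  · have h5 : 1 ≤ |((v.1 0 : ℤ) : ℝ)| := by exact_mod_cast Int.one_le_abs h0
    have h6 : 1 ≤ |((v.1 1 : ℤ) : ℝ)| := by exact_mod_cast Int.one_le_abs h0'
    rw [max_eq_right h5, max_eq_right h6]
    rw [← sq_abs (v.1 0 : ℝ), ← sq_abs (v.1 1 : ℝ)] at hq
    set c : ℝ := |((v.1 0 : ℤ) : ℝ)|
    set d : ℝ := |((v.1 1 : ℤ) : ℝ)|
    have h7 : c * d ≤ quadForm z v := by
      refine le_trans ?_ hq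
      rw [le_div_iff₀ (by positivity)]
      nlinarith [sq_nonneg (c * z.im - d)]
    calc (quadForm z v)⁻¹ ≤ (c * d)⁻¹ := inv_anti₀ (by positivity) h7
      _ = 1 * (c⁻¹ * d⁻¹) := by rw [mul_inv, one_mul]
      _ ≤ _ := by
        apply mul_le_mul_of_nonneg_right (by linarith)
        positivity

lemma summable_max_one_abs_rpow {δ : ℝ} (hδ : 0 < δ) :
    Summable fun n : ℤ => ((max 1 |(n : ℝ)|)⁻¹) ^ (1 + δ) := by
  refine Summable.of_norm_bounded_eventually
    (Real.summable_abs_int_rpow (show 1 < 1 + δ by linarith)) ?_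
  filter_upwards [(Set.finite_singleton (0 : ℤ)).compl_mem_cofinite] with n hn
  have h5 : 1 ≤ |(n : ℝ)| := by exact_mod_cast Int.one_le_abs (by simpa using hn)
  rw [max_eq_right h5, Real.norm_of_nonneg (by positivity), Real.rpow_neg (by positivity),
    Real.inv_rpow (by positivity)]

/-- The truncated Eisenstein-type sum over primitive vectors is bounded on the fundamental
domain. -/
lemma exists_tsum_primitive_le {δ : ℝ} (hδ : 0 < δ) (Y : ℝ) :
    ∃ K : ENNReal, K ≠ ⊤ ∧ ∀ z ∈ ModularGroup.fd, ∑' v : Primitive,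
      (Set.Iic Y).indicator (fun r => ENNReal.ofReal (r ^ (1 + δ))) (quadForm z v)⁻¹ ≤ K := by
  set A := ∑' n : ℤ, ENNReal.ofReal (((max 1 |(n : ℝ)|)⁻¹) ^ (1 + δ)) with hA
  have hAt : A ≠ ⊤ := (summable_max_one_abs_rpow hδ).tsum_ofReal_ne_top
  set B := ENNReal.ofReal ((max 3 Y) ^ (1 + δ))
  refine ⟨B * (A * A), ENNReal.mul_ne_top ENNReal.ofReal_ne_top (ENNReal.mul_ne_top hAt hAt), ?_⟩
  intro z hz
  have h1 : ∀ v : Primitive,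
      (Set.Iic Y).indicator (fun r => ENNReal.ofReal (r ^ (1 + δ))) (quadForm z v)⁻¹ ≤
      B * (ENNReal.ofReal (((max 1 |((v.1 0 : ℤ) : ℝ)|)⁻¹) ^ (1 + δ)) *
        ENNReal.ofReal (((max 1 |((v.1 1 : ℤ) : ℝ)|)⁻¹) ^ (1 + δ))) := by
    intro v
    by_cases hv : (quadForm z v)⁻¹ ≤ Y
    · rw [Set.indicator_of_mem (by exact hv), ← ENNReal.ofReal_mul (by positivity),
        ← ENNReal.ofReal_mul (by positivity), ← Real.mul_rpow (by positivity) (by positivity),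
        ← Real.mul_rpow (by positivity) (by positivity)]
      apply ENNReal.ofReal_le_ofReal
      refine Real.rpow_le_rpow ?_ (inv_quadForm_le_of_mem_fd hz v hv) (by linarith)
      rw [inv_nonneg]
      exact div_nonneg (Complex.normSq_nonneg _) z.im_pos.le
    · rw [Set.indicator_of_notMem (by exact hv)]
      exact zero_le
  refine (ENNReal.tsum_le_tsum h1).trans ?_
  rw [ENNReal.tsum_mul_left]
  gcongr
  refine (ENNReal.tsum_comp_le_tsum_of_injective
    (f := fun v : Primitive => finTwoArrowEquiv ℤ v.1)
    ((finTwoArrowEquiv ℤ).injective.comp Subtype.val_injective)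
    (fun p : ℤ × ℤ => ENNReal.ofReal (((max 1 |(p.1 : ℝ)|)⁻¹) ^ (1 + δ)) *
        ENNReal.ofReal (((max 1 |(p.2 : ℝ)|)⁻¹) ^ (1 + δ)))).trans ?_
  rw [ENNReal.tsum_prod']
  simp_rw [ENNReal.tsum_mul_left, ENNReal.tsum_mul_right]
  exact le_rfl

lemma integrableOn_of_isBigO_atImInfty {g : ℍ → ℂ} (hm : AEStronglyMeasurable g)
    (hO : g =O[atImInfty] fun z : ℍ => z.im ^ (1 / 4 : ℝ)) (a b : ℝ) :
    ∃ Y₀, 1 ≤ Y₀ ∧ IntegrableOn g (reIm ⁻¹' (Set.Icc a b ×ˢ Set.Ioi Y₀)) := by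
  obtain ⟨C, hC⟩ := hO.bound
  obtain ⟨Y₁, hY₁⟩ := (atImInfty_mem _).mp hC
  refine ⟨max 1 Y₁, le_max_left _ _, ?_⟩
  set A := Set.Icc a b ×ˢ Set.Ioi (max 1 Y₁)
  have hA : MeasurableSet A := measurableSet_Icc.prod measurableSet_Ioi
  have hA1 : ∀ q ∈ A, max 1 Y₁ < q.2 := fun q hq => hq.2
  have hA0 : ∀ q ∈ A, 0 < q.2 := fun q hq =>
    lt_of_lt_of_le one_pos ((le_max_left _ _).trans (hA1 q hq).le)
  have h1 : IntegrableOn (fun z : ℍ => z.im ^ (1 / 4 : ℝ)) (reIm ⁻¹' A) := by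
    rw [integrableOn_preimage_iff hA hA0]
    -- The exponent is `1/4 - 2`: the hyperbolic area absorbs the permitted growth at the cusp.
    have h2 : IntegrableOn (fun q : ℝ × ℝ => (1 : ℝ) * q.2 ^ (-(7 / 4) : ℝ)) A := by
      rw [IntegrableOn, Measure.volume_eq_prod, ← Measure.prod_restrict]
      refine Integrable.mul_prod (f := fun _ : ℝ => (1 : ℝ)) (g := fun y : ℝ => y ^ (-(7 / 4) : ℝ))
        ?_ ?_
      · exact integrable_const _
      · exact integrableOn_Ioi_rpow_of_lt (by norm_num) (lt_of_lt_of_le one_pos (le_max_left _ _))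
    refine h2.congr_fun ?_ hA
    intro q hq
    have := hA0 q hq
    simp only [ofReIm_im this, smul_eq_mul, one_mul]
    rw [← Real.rpow_natCast, ← Real.rpow_neg this.le, ← Real.rpow_add this]
    norm_num
  refine (h1.const_mul C).mono' hm.restrict ?_
  refine (ae_restrict_iff' (measurableEmbedding_reIm.measurable hA)).mpr (ae_of_all _ ?_)
  intro z hz
  have := hY₁ z ((le_max_right _ _).trans (hA1 _ hz).le)
  simp only [Set.mem_ofPred_eq] at this
  rwa [Real.norm_of_nonneg (Real.rpow_nonneg z.im_pos.le _)] at this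

lemma integrableOn_fd {g : ℍ → ℂ} (hloc : LocallyIntegrable g)
    (hO : g =O[atImInfty] fun z : ℍ => z.im ^ (1 / 4 : ℝ)) : IntegrableOn g ModularGroup.fd := by
  obtain ⟨Y₀, -, h⟩ := integrableOn_of_isBigO_atImInfty hloc.aestronglyMeasurable hO (-(1 / 2))
    (1 / 2)
  refine ((hloc.integrableOn_isCompact
    (ModularGroup.isCompact_truncatedFundamentalDomain Y₀)).union h).mono_set ?_
  intro z hz
  by_cases hzY : z.im ≤ Y₀
  · exact Or.inl ⟨hz, hzY⟩
  · exact Or.inr ⟨abs_le.mp hz.2, not_le.mp hzY⟩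

lemma measurableSet_unitStrip : MeasurableSet unitStrip :=
  (measurableSet_Ico (a := (0 : ℝ)) (b := 1)).preimage continuous_re.measurable

/-- Unfolding backwards, the integral becomes that of `|g|` over `𝒟` against a truncated Eisenstein
series. The truncation tames the term `y^(1+δ)`, so the series is bounded on `𝒟` and integrability
of `g` there suffices. -/
lemma lintegral_unitStrip_lt_top {g : ℍ → ℂ} (hinv : IsModularInvariant g)
    (hloc : LocallyIntegrable g) (hO : g =O[atImInfty] fun z : ℍ => z.im ^ (1 / 4 : ℝ))
    {δ : ℝ} (hδ : 0 < δ) (Y : ℝ) :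
    ∫⁻ z in unitStrip ∩ {z | z.im ≤ Y}, ‖g z‖ₑ * ENNReal.ofReal (z.im ^ (1 + δ)) ≠ ⊤ := by
  obtain ⟨K, hK, hle⟩ := exists_tsum_primitive_le hδ Y
  set w : ℝ → ENNReal := (Set.Iic Y).indicator (fun r => ENNReal.ofReal (r ^ (1 + δ))) with hw
  have hwm : Measurable w := (by fun_prop : Measurable fun r : ℝ =>
    ENNReal.ofReal (r ^ (1 + δ))).indicator measurableSet_Iic
  set W : ℍ → ENNReal := unitStrip.indicator (fun τ => w τ.im) with hW
  have hWm : Measurable W := (hwm.comp continuous_im.measurable).indicator measurableSet_unitStrip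
  have hgm : AEMeasurable (fun z => ‖g z‖ₑ) := hloc.aestronglyMeasurable.enorm
  have hmS : MeasurableSet (unitStrip ∩ {z | z.im ≤ Y}) :=
    measurableSet_unitStrip.inter (measurableSet_le continuous_im.measurable measurable_const)
  have h1 : ∫⁻ z in unitStrip ∩ {z | z.im ≤ Y}, ‖g z‖ₑ * ENNReal.ofReal (z.im ^ (1 + δ)) =
      ∫⁻ z, ‖g z‖ₑ * W z := by
    rw [← lintegral_indicator hmS]
    congr 1
    funext z
    by_cases h1 : z ∈ unitStrip <;> by_cases h2 : z.im ≤ Y <;> simp [hW, hw, h1, h2]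
  have h2 := lintegral_unfold (hgm.mul hWm.aemeasurable)
  have h3 : ∫⁻ z in ModularGroup.fd, ∑' γ : SL(2, ℤ), ((fun z => ‖g z‖ₑ) * W) (γ • z) ≤
      ∫⁻ z in ModularGroup.fd, ‖g z‖ₑ * K := by
    refine setLIntegral_mono' ModularGroup.isClosed_fd.measurableSet ?_
    intro z hz
    simp only [Pi.mul_apply, hinv _ z]
    rw [ENNReal.tsum_mul_left, hW, tsum_unitStrip_indicator]
    gcongr
    exact hle z hz
  have h4 : ∫⁻ z in ModularGroup.fd, ‖g z‖ₑ * K ≠ ⊤ := by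
    rw [lintegral_mul_const' _ _ hK]
    exact ENNReal.mul_ne_top (integrableOn_fd hloc hO).2.ne hK
  rw [h1]
  intro htop
  have h5 : ∫⁻ z, ((fun z => ‖g z‖ₑ) * W) z = ⊤ := htop
  rw [h5, ENNReal.mul_top (by simp)] at h2
  exact h4 (top_le_iff.mp (h2 ▸ h3))

/-- The growth, in `Y`, of the mass of an invariant function on the part of the unit strip below
height `Y`, with respect to the measure `y ^ (δ - 1) dx dy`. -/
theorem exists_setIntegral_strip_le {g : ℍ → ℂ} (hinv : IsModularInvariant g)
    (hloc : LocallyIntegrable g) (hO : g =O[atImInfty] fun z : ℍ => z.im ^ (1 / 4 : ℝ))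
    {δ : ℝ} (hδ : 0 < δ) : ∃ C, 0 ≤ C ∧ ∀ Y : ℝ, 1 ≤ Y →
      IntegrableOn (fun q : ℝ × ℝ => q.2 ^ (δ - 1) * ‖g (ofReIm q)‖) (Set.Ico 0 1 ×ˢ Set.Ioc 0 Y) ∧
      ∫ q in Set.Ico (0 : ℝ) 1 ×ˢ Set.Ioc 0 Y, q.2 ^ (δ - 1) * ‖g (ofReIm q)‖ ≤ C * Y ^ (1 + δ) := by
  -- Below `Y₀` the mass is finite by unfolding. Between `Y₀` and `Y` the weight is at most
  -- `Y^(1+δ)` and `g` is integrable near the cusp, which accounts for the growth in `Y`.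
  obtain ⟨Y₀, hY₀, hint⟩ := integrableOn_of_isBigO_atImInfty hloc.aestronglyMeasurable hO 0 1
  set h : ℍ → ℝ := fun z => z.im ^ (1 + δ) * ‖g z‖ with hh
  have hhm : AEStronglyMeasurable h := by
    refine AEStronglyMeasurable.mul ?_ hloc.aestronglyMeasurable.norm
    exact (continuous_im.rpow_const fun z => Or.inl z.im_ne_zero).aestronglyMeasurable
  have h1 : IntegrableOn h (unitStrip ∩ {z | z.im ≤ Y₀}) := by
    refine ⟨hhm.restrict, ?_⟩
    rw [HasFiniteIntegral]
    refine lt_of_le_of_lt (le_of_eq ?_) (lintegral_unitStrip_lt_top hinv hloc hO hδ Y₀).lt_top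
    congr 1
    funext z
    rw [hh, enorm_mul, enorm_norm, mul_comm, Real.enorm_of_nonneg (Real.rpow_nonneg z.im_pos.le _)]
  set C₁ := ∫ z in unitStrip ∩ {z | z.im ≤ Y₀}, h z
  set C₂ := ∫ z in reIm ⁻¹' (Set.Icc (0 : ℝ) 1 ×ˢ Set.Ioi Y₀), ‖g z‖
  have hnn : ∀ z, 0 ≤ h z := fun z => mul_nonneg (Real.rpow_nonneg z.im_pos.le _) (norm_nonneg _)
  have hC₁ : 0 ≤ C₁ := integral_nonneg hnn
  have hC₂ : 0 ≤ C₂ := integral_nonneg fun z => norm_nonneg _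
  refine ⟨C₁ + C₂, by positivity, fun Y hY => ?_⟩
  set A : Set (ℝ × ℝ) := Set.Ico 0 1 ×ˢ Set.Ioc 0 Y
  have hA : MeasurableSet A := measurableSet_Ico.prod measurableSet_Ioc
  have hA0 : ∀ q ∈ A, 0 < q.2 := fun q hq => hq.2.1
  have e : ∀ q ∈ A, ((q.2 ^ 2)⁻¹ : ℝ) • h (ofReIm q) = q.2 ^ (δ - 1) * ‖g (ofReIm q)‖ := by
    intro q hq
    have := hA0 q hq
    rw [hh]
    simp only [ofReIm_im this, smul_eq_mul]
    rw [← mul_assoc, ← Real.rpow_natCast, ← Real.rpow_neg this.le, ← Real.rpow_add this]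
    norm_num
    left
    congr 1
    ring
  set B := reIm ⁻¹' (Set.Ico (0 : ℝ) 1 ×ˢ Set.Ioc Y₀ Y)
  have hBm : MeasurableSet B :=
    measurableEmbedding_reIm.measurable (measurableSet_Ico.prod measurableSet_Ioc)
  have hBsub : B ⊆ reIm ⁻¹' (Set.Icc (0 : ℝ) 1 ×ˢ Set.Ioi Y₀) := fun z hz =>
    ⟨Set.Ico_subset_Icc_self hz.1, hz.2.1⟩
  have hYp : 0 ≤ Y ^ (1 + δ) := Real.rpow_nonneg (by linarith) _
  have hbound : ∀ z ∈ B, h z ≤ Y ^ (1 + δ) * ‖g z‖ := by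
    intro z hz
    have : z.im ≤ Y := hz.2.2
    exact mul_le_mul_of_nonneg_right (Real.rpow_le_rpow z.im_pos.le this (by linarith))
      (norm_nonneg _)
  have hgB : IntegrableOn (fun z => Y ^ (1 + δ) * ‖g z‖) B := 
    IntegrableOn.mono_set (hint.norm.const_mul _) hBsub
  have h2 : IntegrableOn h B := by
    refine hgB.mono' hhm.restrict ((ae_restrict_iff' hBm).mpr (ae_of_all _ fun z hz => ?_))
    rw [Real.norm_of_nonneg (hnn z)]
    exact hbound z hz
  have hsub : reIm ⁻¹' A ⊆ (unitStrip ∩ {z | z.im ≤ Y₀}) ∪ B := by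
    intro z hz
    by_cases hzY : z.im ≤ Y₀
    · exact Or.inl ⟨⟨hz.1.1, hz.1.2⟩, hzY⟩
    · exact Or.inr ⟨hz.1, not_le.mp hzY, hz.2.2⟩
  have h3 : IntegrableOn h (reIm ⁻¹' A) := (h1.union h2).mono_set hsub
  constructor
  · exact ((integrableOn_preimage_iff hA hA0 h).mp h3).congr_fun e hA
  · rw [← setIntegral_congr_fun hA e, ← setIntegral_preimage hA hA0 h]
    calc ∫ z in reIm ⁻¹' A, h z ≤ ∫ z in (unitStrip ∩ {z | z.im ≤ Y₀}) ∪ B, h z :=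
          setIntegral_mono_set (h1.union h2) (ae_of_all _ hnn) hsub.eventuallyLE
      _ = C₁ + ∫ z in B, h z := by
          refine setIntegral_union (Set.disjoint_left.mpr ?_) hBm h1 h2
          exact fun z hz hz' => absurd hz.2 (not_le.mpr hz'.2.1)
      _ ≤ C₁ + Y ^ (1 + δ) * C₂ := by
          gcongr
          calc ∫ z in B, h z ≤ ∫ z in B, Y ^ (1 + δ) * ‖g z‖ := setIntegral_mono_on h2 hgB hBm hbound
            _ ≤ Y ^ (1 + δ) * C₂ := by
              rw [integral_const_mul]
              gcongr
              exact setIntegral_mono_set hint.norm (ae_of_all _ fun z => norm_nonneg _)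
                hBsub.eventuallyLE
      _ ≤ (C₁ + C₂) * Y ^ (1 + δ) := by
          have : 1 ≤ Y ^ (1 + δ) := Real.one_le_rpow hY (by linarith)
          nlinarith

/-! ### The constant term -/

lemma IsTwiceDifferentiable.continuous {f : ℍ → ℂ} (h : IsTwiceDifferentiable f) :
    Continuous f := by
  have := h.1.continuousOn.comp_continuous continuous_coe (fun z => z.im_pos)
  convert this using 1
  funext z
  simp

lemma IsRapidDecay.isBigO_quarter {f : ℍ → ℂ} (h : IsRapidDecay f) :
    f =O[atImInfty] fun z : ℍ => z.im ^ (1 / 4 : ℝ) := by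
  refine (h 0).trans (IsBigO.of_bound 1 ?_)
  rw [atImInfty]
  refine mem_comap.mpr ⟨Set.Ici 1, mem_atTop 1, ?_⟩
  intro z hz
  have : 1 ≤ z.im := hz
  simp only [Set.mem_ofPred_eq, pow_zero, inv_one, norm_one, one_mul]
  rw [Real.norm_of_nonneg (by positivity)]
  exact Real.one_le_rpow this (by norm_num)

/-- Invariance, compactness of the truncated domain and decay at the cusp make `f` bounded on all of
`ℍ`. The decay estimates, valid only for large `y`, then extend to every height. -/
lemma exists_norm_mul_pow_le {f : ℍ → ℂ} (hf : Continuous f) (hinv : IsModularInvariant f)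
    (hdec : IsRapidDecay f) (N : ℕ) : ∃ C, 0 ≤ C ∧ ∀ z, ‖f z‖ * z.im ^ N ≤ C := by
  have key : ∀ N : ℕ, ∃ C Y, 0 ≤ C ∧ 1 ≤ Y ∧ ∀ z : ℍ, Y ≤ z.im → ‖f z‖ * z.im ^ N ≤ C := by
    intro N
    obtain ⟨C, hC⟩ := (hdec N).bound
    obtain ⟨Y₁, hY₁⟩ := (atImInfty_mem _).mp hC
    refine ⟨max C 0, max 1 Y₁, le_max_right _ _, le_max_left _ _, fun z hz => ?_⟩
    have := hY₁ z ((le_max_right _ _).trans hz)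
    simp only [Set.mem_ofPred_eq] at this
    have hp : 0 < z.im ^ N := pow_pos z.im_pos N
    rw [norm_inv, Real.norm_of_nonneg hp.le, ← div_eq_mul_inv, le_div_iff₀ hp] at this
    exact this.trans (le_max_left _ _)
  obtain ⟨C₀, Y₀, hC₀, -, h₀⟩ := key 0
  obtain ⟨C₁, hC₁⟩ := (ModularGroup.isCompact_truncatedFundamentalDomain Y₀).exists_bound_of_continuousOn
    hf.continuousOn
  have hM : ∀ z, ‖f z‖ ≤ max C₀ C₁ := by
    intro z
    obtain ⟨g, hg⟩ := ModularGroup.exists_smul_mem_fd z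
    rw [← hinv g z]
    by_cases h : (g • z).im ≤ Y₀
    · exact (hC₁ _ ⟨hg, h⟩).trans (le_max_right _ _)
    · have := h₀ _ (not_le.mp h).le
      rw [pow_zero, mul_one] at this
      exact this.trans (le_max_left _ _)
  obtain ⟨C, Y, hC, hY, h⟩ := key N
  have hM0 : 0 ≤ max C₀ C₁ := hC₀.trans (le_max_left _ _)
  refine ⟨max C (max C₀ C₁ * Y ^ N), hC.trans (le_max_left _ _), fun z => ?_⟩
  by_cases hz : Y ≤ z.im
  · exact (h z hz).trans (le_max_left _ _)
  · refine le_trans ?_ (le_max_right _ _)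
    have : z.im ^ N ≤ Y ^ N := pow_le_pow_left₀ z.im_pos.le (not_le.mp hz).le N
    exact mul_le_mul (hM z) this (pow_nonneg z.im_pos.le N) hM0

lemma constantTerm_eq (f : ℍ → ℂ) (y : ℝ) :
    constantTerm f y = ∫ x in Set.Ico (0 : ℝ) 1, f (ofReIm (x, y)) := by
  rw [constantTerm, intervalIntegral.integral_of_le zero_le_one, integral_Ico_eq_integral_Ioc]
  rfl

lemma continuousOn_constantTerm {f : ℍ → ℂ} (hf : Continuous f) {C : ℝ} (hC : ∀ z, ‖f z‖ ≤ C) :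
    ContinuousOn (constantTerm f) (Set.Ioi 0) := by
  have h0 : ∀ x : ℝ, ∀ y ∈ Set.Ioi (0 : ℝ), ((x, y) : ℝ × ℝ) ∈ {q : ℝ × ℝ | 0 < q.2} :=
    fun x y hy => hy
  rw [show constantTerm f = fun y => ∫ x in Set.Ico (0 : ℝ) 1, f (ofReIm (x, y)) from
    funext (constantTerm_eq f)]
  refine MeasureTheory.continuousOn_of_dominated (bound := fun _ => C) ?_ ?_ ?_ ?_
  · intro y hy
    have : Continuous fun x : ℝ => f (ofReIm (x, y)) :=
      hf.comp (continuousOn_ofReIm.comp_continuous (by fun_prop) fun x => h0 x y hy)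
    exact this.aestronglyMeasurable
  · exact fun y _ => ae_of_all _ fun x => hC _
  · exact integrable_const _
  · refine ae_of_all _ fun x => ?_
    exact hf.comp_continuousOn (continuousOn_ofReIm.comp (by fun_prop) (h0 x))

lemma norm_constantTerm_mul_pow_le {f : ℍ → ℂ} {N : ℕ} {C : ℝ}
    (h : ∀ z, ‖f z‖ * z.im ^ N ≤ C) {y : ℝ} (hy : 0 < y) : ‖constantTerm f y‖ * y ^ N ≤ C := by
  have hp : 0 < y ^ N := pow_pos hy N
  rw [← le_div_iff₀ hp, constantTerm_eq]
  refine (norm_setIntegral_le_of_norm_le_const (C := C / y ^ N) (by simp) ?_).trans (by simp)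
  intro x _
  rw [le_div_iff₀ hp]
  have := h (ofReIm (x, y))
  rwa [ofReIm_im (by exact hy)] at this

/-- Integration over the unit strip of an integrable function, first in the `x` variable. -/
lemma integral_unitStrip_mul {f : ℍ → ℂ} (w : ℝ → ℂ)
    (hint : IntegrableOn (fun z => f z * w z.im) unitStrip) :
    ∫ z in unitStrip, f z * w z.im = ∫ y in Set.Ioi (0 : ℝ),
      constantTerm f y * (w y * (y ^ 2 : ℝ)⁻¹) := by
  have hS : unitStrip = reIm ⁻¹' (Set.Ico 0 1 ×ˢ Set.Ioi 0) := by
    ext z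
    simp [unitStrip, reIm, z.im_pos]
  have hA : MeasurableSet (Set.Ico (0 : ℝ) 1 ×ˢ Set.Ioi (0 : ℝ)) :=
    measurableSet_Ico.prod measurableSet_Ioi
  have hA0 : ∀ q ∈ Set.Ico (0 : ℝ) 1 ×ˢ Set.Ioi (0 : ℝ), 0 < q.2 := fun q hq => hq.2
  rw [hS] at hint ⊢
  rw [integrableOn_preimage_iff hA hA0] at hint
  rw [setIntegral_preimage hA hA0]
  rw [Measure.volume_eq_prod] at hint ⊢
  rw [IntegrableOn, ← Measure.prod_restrict] at hint
  rw [← Measure.prod_restrict, integral_prod_symm _ hint]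
  refine setIntegral_congr_fun measurableSet_Ioi fun y hy => ?_
  simp only [constantTerm_eq]
  rw [← integral_mul_const]
  congr 1
  funext x
  rw [ofReIm_im (by exact hy), Complex.real_smul]
  push_cast
  ring

lemma integrableOn_unitStrip_mul {f : ℍ → ℂ} (hf : Continuous f) {w : ℝ → ℂ} (hw : ContinuousOn w (Set.Ioi 0))
    {b : ℝ → ℝ} (hb : IntegrableOn b (Set.Ioi 0))
    (hfw : ∀ z, ‖f z‖ * ‖w z.im‖ * (z.im ^ 2)⁻¹ ≤ b z.im) :
    IntegrableOn (fun z => f z * w z.im) unitStrip := by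
  have hS : unitStrip = reIm ⁻¹' (Set.Ico 0 1 ×ˢ Set.Ioi 0) := by
    ext z
    simp [unitStrip, reIm, z.im_pos]
  have hA : MeasurableSet (Set.Ico (0 : ℝ) 1 ×ˢ Set.Ioi (0 : ℝ)) :=
    measurableSet_Ico.prod measurableSet_Ioi
  have hA0 : ∀ q ∈ Set.Ico (0 : ℝ) 1 ×ˢ Set.Ioi (0 : ℝ), 0 < q.2 := fun q hq => hq.2
  rw [hS, integrableOn_preimage_iff hA hA0]
  have h1 : IntegrableOn (fun q : ℝ × ℝ => (1 : ℝ) * b q.2) (Set.Ico (0 : ℝ) 1 ×ˢ Set.Ioi (0 : ℝ)) := by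
    rw [IntegrableOn, Measure.volume_eq_prod, ← Measure.prod_restrict]
    exact Integrable.mul_prod (f := fun _ : ℝ => (1 : ℝ)) (integrable_const _) hb
  refine h1.mono' ?_ ?_
  · have h2 : ContinuousOn (fun q : ℝ × ℝ => f (ofReIm q)) (Set.Ico (0 : ℝ) 1 ×ˢ Set.Ioi (0 : ℝ)) :=
      hf.comp_continuousOn (continuousOn_ofReIm.mono hA0)
    have h3 : AEStronglyMeasurable (fun q : ℝ × ℝ => ((q.2 ^ 2)⁻¹ : ℝ) • (f (ofReIm q) * w q.2))
        (volume.restrict (Set.Ico (0 : ℝ) 1 ×ˢ Set.Ioi (0 : ℝ))) := by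
      refine AEStronglyMeasurable.smul (f := fun q : ℝ × ℝ => ((q.2 ^ 2)⁻¹ : ℝ))
        (by fun_prop : Measurable fun q : ℝ × ℝ => ((q.2 ^ 2)⁻¹ : ℝ)).aestronglyMeasurable ?_
      exact (h2.aestronglyMeasurable hA).mul ((hw.comp continuousOn_snd fun q hq => hq.2).aestronglyMeasurable hA)
    refine h3.congr ((ae_restrict_iff' hA).mpr (ae_of_all _ fun q hq => ?_))
    simp only [ofReIm_im (hA0 q hq)]
  · refine (ae_restrict_iff' hA).mpr (ae_of_all _ fun q hq => ?_)
    have := hfw (ofReIm q)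
    rw [ofReIm_im (hA0 q hq)] at this
    rw [norm_smul, norm_mul, Real.norm_of_nonneg (by positivity), ofReIm_im (hA0 q hq), one_mul]
    linarith

/-! ### The two-dimensional theta function -/

/-- The theta function of the lattice `ℤz + ℤ`, normalised to covolume one. -/
def theta (t : ℝ) (z : ℍ) : ℝ :=
  ∑' v : Fin 2 → ℤ, Real.exp (-Real.pi * t * quadForm z v)

lemma quadForm_eq (z : ℍ) (v : Fin 2 → ℤ) :
    quadForm z v = ((v 1 : ℝ) + v 0 * z.re) ^ 2 / z.im + (v 0 : ℝ) ^ 2 * z.im := by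
  have := z.im_ne_zero
  rw [quadForm, Complex.normSq_apply]
  simp only [Complex.add_re, Complex.mul_re, Complex.intCast_re, Complex.intCast_im, coe_re, coe_im,
    Complex.add_im, Complex.mul_im, zero_mul, sub_zero, add_zero]
  field_simp
  ring

lemma quadForm_smul (z : ℍ) (k : ℤ) (v : Fin 2 → ℤ) : quadForm z (k • v) = k ^ 2 * quadForm z v := by
  rw [quadForm_eq, quadForm_eq]
  simp only [Pi.smul_apply, smul_eq_mul, Int.cast_mul]
  ring

lemma summable_exp_neg_pi_int_sq {t : ℝ} (ht : 0 < t) :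
    Summable fun n : ℤ => Real.exp (-Real.pi * (n : ℝ) ^ 2 * t) := by
  simpa using (HurwitzZeta.hasSum_int_evenKernel 0 ht).summable

lemma exp_quadForm_eq (z : ℍ) (t : ℝ) (m n : ℤ) :
    Real.exp (-Real.pi * t * quadForm z ((finTwoArrowEquiv ℤ).symm (m, n))) =
      Real.exp (-Real.pi * (m : ℝ) ^ 2 * (t * z.im)) *
        Real.exp (-Real.pi * ((n : ℝ) + (m * z.re : ℝ)) ^ 2 * (t / z.im)) := by
  rw [quadForm_eq, ← Real.exp_add]
  congr 1
  simp
  ring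

lemma cosKernel_le (a : ℝ) {x : ℝ} (hx : 0 < x) :
    |HurwitzZeta.cosKernel a x| ≤ ∑' n : ℤ, Real.exp (-Real.pi * (n : ℝ) ^ 2 * x) := by
  have h := HurwitzZeta.hasSum_int_cosKernel a hx
  have h2 := summable_exp_neg_pi_int_sq hx
  rw [← Real.norm_eq_abs, ← Complex.norm_real, ← h.tsum_eq]
  refine tsum_of_norm_bounded h2.hasSum fun n => ?_
  rw [norm_mul, Complex.norm_real, Real.norm_of_nonneg (Real.exp_pos _).le,
    show (2 * Real.pi * Complex.I * a * n : ℂ) = ((2 * Real.pi * a * n : ℝ) : ℂ) * Complex.I by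
      push_cast; ring, Complex.norm_exp_ofReal_mul_I, one_mul]

lemma hasSum_exp_quadForm_inner (z : ℍ) {t : ℝ} (ht : 0 < t) (m : ℤ) :
    HasSum (fun n : ℤ => Real.exp (-Real.pi * t * quadForm z ((finTwoArrowEquiv ℤ).symm (m, n))))
      (Real.exp (-Real.pi * (m : ℝ) ^ 2 * (t * z.im)) *
        ((z.im / t) ^ (1 / 2 : ℝ) *
          HurwitzZeta.cosKernel ((m * z.re : ℝ) : UnitAddCircle) (z.im / t))) := by
  have hy := z.im_pos
  simp_rw [exp_quadForm_eq]
  refine HasSum.mul_left _ ?_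
  have := HurwitzZeta.hasSum_int_evenKernel (m * z.re) (t := t / z.im) (by positivity)
  rwa [HurwitzZeta.evenKernel_functional_equation, one_div_div, one_div,
    ← Real.inv_rpow (by positivity), inv_div] at this

lemma summable_exp_quadForm (z : ℍ) {t : ℝ} (ht : 0 < t) :
    Summable fun v : Fin 2 → ℤ => Real.exp (-Real.pi * t * quadForm z v) := by
  have hy := z.im_pos
  rw [← (finTwoArrowEquiv ℤ).symm.summable_iff]
  refine (summable_prod_of_nonneg (fun _ => (Real.exp_pos _).le)).mpr ?_
  refine ⟨fun m => (hasSum_exp_quadForm_inner z ht m).summable, ?_⟩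
  simp only [(hasSum_exp_quadForm_inner z ht _).tsum_eq]
  set D := ∑' n : ℤ, Real.exp (-Real.pi * (n : ℝ) ^ 2 * (z.im / t))
  refine Summable.of_norm_bounded (g := fun m : ℤ =>
    Real.exp (-Real.pi * (m : ℝ) ^ 2 * (t * z.im)) * ((z.im / t) ^ (1 / 2 : ℝ) * D))
    ((summable_exp_neg_pi_int_sq (by positivity)).mul_right _) fun m => ?_
  rw [norm_mul, norm_mul, Real.norm_of_nonneg (Real.exp_pos _).le,
    Real.norm_of_nonneg (Real.rpow_nonneg (by positivity) _), Real.norm_eq_abs]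
  gcongr
  exact cosKernel_le _ (by positivity)

/-- Poisson summation is applied in `n` only. In the resulting double series, replacing `t` by `1/t`
merely exchanges `m` and `n`, so the two-dimensional modular relation reduces to an interchange of
sums and a comparison of the prefactors. -/
lemma theta_eq (z : ℍ) {t : ℝ} (ht : 0 < t) :
    (theta t z : ℂ) = ((z.im / t) ^ (1 / 2 : ℝ) : ℝ) * ∑' m : ℤ, ∑' n : ℤ,
      (Real.exp (-Real.pi * (m : ℝ) ^ 2 * (t * z.im)) : ℂ) *
        (Complex.exp (2 * Real.pi * Complex.I * z.re * (m * n)) *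
          Real.exp (-Real.pi * (n : ℝ) ^ 2 * (z.im / t))) := by
  have hy := z.im_pos
  have hs := summable_exp_quadForm z ht
  have h0 : theta t z = ∑' m : ℤ, Real.exp (-Real.pi * (m : ℝ) ^ 2 * (t * z.im)) *
      ((z.im / t) ^ (1 / 2 : ℝ) *
        HurwitzZeta.cosKernel ((m * z.re : ℝ) : UnitAddCircle) (z.im / t)) := by
    rw [theta, ← (finTwoArrowEquiv ℤ).symm.tsum_eq]
    refine (Summable.tsum_prod' ((finTwoArrowEquiv ℤ).symm.summable_iff.mpr hs)
      (fun m => (hasSum_exp_quadForm_inner z ht m).summable)).trans ?_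
    exact tsum_congr fun m => (hasSum_exp_quadForm_inner z ht m).tsum_eq
  rw [h0, Complex.ofReal_tsum, ← tsum_mul_left]
  refine tsum_congr fun m => ?_
  have h := HurwitzZeta.hasSum_int_cosKernel (m * z.re) (t := z.im / t) (by positivity)
  rw [tsum_mul_left, Complex.ofReal_mul, Complex.ofReal_mul, ← h.tsum_eq, mul_left_comm]
  congr 2
  refine tsum_congr fun n => ?_
  congr 2
  push_cast
  ring

/-- The modular relation for the theta function of a lattice. -/
theorem theta_inv (z : ℍ) {t : ℝ} (ht : 0 < t) : theta (1 / t) z = t * theta t z := by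
  have hy := z.im_pos
  have h1 := theta_eq z ht
  have h2 := theta_eq z (t := 1 / t) (by positivity)
  have key : ∑' m : ℤ, ∑' n : ℤ, (Real.exp (-Real.pi * (m : ℝ) ^ 2 * (1 / t * z.im)) : ℂ) *
        (Complex.exp (2 * Real.pi * Complex.I * z.re * (m * n)) *
          Real.exp (-Real.pi * (n : ℝ) ^ 2 * (z.im / (1 / t)))) =
      ∑' m : ℤ, ∑' n : ℤ,
      (Real.exp (-Real.pi * (m : ℝ) ^ 2 * (t * z.im)) : ℂ) *
        (Complex.exp (2 * Real.pi * Complex.I * z.re * (m * n)) *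
          Real.exp (-Real.pi * (n : ℝ) ^ 2 * (z.im / t))) := by
    rw [Summable.tsum_comm]
    · congr 1
      funext n
      congr 1
      funext m
      rw [show 1 / t * z.im = z.im / t by ring, show z.im / (1 / t) = t * z.im by field_simp,
        mul_comm (m : ℂ)]
      ring
    · have h3 := summable_exp_neg_pi_int_sq (t := 1 / t * z.im) (by positivity)
      have h4 := summable_exp_neg_pi_int_sq (t := z.im / (1 / t)) (by positivity)
      refine Summable.of_norm_bounded (h4.mul_of_nonneg h3 (fun _ => (Real.exp_pos _).le)
        (fun _ => (Real.exp_pos _).le)) fun p => ?_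
      rw [Function.uncurry_apply_pair, norm_mul, norm_mul, show (2 * Real.pi * Complex.I * z.re * (p.2 * p.1) : ℂ) =
        ((2 * Real.pi * z.re * (p.2 * p.1) : ℝ) : ℂ) * Complex.I by
          push_cast; ring, Complex.norm_exp_ofReal_mul_I, one_mul, Complex.norm_real,
        Complex.norm_real, Real.norm_of_nonneg (Real.exp_pos _).le,
        Real.norm_of_nonneg (Real.exp_pos _).le, mul_comm]
  rw [key] at h2
  have h5 : (z.im / (1 / t)) ^ (1 / 2 : ℝ) = t * (z.im / t) ^ (1 / 2 : ℝ) := by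
    rw [← Real.sqrt_eq_rpow, ← Real.sqrt_eq_rpow,
      show z.im / (1 / t) = t ^ 2 * (z.im / t) by field_simp,
      Real.sqrt_mul (by positivity), Real.sqrt_sq ht.le]
  rw [h5] at h2
  apply Complex.ofReal_injective
  rw [h2]
  push_cast
  rw [h1]
  push_cast
  ring

/-- Half of the one-dimensional theta series without its constant term. -/
def halfTheta (x : ℝ) : ℝ := (HurwitzZeta.cosKernel 0 x - 1) / 2

lemma hasSum_halfTheta {x : ℝ} (hx : 0 < x) :
    HasSum (fun k : ℕ => Real.exp (-Real.pi * ((k : ℝ) + 1) ^ 2 * x)) (halfTheta x) := by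
  have := (HurwitzZeta.hasSum_nat_cosKernel₀ 0 hx).div_const 2
  simpa [halfTheta] using this

lemma halfTheta_nonneg {x : ℝ} (hx : 0 < x) : 0 ≤ halfTheta x :=
  (hasSum_halfTheta hx).nonneg fun _ => (Real.exp_pos _).le

open EisensteinSeries in
/-- Decomposition of a sum over nonzero lattice vectors into primitive vectors and multiples. -/
lemma tsum_eq_add_tsum_primitive (F : (Fin 2 → ℤ) → ENNReal) :
    ∑' v, F v = F 0 + ∑' v : Primitive, ∑' k : ℕ, F (((k : ℤ) + 1) • v.1) := by
  rw [← gammaSetDivGcdSigmaEquiv.symm.tsum_eq, ENNReal.tsum_sigma', tsum_eq_zero_add']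
  swap
  · exact ENNReal.summable
  congr 1
  · let _ : Unique (gammaSet 1 0 0) :=
      { default := ⟨0, by simp [gammaSet_one_mem_iff]⟩
        uniq := by
          rintro ⟨v, hv⟩
          rw [gammaSet_one_mem_iff, Int.gcd_eq_zero_iff] at hv
          apply Subtype.ext
          funext i
          fin_cases i
          · exact hv.1
          · exact hv.2 }
    rw [tsum_fintype, Fintype.sum_unique, gammaSetDivGcdSigmaEquiv_symm_eq]
    rfl
  · rw [ENNReal.tsum_comm]
    congr 1
    funext k
    rw [← (gammaSetDivGcdEquiv (k + 1)).tsum_eq]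
    congr 1
    funext v
    rw [gammaSetDivGcdSigmaEquiv_symm_eq, gammaSetDivGcdEquiv_eq]
    congr 1
    refine (gammaSet_eq_gcd_mul_divIntMap v.2).trans ?_
    funext i
    simp

lemma primitive_ne_zero (v : Primitive) : v.1 ≠ 0 := by
  intro h
  have := v.isCoprime
  rw [h] at this
  exact not_isCoprime_zero_zero this

lemma tsum_ofReal_exp_quadForm (z : ℍ) {t : ℝ} (ht : 0 < t) :
    ∑' v : Fin 2 → ℤ, ENNReal.ofReal (Real.exp (-Real.pi * t * quadForm z v)) =
      1 + ∑' v : Primitive, ENNReal.ofReal (halfTheta (t * quadForm z v)) := by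
  rw [tsum_eq_add_tsum_primitive]
  congr 1
  · simp [quadForm]
  · congr 1
    funext v
    have hq := quadForm_pos z (primitive_ne_zero v)
    rw [← (hasSum_halfTheta (mul_pos ht hq)).tsum_eq, ENNReal.ofReal_tsum_of_nonneg
      (fun _ => (Real.exp_pos _).le) (hasSum_halfTheta (mul_pos ht hq)).summable]
    congr 1
    funext k
    rw [quadForm_smul]
    congr 2
    push_cast
    ring

lemma ofReal_theta_sub_one (z : ℍ) {t : ℝ} (ht : 0 < t) :
    0 ≤ theta t z - 1 ∧ ENNReal.ofReal (theta t z - 1) =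
      ∑' v : Primitive, ENNReal.ofReal (halfTheta (t * quadForm z v)) := by
  have h := tsum_ofReal_exp_quadForm z ht
  rw [← ENNReal.ofReal_tsum_of_nonneg (fun _ => (Real.exp_pos _).le) (summable_exp_quadForm z ht)] at h
  change ENNReal.ofReal (theta t z) = _ at h
  have hn : 0 ≤ theta t z := tsum_nonneg fun _ => (Real.exp_pos _).le
  have h1 : 1 ≤ theta t z := by
    rw [← ENNReal.ofReal_le_ofReal_iff hn, h, ENNReal.ofReal_one]
    exact le_self_add
  refine ⟨by linarith, ?_⟩
  rw [ENNReal.ofReal_sub _ zero_le_one, h, ENNReal.ofReal_one, ENNReal.add_sub_cancel_left (by simp)]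

lemma theta_sub_one_eq (z : ℍ) {t : ℝ} (ht : 0 < t) :
    theta t z - 1 = ∑' v : Primitive, halfTheta (t * quadForm z v) := by
  obtain ⟨h0, h⟩ := ofReal_theta_sub_one z ht
  rw [← ENNReal.toReal_ofReal h0, h, ENNReal.tsum_toReal_eq (fun _ => ENNReal.ofReal_ne_top)]
  congr 1
  funext v
  exact ENNReal.toReal_ofReal (halfTheta_nonneg (mul_pos ht (quadForm_pos z (primitive_ne_zero v))))

lemma measurable_theta (t : ℝ) : Measurable (theta t) := by
  have hq : ∀ v : Fin 2 → ℤ, Measurable fun z : ℍ => quadForm z v := by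
    intro v
    have : (fun z : ℍ => quadForm z v) =
        fun z : ℍ => ((v 1 : ℝ) + v 0 * z.re) ^ 2 / z.im + (v 0 : ℝ) ^ 2 * z.im := by
      funext z; exact quadForm_eq z v
    rw [this]
    have := continuous_re.measurable
    have := continuous_im.measurable
    fun_prop
  have : theta t = fun z => (∑' v : Fin 2 → ℤ,
      ENNReal.ofReal (Real.exp (-Real.pi * t * quadForm z v))).toReal := by
    funext z
    rw [ENNReal.tsum_toReal_eq (fun _ => ENNReal.ofReal_ne_top)]
    simp_rw [ENNReal.toReal_ofReal (Real.exp_pos _).le]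
    rfl
  rw [this]
  exact (Measurable.tsum (fun v => by have := hq v; fun_prop)).ennreal_toReal

/-- From `exp(-u) ≤ M!/u^M`; the condition `M ≥ 1` leaves at least `(k + 1)⁻²` in each term, so the
sum over `k` converges. -/
lemma exists_halfTheta_le {M : ℕ} (hM : 1 ≤ M) :
    ∃ K, 0 ≤ K ∧ ∀ x, 0 < x → halfTheta x ≤ K * (x ^ M)⁻¹ := by
  have hs : Summable fun k : ℕ => (((k : ℝ) + 1) ^ 2)⁻¹ := by
    have := (summable_nat_add_iff 1).mpr (Real.summable_nat_pow_inv.mpr one_lt_two)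
    simpa using this
  refine ⟨M.factorial * ∑' k : ℕ, (((k : ℝ) + 1) ^ 2)⁻¹, by positivity, fun x hx => ?_⟩
  rw [← (hasSum_halfTheta hx).tsum_eq, ← tsum_mul_left, ← tsum_mul_right]
  refine (hasSum_halfTheta hx).summable.tsum_le_tsum (fun k => ?_) ((hs.mul_left _).mul_right _)
  have hk : (1 : ℝ) ≤ (k : ℝ) + 1 := by linarith [(Nat.cast_nonneg k : (0 : ℝ) ≤ k)]
  have hu : 0 < Real.pi * ((k : ℝ) + 1) ^ 2 * x := by positivity
  have h1 := Real.pow_div_factorial_le_exp _ hu.le M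
  rw [show -Real.pi * ((k : ℝ) + 1) ^ 2 * x = -(Real.pi * ((k : ℝ) + 1) ^ 2 * x) by ring,
    Real.exp_neg]
  have h2 : ((k : ℝ) + 1) ^ 2 * x ^ M ≤ (Real.pi * ((k : ℝ) + 1) ^ 2 * x) ^ M := by
    rw [mul_pow]
    gcongr
    have h3 : (1 : ℝ) ≤ ((k : ℝ) + 1) ^ 2 := one_le_pow₀ hk
    calc ((k : ℝ) + 1) ^ 2 ≤ Real.pi * ((k : ℝ) + 1) ^ 2 := by nlinarith [Real.pi_gt_three]
      _ ≤ _ := le_self_pow₀ (by nlinarith [Real.pi_gt_three]) (by omega)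
  calc (Real.exp (Real.pi * ((k : ℝ) + 1) ^ 2 * x))⁻¹
      ≤ ((Real.pi * ((k : ℝ) + 1) ^ 2 * x) ^ M / M.factorial)⁻¹ := inv_anti₀ (by positivity) h1
    _ ≤ (((k : ℝ) + 1) ^ 2 * x ^ M / M.factorial)⁻¹ := inv_anti₀ (by positivity) (by gcongr)
    _ = _ := by
      rw [inv_div, div_eq_mul_inv, mul_inv, mul_assoc]

lemma continuousOn_halfTheta : ContinuousOn halfTheta (Set.Ioi 0) :=
  ((HurwitzZeta.continuousOn_cosKernel 0).sub continuousOn_const).div_const 2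

lemma continuousOn_halfTheta_div {t : ℝ} (ht : 0 < t) :
    ContinuousOn (fun y : ℝ => (halfTheta (t / y) : ℂ)) (Set.Ioi 0) := by
  refine Complex.continuous_ofReal.comp_continuousOn (continuousOn_halfTheta.comp
    (continuousOn_const.div continuousOn_id fun y hy => (ne_of_gt hy)) fun y hy => ?_)
  exact div_pos ht hy

/-! ### The theta transform of the constant term -/

lemma exists_norm_mul_pow_le_inv {f : ℍ → ℂ} (hf : Continuous f) (hinv : IsModularInvariant f)
    (hdec : IsRapidDecay f) (N : ℕ) :
    ∃ C, 0 ≤ C ∧ ∀ z, ‖f z‖ * z.im ^ N ≤ C * (1 + z.im ^ 2)⁻¹ := by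
  obtain ⟨C₀, h₀, hC₀⟩ := exists_norm_mul_pow_le hf hinv hdec N
  obtain ⟨C₂, h₂, hC₂⟩ := exists_norm_mul_pow_le hf hinv hdec (N + 2)
  refine ⟨C₀ + C₂, by positivity, fun z => ?_⟩
  have : 0 < 1 + z.im ^ 2 := by positivity
  rw [← div_eq_mul_inv, le_div_iff₀ this]
  have h1 := hC₀ z
  have h2 := hC₂ z
  rw [pow_add] at h2
  linarith

/-- The theta transform of the constant term. -/
def thetaTransform (f : ℍ → ℂ) (t : ℝ) : ℂ :=
  ∫ y in Set.Ioi (0 : ℝ), constantTerm f y * ((2 * halfTheta (t / y) : ℂ) * ((y ^ 2 : ℝ)⁻¹ : ℝ))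

/-- The bound `(y/t)^(N+2)` for the theta weight cancels the `y⁻²` of the measure and leaves `y^N`,
which the rapid decay of `f` absorbs. A single estimate thus gives integrability in `y` and
arbitrary polynomial decay in `t`. -/
lemma exists_weight_bound (N : ℕ) {C : ℝ} (hC : 0 ≤ C) : ∃ C', 0 ≤ C' ∧
    ∀ t, 0 < t → ∀ y, 0 < y → ∀ a, 0 ≤ a → a * y ^ N ≤ C * (1 + y ^ 2)⁻¹ →
      a * ‖(halfTheta (t / y) : ℂ)‖ * (y ^ 2)⁻¹ ≤ C' * (t ^ (N + 2))⁻¹ * (1 + y ^ 2)⁻¹ := by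
  obtain ⟨K, hK, hKle⟩ := exists_halfTheta_le (show 1 ≤ N + 2 by omega)
  refine ⟨K * C, by positivity, fun t ht y hy a ha h2 => ?_⟩
  have h1 := hKle (t / y) (by positivity)
  rw [Complex.norm_real, Real.norm_of_nonneg (halfTheta_nonneg (by positivity))]
  calc a * halfTheta (t / y) * (y ^ 2)⁻¹
      ≤ a * (K * ((t / y) ^ (N + 2))⁻¹) * (y ^ 2)⁻¹ := by gcongr
    _ = K * (t ^ (N + 2))⁻¹ * (a * y ^ N) := by
      rw [div_pow, inv_div, pow_add y]
      field_simp
    _ ≤ K * (t ^ (N + 2))⁻¹ * (C * (1 + y ^ 2)⁻¹) := by gcongr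
    _ = _ := by ring

/-- The unfolding identity for the integral against a theta function. -/
theorem integral_mul_theta_sub_one {f : ℍ → ℂ} (hf : Continuous f) (hinv : IsModularInvariant f)
    (hdec : IsRapidDecay f) {t : ℝ} (ht : 0 < t) :
    IntegrableOn (fun z => f z * ((theta t z - 1 : ℝ) : ℂ)) ModularGroup.fd ∧
      ∫ z in ModularGroup.fd, f z * ((theta t z - 1 : ℝ) : ℂ) = thetaTransform f t := by
  set w : ℝ → ℂ := fun y => (halfTheta (t / y) : ℂ) with hw
  set W : ℍ → ℂ := unitStrip.indicator (fun τ => w τ.im) with hW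
  set h : ℍ → ℂ := fun z => f z * W z with hh
  have hstrip : IntegrableOn (fun z => f z * w z.im) unitStrip := by
    obtain ⟨C₀, hC₀, h₀⟩ := exists_norm_mul_pow_le_inv hf hinv hdec 0
    obtain ⟨C, -, hC⟩ := exists_weight_bound 0 hC₀
    exact integrableOn_unitStrip_mul hf (continuousOn_halfTheta_div ht)
      ((integrable_inv_one_add_sq.const_mul (C * (t ^ (0 + 2))⁻¹)).integrableOn)
      fun z => hC t ht _ z.im_pos _ (norm_nonneg _) (h₀ z)
  have hh' : h = unitStrip.indicator (fun z => f z * w z.im) := by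
    funext z
    by_cases hz : z ∈ unitStrip <;> simp [hh, hW, hz]
  have hint : Integrable h := by
    rw [hh']
    exact (integrable_indicator_iff measurableSet_unitStrip).mpr hstrip
  have hγ : ∀ (z : ℍ) (γ : SL(2, ℤ)), h (γ • z) = f z * W (γ • z) := by
    intro z γ
    simp only [hh, hinv γ z]
  have hsum : ∀ z, ∑' γ : SL(2, ℤ), h (γ • z) = f z * ((theta t z - 1 : ℝ) : ℂ) := by
    intro z
    simp_rw [hγ]
    rw [tsum_mul_left, hW, tsum_unitStrip_indicator w z, theta_sub_one_eq z ht, Complex.ofReal_tsum]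
    congr 1
    refine tsum_congr fun v => ?_
    simp only [hw, div_inv_eq_mul]
  -- All theta weights are nonnegative, so the sum of norms is computed exactly, and integrability
  -- over `𝒟` follows from unfolding for nonnegative functions.
  have hsum' : ∀ z, ∑' γ : SL(2, ℤ), ‖h (γ • z)‖ₑ = ‖f z * ((theta t z - 1 : ℝ) : ℂ)‖ₑ := by
    intro z
    simp_rw [hγ, enorm_mul]
    have e : ∀ γ : SL(2, ℤ), ‖W (γ • z)‖ₑ = unitStrip.indicator (fun τ => ‖w τ.im‖ₑ) (γ • z) :=
      fun γ => enorm_indicator_eq_indicator_enorm _ _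
    simp_rw [e]
    obtain ⟨h0, h1⟩ := ofReal_theta_sub_one z ht
    rw [ENNReal.tsum_mul_left, tsum_unitStrip_indicator (fun y => ‖w y‖ₑ) z,
      show ‖((theta t z - 1 : ℝ) : ℂ)‖ₑ = ENNReal.ofReal (theta t z - 1) by
        rw [← ofReal_norm, Complex.norm_real, Real.norm_of_nonneg h0], h1]
    congr 1
    refine tsum_congr fun v => ?_
    have hq := mul_pos ht (quadForm_pos z (primitive_ne_zero v))
    simp only [hw, div_inv_eq_mul]
    rw [← ofReal_norm, Complex.norm_real, Real.norm_of_nonneg (halfTheta_nonneg hq)]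
  constructor
  · refine ⟨?_, ?_⟩
    · refine AEStronglyMeasurable.mul hf.aestronglyMeasurable ?_
      exact (Complex.measurable_ofReal.comp
        ((measurable_theta t).sub_const 1)).aestronglyMeasurable
    · rw [HasFiniteIntegral]
      simp_rw [← hsum']
      rw [lintegral_unfold hint.1.enorm]
      exact ENNReal.mul_lt_top (by simp) hint.2
  · simp_rw [← hsum]
    -- The doubling of the unfolding formula is the factor `2` built into `thetaTransform`.
    rw [integral_unfold hint, hh', integral_indicator measurableSet_unitStrip,
      integral_unitStrip_mul w hstrip, thetaTransform, ← integral_const_mul]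
    congr 1
    funext y
    simp only [hw]
    push_cast
    ring

/-- The modular relation of `theta`, integrated against `f` over `𝒟`. Since `theta - 1` is what
unfolds, the constant term contributes `∫ f` on both sides; these become the poles at `0` and `1`.
-/
theorem thetaTransform_inv {f : ℍ → ℂ} (hf : Continuous f) (hinv : IsModularInvariant f)
    (hdec : IsRapidDecay f) {t : ℝ} (ht : 0 < t) :
    thetaTransform f (1 / t) + ∫ z in ModularGroup.fd, f z =
      t * (thetaTransform f t + ∫ z in ModularGroup.fd, f z) := by
  obtain ⟨h1, h2⟩ := integral_mul_theta_sub_one hf hinv hdec ht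
  obtain ⟨h3, h4⟩ := integral_mul_theta_sub_one hf hinv hdec (t := 1 / t) (by positivity)
  have h5 : IntegrableOn f ModularGroup.fd :=
    integrableOn_fd hf.locallyIntegrable hdec.isBigO_quarter
  rw [← h2, ← h4, ← integral_add h1 h5, ← integral_add h3 h5, ← integral_const_mul]
  congr 1
  funext z
  rw [theta_inv z ht]
  push_cast
  ring

lemma norm_constantTerm_mul_pow_le_inv {f : ℍ → ℂ} {N : ℕ} {C : ℝ}
    (h : ∀ z, ‖f z‖ * z.im ^ N ≤ C * (1 + z.im ^ 2)⁻¹) {y : ℝ} (hy : 0 < y) :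
    ‖constantTerm f y‖ * y ^ N ≤ C * (1 + y ^ 2)⁻¹ := by
  have hp : 0 < y ^ N := pow_pos hy N
  rw [← le_div_iff₀ hp, constantTerm_eq]
  refine (norm_setIntegral_le_of_norm_le_const (C := C * (1 + y ^ 2)⁻¹ / y ^ N) (by simp) ?_).trans
    (by simp)
  intro x _
  rw [le_div_iff₀ hp]
  have := h (ofReIm (x, y))
  rwa [ofReIm_im (by exact hy)] at this

lemma exists_thetaTransform_integrand_le {f : ℍ → ℂ} (hf : Continuous f)
    (hinv : IsModularInvariant f) (hdec : IsRapidDecay f) (N : ℕ) :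
    ∃ C, 0 ≤ C ∧ ∀ t, 0 < t → ∀ y ∈ Set.Ioi (0 : ℝ),
      ‖constantTerm f y * ((2 * halfTheta (t / y) : ℂ) * ((y ^ 2 : ℝ)⁻¹ : ℝ))‖ ≤
        C * (t ^ (N + 2))⁻¹ * (1 + y ^ 2)⁻¹ := by
  obtain ⟨C₀, hC₀, h₀⟩ := exists_norm_mul_pow_le_inv hf hinv hdec N
  obtain ⟨C, hC, h⟩ := exists_weight_bound N hC₀
  refine ⟨2 * C, by positivity, fun t ht y hy => ?_⟩
  have h1 := h t ht y hy _ (norm_nonneg _) (norm_constantTerm_mul_pow_le_inv h₀ hy)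
  rw [norm_mul, norm_mul, norm_mul, Complex.norm_two, Complex.norm_real ((y ^ 2)⁻¹),
    Real.norm_of_nonneg (inv_nonneg.mpr (sq_nonneg y))]
  linarith

lemma exists_norm_thetaTransform_le {f : ℍ → ℂ} (hf : Continuous f) (hinv : IsModularInvariant f)
    (hdec : IsRapidDecay f) (N : ℕ) :
    ∃ C, 0 ≤ C ∧ ∀ t, 0 < t → ‖thetaTransform f t‖ ≤ C * (t ^ (N + 2))⁻¹ := by
  obtain ⟨C, hC, h⟩ := exists_thetaTransform_integrand_le hf hinv hdec N
  set I := ∫ y in Set.Ioi (0 : ℝ), (1 + y ^ 2)⁻¹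
  have hI : 0 ≤ I := integral_nonneg fun y => by positivity
  refine ⟨C * I, by positivity, fun t ht => ?_⟩
  refine (norm_integral_le_of_norm_le
    ((integrable_inv_one_add_sq.const_mul (C * (t ^ (N + 2))⁻¹)).integrableOn (s := Set.Ioi 0))
    ((ae_restrict_iff' measurableSet_Ioi).mpr (ae_of_all _ (h t ht)))).trans (le_of_eq ?_)
  rw [integral_const_mul]
  ring

lemma aestronglyMeasurable_thetaTransform_integrand {f : ℍ → ℂ} (hf : Continuous f) {C : ℝ}
    (hC : ∀ z, ‖f z‖ ≤ C) {t : ℝ} (ht : 0 < t) :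
    AEStronglyMeasurable (fun y : ℝ =>
      constantTerm f y * ((2 * halfTheta (t / y) : ℂ) * ((y ^ 2 : ℝ)⁻¹ : ℝ)))
      (volume.restrict (Set.Ioi 0)) := by
  refine ((continuousOn_constantTerm hf hC).aestronglyMeasurable measurableSet_Ioi).mul
    (AEStronglyMeasurable.mul ?_ ?_)
  · exact (continuousOn_const.mul (continuousOn_halfTheta_div ht)).aestronglyMeasurable
      measurableSet_Ioi
  · exact (by fun_prop : Measurable fun y : ℝ => (((y ^ 2 : ℝ)⁻¹ : ℝ) : ℂ)).aestronglyMeasurable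

lemma continuousOn_thetaTransform {f : ℍ → ℂ} (hf : Continuous f) (hinv : IsModularInvariant f)
    (hdec : IsRapidDecay f) : ContinuousOn (thetaTransform f) (Set.Ioi 0) := by
  obtain ⟨C, hC, h⟩ := exists_thetaTransform_integrand_le hf hinv hdec 0
  obtain ⟨C₀, hC₀, h₀⟩ := exists_norm_mul_pow_le hf hinv hdec 0
  simp only [pow_zero, mul_one] at h₀
  intro t₀ ht₀
  have ht₀ : 0 < t₀ := ht₀
  refine ContinuousAt.continuousWithinAt ?_
  have hev : ∀ᶠ t in 𝓝 t₀, t₀ / 2 < t := lt_mem_nhds (by linarith)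
  refine continuousAt_of_dominated
    (bound := fun y => C * ((t₀ / 2) ^ (0 + 2))⁻¹ * (1 + y ^ 2)⁻¹) ?_ ?_ ?_ ?_
  · filter_upwards [hev] with t ht
    exact aestronglyMeasurable_thetaTransform_integrand hf h₀ (by linarith)
  · filter_upwards [hev] with t ht
    refine (ae_restrict_iff' measurableSet_Ioi).mpr (ae_of_all _ fun y hy => ?_)
    refine (h t (by linarith) y hy).trans ?_
    gcongr
  · exact (integrable_inv_one_add_sq.const_mul _).integrableOn
  · refine (ae_restrict_iff' measurableSet_Ioi).mpr (ae_of_all _ fun y hy => ?_)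
    have hy : 0 < y := hy
    have h1 : ContinuousAt halfTheta (t₀ / y) :=
      continuousOn_halfTheta.continuousAt (Ioi_mem_nhds (by positivity))
    have h2 : ContinuousAt (fun t : ℝ => (halfTheta (t / y) : ℂ)) t₀ :=
      Complex.continuous_ofReal.continuousAt.comp
        (ContinuousAt.comp (f := fun t : ℝ => t / y) h1 (by fun_prop))
    exact continuousAt_const.mul ((continuousAt_const.mul h2).mul continuousAt_const)

lemma isBigO_atTop_of_le_inv_pow {Φ : ℝ → ℂ}
    (h : ∀ N : ℕ, ∃ C, 0 ≤ C ∧ ∀ t, 0 < t → ‖Φ t‖ ≤ C * (t ^ (N + 2))⁻¹) (r : ℝ) :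
    Φ =O[atTop] fun x : ℝ => x ^ r := by
  obtain ⟨N, hN⟩ := exists_nat_ge (-r)
  obtain ⟨C, hC, hle⟩ := h N
  refine IsBigO.of_bound C ?_
  filter_upwards [eventually_ge_atTop 1] with t ht
  have h0 : 0 < t := by linarith
  refine (hle t h0).trans ?_
  rw [Real.norm_of_nonneg (Real.rpow_nonneg h0.le r), ← Real.rpow_natCast, ← Real.rpow_neg h0.le]
  gcongr
  push_cast
  linarith

/-- The pair of functions whose Mellin transform is the Rankin–Selberg transform of `f`. -/
def thetaPair {f : ℍ → ℂ} (hf : Continuous f) (hinv : IsModularInvariant f)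
    (hdec : IsRapidDecay f) : WeakFEPair ℂ where
  f t := thetaTransform f t + ∫ z in ModularGroup.fd, f z
  g t := thetaTransform f t + ∫ z in ModularGroup.fd, f z
  k := 1
  ε := 1
  f₀ := ∫ z in ModularGroup.fd, f z
  g₀ := ∫ z in ModularGroup.fd, f z
  hf_int := ((continuousOn_thetaTransform hf hinv hdec).add continuousOn_const).locallyIntegrableOn
    measurableSet_Ioi
  hg_int := ((continuousOn_thetaTransform hf hinv hdec).add continuousOn_const).locallyIntegrableOn
    measurableSet_Ioi
  hk := one_pos
  hε := one_ne_zero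
  h_feq x hx := by
    rw [thetaTransform_inv hf hinv hdec hx]
    simp
  hf_top r := by
    simpa using isBigO_atTop_of_le_inv_pow (exists_norm_thetaTransform_le hf hinv hdec) r
  hg_top r := by
    simpa using isBigO_atTop_of_le_inv_pow (exists_norm_thetaTransform_le hf hinv hdec) r

/-! ### Mellin transforms and the Rankin–Selberg identity -/

lemma mellinConvergent_constantTerm {f : ℍ → ℂ} (hf : Continuous f) (hinv : IsModularInvariant f)
    (hdec : IsRapidDecay f) {s : ℂ} (hs : 0 < s.re) : MellinConvergent (constantTerm f) s := by
  obtain ⟨C₀, -, h₀⟩ := exists_norm_mul_pow_le hf hinv hdec 0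
  simp only [pow_zero, mul_one] at h₀
  refine mellinConvergent_of_isBigO_rpow (a := s.re + 1) (b := 0)
    ((continuousOn_constantTerm hf h₀).locallyIntegrableOn measurableSet_Ioi) ?_ (by linarith)
    ?_ hs
  · obtain ⟨N, hN⟩ := exists_nat_ge (s.re + 1)
    obtain ⟨C, hC, h⟩ := exists_norm_mul_pow_le hf hinv hdec N
    refine IsBigO.of_bound C ?_
    filter_upwards [eventually_ge_atTop 1] with t ht
    have h0 : 0 < t := by linarith
    have h1 := norm_constantTerm_mul_pow_le h h0
    rw [← le_div_iff₀ (pow_pos h0 N), div_eq_mul_inv] at h1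
    refine h1.trans ?_
    rw [Real.norm_of_nonneg (Real.rpow_nonneg h0.le _), ← Real.rpow_natCast, ← Real.rpow_neg h0.le]
    gcongr
  · refine IsBigO.of_bound C₀ ?_
    filter_upwards [self_mem_nhdsWithin] with t ht
    have h1 := norm_constantTerm_mul_pow_le (N := 0) (by simpa using h₀) ht
    simpa using h1

lemma hasMellin_halfTheta {s : ℂ} (hs : 1 / 2 < s.re) :
    HasMellin (fun x => (2 * halfTheta x : ℂ)) s (2 * completedRiemannZeta (2 * s)) := by
  have h := (HurwitzZeta.hurwitzEvenFEPair 0).hasMellin (s := s) hs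
  have e1 : (fun x => (HurwitzZeta.hurwitzEvenFEPair 0).f x - (HurwitzZeta.hurwitzEvenFEPair 0).f₀) =
      fun x => (2 * halfTheta x : ℂ) := by
    funext x
    simp only [HurwitzZeta.hurwitzEvenFEPair, Function.comp, if_true, halfTheta,
      HurwitzZeta.evenKernel_eq_cosKernel_of_zero]
    push_cast
    ring
  have e2 : (HurwitzZeta.hurwitzEvenFEPair 0).Λ s = 2 * completedRiemannZeta (2 * s) := by
    rw [← HurwitzZeta.completedHurwitzZetaEven_zero, HurwitzZeta.completedHurwitzZetaEven,
      mul_div_cancel_left₀ s two_ne_zero]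
    ring
  rwa [e1, e2] at h

/-- The Rankin–Selberg identity. -/
theorem mellin_thetaTransform {f : ℍ → ℂ} (hf : Continuous f) (hinv : IsModularInvariant f)
    (hdec : IsRapidDecay f) {s : ℂ} (hs : 1 < s.re) :
    mellin (thetaTransform f) s =
      2 * completedRiemannZeta (2 * s) * mellin (constantTerm f) (s - 1) := by
  obtain ⟨C₀, -, h₀⟩ := exists_norm_mul_pow_le hf hinv hdec 0
  simp only [pow_zero, mul_one] at h₀
  obtain ⟨hh1, hh2⟩ := hasMellin_halfTheta (s := s) (by linarith)
  have hp := mellinConvergent_constantTerm hf hinv hdec (s := s - 1)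
    (by simpa using sub_pos.mpr hs)
  set h2 : ℝ → ℂ := fun x => (2 * halfTheta x : ℂ) with hh2def
  set F : ℝ × ℝ → ℂ := fun q => (q.1 : ℂ) ^ (s - 1) *
    (constantTerm f q.2 * (h2 (q.1 / q.2) * ((q.2 ^ 2 : ℝ)⁻¹ : ℝ))) with hF
  have hcont : ContinuousOn F (Set.Ioi 0 ×ˢ Set.Ioi 0) := by
    have c1 : ContinuousOn (fun q : ℝ × ℝ => (q.1 : ℂ) ^ (s - 1)) (Set.Ioi 0 ×ˢ Set.Ioi 0) := by
      refine ContinuousOn.cpow_const (Complex.continuous_ofReal.comp continuous_fst).continuousOn ?_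
      intro q hq
      exact Complex.ofReal_mem_slitPlane.mpr hq.1
    have c2 : ContinuousOn (fun q : ℝ × ℝ => constantTerm f q.2) (Set.Ioi 0 ×ˢ Set.Ioi 0) :=
      (continuousOn_constantTerm hf h₀).comp continuousOn_snd fun q hq => hq.2
    have c3 : ContinuousOn (fun q : ℝ × ℝ => h2 (q.1 / q.2)) (Set.Ioi 0 ×ˢ Set.Ioi 0) := by
      refine continuousOn_const.mul (Complex.continuous_ofReal.comp_continuousOn
        (continuousOn_halfTheta.comp (continuousOn_fst.div continuousOn_snd
          fun q hq => (ne_of_gt hq.2)) fun q hq => ?_))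
      exact div_pos (Set.mem_Ioi.mp hq.1) (Set.mem_Ioi.mp hq.2)
    have c4 : ContinuousOn (fun q : ℝ × ℝ => (((q.2 ^ 2 : ℝ)⁻¹ : ℝ) : ℂ)) (Set.Ioi 0 ×ˢ Set.Ioi 0) := by
      refine Complex.continuous_ofReal.comp_continuousOn (ContinuousOn.inv₀ (by fun_prop) ?_)
      intro q hq
      exact pow_ne_zero 2 (ne_of_gt hq.2)
    exact c1.mul (c2.mul (c3.mul c4))
  have hmeas : AEStronglyMeasurable F
      ((volume.restrict (Set.Ioi (0 : ℝ))).prod (volume.restrict (Set.Ioi (0 : ℝ)))) := by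
    rw [Measure.prod_restrict]
    exact hcont.aestronglyMeasurable (measurableSet_Ioi.prod measurableSet_Ioi)
  set G : ℝ → ℝ := fun u => ‖(u : ℂ) ^ (s - 1) • h2 u‖
  have hFeq : ∀ y t, F (t, y) = (constantTerm f y * ((y ^ 2 : ℝ)⁻¹ : ℝ)) *
      ((t : ℂ) ^ (s - 1) • h2 (y⁻¹ * t)) := by
    intro y t
    simp only [hF, smul_eq_mul, div_eq_inv_mul]
    ring
  -- Absolute convergence for Fubini: scaling `t` by `y` separates the double integral into a Mellin
  -- integral of `a₀` times one of the theta weight. The condition `Re s > 1` is needed for the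
  -- former.
  have hint : Integrable F
      ((volume.restrict (Set.Ioi (0 : ℝ))).prod (volume.restrict (Set.Ioi (0 : ℝ)))) := by
    rw [integrable_prod_iff' hmeas]
    constructor
    · refine (ae_restrict_iff' measurableSet_Ioi).mpr (ae_of_all _ fun y hy => ?_)
      simp_rw [hFeq]
      exact ((MellinConvergent.comp_mul_left (inv_pos.mpr hy)).mpr hh1).const_mul _
    · have e : ∀ y ∈ Set.Ioi (0 : ℝ), (∫ t in Set.Ioi (0 : ℝ), ‖F (t, y)‖) =
          ‖(y : ℂ) ^ (s - 1 - 1) • constantTerm f y‖ * ∫ u in Set.Ioi (0 : ℝ), G u := by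
        intro y hy
        have hy : 0 < y := hy
        have e1 : ∀ t ∈ Set.Ioi (0 : ℝ), ‖F (t, y)‖ =
            ‖constantTerm f y * ((y ^ 2 : ℝ)⁻¹ : ℝ)‖ * (y ^ (s.re - 1) * G (y⁻¹ * t)) := by
          intro t ht
          have ht : 0 < t := ht
          have hyt : 0 < y⁻¹ * t := by positivity
          rw [hFeq, norm_mul]
          congr 1
          simp only [G]
          rw [norm_smul, norm_smul, Complex.norm_cpow_eq_rpow_re_of_pos ht,
            Complex.norm_cpow_eq_rpow_re_of_pos hyt, ← mul_assoc]
          congr 1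
          simp only [Complex.sub_re, Complex.one_re]
          rw [← Real.mul_rpow hy.le hyt.le, mul_inv_cancel_left₀ hy.ne']
        rw [setIntegral_congr_fun measurableSet_Ioi e1, integral_const_mul, integral_const_mul,
          integral_comp_mul_left_Ioi G 0 (inv_pos.mpr hy), mul_zero, inv_inv, smul_eq_mul,
          norm_smul, norm_mul, Complex.norm_cpow_eq_rpow_re_of_pos hy, Complex.norm_real,
          Real.norm_of_nonneg (by positivity)]
        have : y ^ ((s - 1 - 1).re) = (y ^ 2)⁻¹ * (y ^ (s.re - 1) * y) := by
          simp only [Complex.sub_re, Complex.one_re]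
          rw [← Real.rpow_add_one hy.ne', ← Real.rpow_natCast, ← Real.rpow_neg hy.le,
            ← Real.rpow_add hy]
          congr 1
          push_cast
          ring
        rw [this]
        ring
      have := (hp.norm).mul_const (∫ u in Set.Ioi (0 : ℝ), G u)
      exact (integrableOn_congr_fun e measurableSet_Ioi).mpr this
  have hswap := integral_integral_swap (f := fun t y => F (t, y)) hint
  rw [mellin]
  have l1 : ∀ t ∈ Set.Ioi (0 : ℝ), (t : ℂ) ^ (s - 1) • thetaTransform f t =
      ∫ y in Set.Ioi (0 : ℝ), F (t, y) := by
    intro t _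
    rw [thetaTransform, smul_eq_mul, ← integral_const_mul]
  rw [setIntegral_congr_fun measurableSet_Ioi l1, hswap]
  have l2 : ∀ y ∈ Set.Ioi (0 : ℝ), (∫ t in Set.Ioi (0 : ℝ), F (t, y)) =
      2 * completedRiemannZeta (2 * s) * ((y : ℂ) ^ (s - 1 - 1) • constantTerm f y) := by
    intro y hy
    have hy : 0 < y := hy
    simp_rw [hFeq]
    rw [integral_const_mul]
    have := mellin_comp_mul_left h2 s (inv_pos.mpr hy)
    rw [mellin] at this
    rw [this, hh2, smul_eq_mul, smul_eq_mul]
    have e3 : (y : ℂ) ^ (s - 1 - 1) = (((y ^ 2 : ℝ)⁻¹ : ℝ) : ℂ) * ((y⁻¹ : ℝ) : ℂ) ^ (-s) := by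
      have hy' : (y : ℂ) ≠ 0 := by exact_mod_cast hy.ne'
      rw [Complex.ofReal_inv, Complex.ofReal_inv, Complex.inv_cpow _ _ (by
        rw [Complex.arg_ofReal_of_nonneg hy.le]; exact Real.pi_pos.ne), Complex.cpow_neg, inv_inv,
        show s - 1 - 1 = s - (2 : ℕ) by push_cast; ring, Complex.cpow_sub _ _ hy',
        Complex.cpow_natCast]
      push_cast
      field_simp
    rw [e3]
    ring
  rw [setIntegral_congr_fun measurableSet_Ioi l2, integral_const_mul]
  rfl

/-! ### Green's formula on a period strip -/

/-- The linear identification of `ℝ × ℝ` with `ℂ`. -/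
def toComplex : ℝ × ℝ →L[ℝ] ℂ := (Complex.equivRealProdCLM.symm : ℝ × ℝ →L[ℝ] ℂ)

lemma toComplex_apply (q : ℝ × ℝ) : toComplex q = q.1 + q.2 * Complex.I := by
  simp [toComplex, Complex.equivRealProdCLM_symm_apply]

lemma toComplex_mem {q : ℝ × ℝ} (hq : 0 < q.2) : toComplex q ∈ upperHalfPlaneSet := by
  rw [toComplex_apply]
  simpa [upperHalfPlaneSet] using hq

/-- Periodicity of the gradient, which makes the vertical sides cancel in Green's formula. -/
lemma fderiv_add_one {f : ℍ → ℂ} (hinv : IsModularInvariant f) {z : ℂ}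
    (hz : z ∈ upperHalfPlaneSet) :
    fderiv ℝ (f ∘ ofComplex) (z + 1) = fderiv ℝ (f ∘ ofComplex) z := by
  rw [← fderiv_comp_add_right]
  refine Filter.EventuallyEq.fderiv_eq ?_
  filter_upwards [isOpen_upperHalfPlaneSet.mem_nhds hz] with w hw
  have hw' : 0 < (w + 1).im := by simpa [upperHalfPlaneSet] using hw
  have : ofComplex (w + 1) = ModularGroup.T • ofComplex w := by
    apply UpperHalfPlane.ext
    rw [ofComplex_apply_of_im_pos hw']
    have := ModularGroup.coe_T_zpow_smul_eq (z := ofComplex w) (n := 1)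
    rw [zpow_one] at this
    rw [this, ofComplex_apply_of_im_pos (by exact hw)]
    simp
  rw [Function.comp_apply, Function.comp_apply, this]
  exact hinv _ _

lemma hasFDerivAt_weight {w : ℝ → ℂ} {w' : ℂ} {q : ℝ × ℝ} (hw : HasDerivAt w w' q.2) :
    HasFDerivAt (fun q : ℝ × ℝ => w q.2)
      ((ContinuousLinearMap.toSpanSingleton ℝ w').comp (ContinuousLinearMap.snd ℝ ℝ ℝ)) q :=
  hw.hasFDerivAt.comp q hasFDerivAt_snd

lemma hasFDerivAt_real_coords {f : ℍ → ℂ} (hdiff : IsTwiceDifferentiable f) {q : ℝ × ℝ}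
    (hq : 0 < q.2) :
    HasFDerivAt (fun q => f (ofReIm q)) ((fderiv ℝ (f ∘ ofComplex) (toComplex q)).comp toComplex) q := by
  have h := (hdiff.1.differentiableAt (isOpen_upperHalfPlaneSet.mem_nhds (toComplex_mem hq))).hasFDerivAt
  have e : (fun q => f (ofReIm q)) = (f ∘ ofComplex) ∘ toComplex := by
    funext q
    simp [ofReIm, toComplex_apply]
  rw [e]
  exact h.comp q toComplex.hasFDerivAt

lemma hasFDerivAt_fderiv_apply {f : ℍ → ℂ} (hdiff : IsTwiceDifferentiable f) {q : ℝ × ℝ}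
    (hq : 0 < q.2) (v : ℂ) :
    HasFDerivAt (fun q => fderiv ℝ (f ∘ ofComplex) (toComplex q) v)
      ((ContinuousLinearMap.apply ℝ ℂ v).comp
        ((fderiv ℝ (fderiv ℝ (f ∘ ofComplex)) (toComplex q)).comp toComplex)) q := by
  have h := (hdiff.2.differentiableAt (isOpen_upperHalfPlaneSet.mem_nhds (toComplex_mem hq))).hasFDerivAt
  exact (ContinuousLinearMap.apply ℝ ℂ v).hasFDerivAt.comp q (h.comp q toComplex.hasFDerivAt)

/-- Green's formula on a rectangle of width one for a periodic function and a weight depending only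
on the height and vanishing, with its derivative, at both ends. -/
theorem integral_laplacian_mul_weight {f : ℍ → ℂ} (hinv : IsModularInvariant f)
    (hdiff : IsTwiceDifferentiable f) {a b : ℝ} (ha : 0 < a) (hab : a ≤ b) {w w₁ w₂ : ℝ → ℂ}
    (hw : ∀ y, 0 < y → HasDerivAt w (w₁ y) y) (hw₁ : ∀ y, 0 < y → HasDerivAt w₁ (w₂ y) y)
    (hw₂ : ContinuousOn w₂ (Set.Ioi 0)) (h0 : w a = 0) (h1 : w₁ a = 0) (h2 : w b = 0)
    (h3 : w₁ b = 0)
    (hint : IntegrableOn (fun q : ℝ × ℝ => Laplacian.laplacian (f ∘ ofComplex) (toComplex q))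
      (Set.Icc 0 1 ×ˢ Set.Icc a b)) :
    ∫ q in Set.Icc (0 : ℝ) 1 ×ˢ Set.Icc a b,
        Laplacian.laplacian (f ∘ ofComplex) (toComplex q) * w q.2 =
      ∫ y in Set.Icc a b, constantTerm f y * w₂ y := by
  set F₀ := f ∘ ofComplex with hF₀
  -- The vector field `(w f_x, w f_y - w' f)` has divergence `w (f_xx + f_yy) - w'' f`. Its flux
  -- vanishes: the vertical sides cancel by periodicity, and `w`, `w'` are zero on the horizontal
  -- ones.
  set V : ℝ × ℝ → ℂ := fun q => fderiv ℝ F₀ (toComplex q) 1 * w q.2 with hV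
  set U : ℝ × ℝ → ℂ := fun q => fderiv ℝ F₀ (toComplex q) Complex.I * w q.2 -
    f (ofReIm q) * w₁ q.2 with hU
  set V' : ℝ × ℝ → ℝ × ℝ →L[ℝ] ℂ := fderiv ℝ V
  set U' : ℝ × ℝ → ℝ × ℝ →L[ℝ] ℂ := fderiv ℝ U
  have hVd : ∀ q : ℝ × ℝ, 0 < q.2 → HasFDerivAt V (V' q) q ∧
      V' q (1, 0) = fderiv ℝ (fderiv ℝ F₀) (toComplex q) 1 1 * w q.2 := by
    intro q hq
    have h := (hasFDerivAt_fderiv_apply hdiff hq 1).mul (hasFDerivAt_weight (hw q.2 hq))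
    refine ⟨h.differentiableAt.hasFDerivAt, ?_⟩
    change fderiv ℝ V q (1, 0) = _
    rw [HasFDerivAt.fderiv (f := V) h]
    simp [toComplex_apply, mul_comm, hF₀]
  have hUd : ∀ q : ℝ × ℝ, 0 < q.2 → HasFDerivAt U (U' q) q ∧
      U' q (0, 1) = fderiv ℝ (fderiv ℝ F₀) (toComplex q) Complex.I Complex.I * w q.2 -
        f (ofReIm q) * w₂ q.2 := by
    intro q hq
    have h := ((hasFDerivAt_fderiv_apply hdiff hq Complex.I).mul
      (hasFDerivAt_weight (hw q.2 hq))).sub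
      ((hasFDerivAt_real_coords hdiff hq).mul (hasFDerivAt_weight (hw₁ q.2 hq)))
    refine ⟨h.differentiableAt.hasFDerivAt, ?_⟩
    change fderiv ℝ U q (0, 1) = _
    rw [HasFDerivAt.fderiv (f := U) h]
    simp [toComplex_apply, hF₀]
    ring
  have hbox : Set.Icc ((0 : ℝ), a) ((1 : ℝ), b) = Set.Icc 0 1 ×ˢ Set.Icc a b := by
    rw [Set.Icc_prod_eq]
  have hpos : ∀ q ∈ Set.Icc ((0 : ℝ), a) ((1 : ℝ), b), 0 < q.2 := fun q hq =>
    lt_of_lt_of_le ha hq.1.2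
  have hm : MeasurableSet (Set.Icc ((0 : ℝ), a) ((1 : ℝ), b)) := measurableSet_Icc
  have hc : IsCompact (Set.Icc ((0 : ℝ), a) ((1 : ℝ), b)) := isCompact_Icc
  have hwc : ContinuousOn w (Set.Ioi 0) := fun y hy => (hw y hy).continuousAt.continuousWithinAt
  have hfc : ContinuousOn (fun q => f (ofReIm q)) (Set.Icc ((0 : ℝ), a) ((1 : ℝ), b)) :=
    fun q hq => (hasFDerivAt_real_coords hdiff (hpos q hq)).continuousAt.continuousWithinAt
  have i1 : IntegrableOn (fun q : ℝ × ℝ => Laplacian.laplacian F₀ (toComplex q) * w q.2)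
      (Set.Icc ((0 : ℝ), a) ((1 : ℝ), b)) := by
    refine IntegrableOn.mul_continuousOn_of_subset ?_ ?_ hm hc (subset_refl _)
    · rw [hbox]; exact hint
    · exact hwc.comp continuousOn_snd hpos
  have i2 : IntegrableOn (fun q : ℝ × ℝ => f (ofReIm q) * w₂ q.2)
      (Set.Icc ((0 : ℝ), a) ((1 : ℝ), b)) :=
    (hfc.mul (hw₂.comp continuousOn_snd hpos)).integrableOn_compact hc
  have hdivg : ∀ q ∈ Set.Icc ((0 : ℝ), a) ((1 : ℝ), b), V' q (1, 0) + U' q (0, 1) =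
      Laplacian.laplacian F₀ (toComplex q) * w q.2 - f (ofReIm q) * w₂ q.2 := by
    intro q hq
    rw [(hVd q (hpos q hq)).2, (hUd q (hpos q hq)).2, laplacian_eq_fderiv_fderiv]
    ring
  -- This form of the divergence theorem asks for pointwise differentiability and integrability of
  -- the divergence, not for continuous derivatives; hence twice differentiable `f` with locally
  -- integrable `Δf` is enough.
  have key := integral_divergence_prod_Icc_of_hasFDerivAt_of_le V U V' U' (0, a) (1, b)
    ⟨zero_le_one, hab⟩
    (fun q hq => (hVd q (hpos q hq)).1.continuousAt.continuousWithinAt)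
    (fun q hq => (hUd q (hpos q hq)).1.continuousAt.continuousWithinAt)
    (fun q hq => (hVd q (lt_trans ha hq.2.1)).1)
    (fun q hq => (hUd q (lt_trans ha hq.2.1)).1)
    ((integrableOn_congr_fun hdivg hm).mpr (i1.sub i2))
  rw [setIntegral_congr_fun hm hdivg, integral_sub i1 i2] at key
  have e1 : (∫ x in (0 : ℝ)..1, U (x, b)) = 0 := by simp [hU, h2, h3]
  have e2 : (∫ x in (0 : ℝ)..1, U (x, a)) = 0 := by simp [hU, h0, h1]
  have e3 : (∫ y in a..b, V (1, y)) = ∫ y in a..b, V (0, y) := by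
    refine intervalIntegral.integral_congr fun y hy => ?_
    rw [Set.uIcc_of_le hab] at hy
    have hy0 : 0 < y := lt_of_lt_of_le ha hy.1
    simp only [hV]
    rw [show toComplex (1, y) = toComplex (0, y) + 1 by simp [toComplex_apply, add_comm],
      fderiv_add_one hinv (toComplex_mem (q := (0, y)) hy0)]
  simp only [e1, e2, e3] at key
  rw [hbox] at key i2
  have key2 : ∫ q in Set.Icc (0 : ℝ) 1 ×ˢ Set.Icc a b, Laplacian.laplacian F₀ (toComplex q) * w q.2 =
      ∫ q in Set.Icc (0 : ℝ) 1 ×ˢ Set.Icc a b, f (ofReIm q) * w₂ q.2 := by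
    linear_combination key
  rw [key2]
  rw [Measure.volume_eq_prod] at i2 ⊢
  rw [IntegrableOn, ← Measure.prod_restrict] at i2
  rw [← Measure.prod_restrict, integral_prod_symm _ i2]
  congr 1
  funext y
  rw [constantTerm_eq, integral_Ico_eq_integral_Ioc, ← integral_Icc_eq_integral_Ioc,
    ← integral_mul_const]

lemma hypLaplacian_ofReIm (f : ℍ → ℂ) {q : ℝ × ℝ} (hq : 0 < q.2) :
    Laplacian.laplacian (f ∘ ofComplex) (toComplex q) =
      ((q.2 ^ 2)⁻¹ : ℝ) • hypLaplacian f (ofReIm q) := by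
  rw [hypLaplacian, ofReIm_im hq, smul_smul, inv_mul_cancel₀ (by positivity), one_smul,
    coe_ofReIm hq, toComplex_apply]

lemma integrableOn_laplacian_box {f : ℍ → ℂ} (hloc : LocallyIntegrable (hypLaplacian f) volume)
    {a b : ℝ} (ha : 0 < a) :
    IntegrableOn (fun q : ℝ × ℝ => Laplacian.laplacian (f ∘ ofComplex) (toComplex q))
      (Set.Icc 0 1 ×ˢ Set.Icc a b) := by
  set A := Set.Icc (0 : ℝ) 1 ×ˢ Set.Icc a b
  have hA : MeasurableSet A := measurableSet_Icc.prod measurableSet_Icc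
  have hA0 : ∀ q ∈ A, 0 < q.2 := fun q hq => lt_of_lt_of_le ha hq.2.1
  have hK : IsCompact (reIm ⁻¹' A) := by
    have : reIm ⁻¹' A = ofReIm '' A := by
      ext z
      constructor
      · intro hz
        exact ⟨reIm z, hz, ofReIm_reIm z⟩
      · rintro ⟨q, hq, rfl⟩
        have : reIm (ofReIm q) = q := by
          rw [reIm, ofReIm_re (hA0 q hq), ofReIm_im (hA0 q hq)]
        rw [Set.mem_preimage, this]
        exact hq
    rw [this]
    exact (isCompact_Icc.prod isCompact_Icc).image_of_continuousOn (continuousOn_ofReIm.mono hA0)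
  have := (integrableOn_preimage_iff hA hA0 _).mp (hloc.integrableOn_isCompact hK)
  exact (integrableOn_congr_fun (fun q hq => hypLaplacian_ofReIm f (hA0 q hq)) hA).mpr this

/-! ### Decay of the Mellin transform of the constant term on vertical lines -/

lemma exists_smooth_step : ∃ κ κ₁ κ₂ : ℝ → ℝ, ∃ B, 0 ≤ B ∧ (∀ u, HasDerivAt κ (κ₁ u) u) ∧
    (∀ u, HasDerivAt κ₁ (κ₂ u) u) ∧ Continuous κ₂ ∧ (∀ u, 0 ≤ κ u ∧ κ u ≤ 1) ∧
    (∀ u, u ≤ 1 → κ u = 0 ∧ κ₁ u = 0 ∧ κ₂ u = 0) ∧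
    (∀ u, 2 ≤ u → κ u = 1 ∧ κ₁ u = 0 ∧ κ₂ u = 0) ∧
    ∀ u, |u * κ₁ u| ≤ B ∧ |u ^ 2 * κ₂ u| ≤ B := by
  -- The transition takes place on `[5/4, 7/4]`, so `κ` is constant in a neighbourhood of each point
  -- with `u ≤ 1` or `u ≥ 2`, and its derivatives vanish there including at the endpoints.
  set κ : ℝ → ℝ := fun u => Real.smoothTransition (2 * u - 5 / 2) with hκ
  have hs : ContDiff ℝ 2 κ := Real.smoothTransition.contDiff.comp (by fun_prop)
  have hs1 : ContDiff ℝ 1 (deriv κ) := hs.deriv'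
  have hs2 : Continuous (deriv (deriv κ)) := hs1.continuous_deriv le_rfl
  have hlow : ∀ u : ℝ, u ≤ 1 → κ u = 0 ∧ deriv κ u = 0 ∧ deriv (deriv κ) u = 0 := by
    intro u hu
    have h1 : κ =ᶠ[𝓝 u] fun _ => 0 := by
      filter_upwards [gt_mem_nhds (show u < 5 / 4 by linarith)] with v hv
      exact Real.smoothTransition.zero_of_nonpos (by linarith)
    have h2 : deriv κ =ᶠ[𝓝 u] fun _ => 0 := by simpa using h1.deriv
    exact ⟨h1.eq_of_nhds, h2.eq_of_nhds, by simpa using h2.deriv_eq⟩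
  have hhigh : ∀ u : ℝ, 2 ≤ u → κ u = 1 ∧ deriv κ u = 0 ∧ deriv (deriv κ) u = 0 := by
    intro u hu
    have h1 : κ =ᶠ[𝓝 u] fun _ => 1 := by
      filter_upwards [lt_mem_nhds (show 7 / 4 < u by linarith)] with v hv
      exact Real.smoothTransition.one_of_one_le (by linarith)
    have h2 : deriv κ =ᶠ[𝓝 u] fun _ => 0 := by simpa using h1.deriv
    exact ⟨h1.eq_of_nhds, h2.eq_of_nhds, by simpa using h2.deriv_eq⟩
  obtain ⟨B₁, hB₁⟩ := (isCompact_Icc (a := (1 : ℝ)) (b := 2)).exists_bound_of_continuousOn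
    (f := fun u => u * deriv κ u) (by have := hs1.continuous; fun_prop)
  obtain ⟨B₂, hB₂⟩ := (isCompact_Icc (a := (1 : ℝ)) (b := 2)).exists_bound_of_continuousOn
    (f := fun u => u ^ 2 * deriv (deriv κ) u) (by fun_prop)
  have hB0 : 0 ≤ max B₁ B₂ := (norm_nonneg _).trans ((hB₁ 1 (by simp)).trans (le_max_left _ _))
  refine ⟨κ, deriv κ, deriv (deriv κ), max B₁ B₂, hB0,
    fun u => (hs.differentiable (by norm_num) u).hasDerivAt,
    fun u => (hs1.differentiable (by norm_num) u).hasDerivAt, hs2,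
    fun u => ⟨Real.smoothTransition.nonneg _, Real.smoothTransition.le_one _⟩, hlow, hhigh,
    fun u => ?_⟩
  rcases le_total u 1 with h | h
  · rw [(hlow u h).2.1, (hlow u h).2.2]
    simpa using hB0
  rcases le_total 2 u with h' | h'
  · rw [(hhigh u h').2.1, (hhigh u h').2.2]
    simpa using hB0
  · exact ⟨(hB₁ u ⟨h, h'⟩).trans (le_max_left _ _), (hB₂ u ⟨h, h'⟩).trans (le_max_right _ _)⟩

/-- A product of a step up at scale `η` and a step down at scale `Y`. Since `yχ'` and `y²χ''` are
invariant under scaling, `B` depends on neither scale. -/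
lemma exists_band_cutoff : ∃ B, 0 ≤ B ∧ ∀ η Y : ℝ, 0 < η → 2 * η ≤ Y →
    ∃ χ χ₁ χ₂ : ℝ → ℝ, (∀ y, HasDerivAt χ (χ₁ y) y) ∧ (∀ y, HasDerivAt χ₁ (χ₂ y) y) ∧
    Continuous χ₂ ∧ (∀ y, 0 ≤ χ y ∧ χ y ≤ 1) ∧
    (∀ y, y ≤ η ∨ 2 * Y ≤ y → χ y = 0 ∧ χ₁ y = 0 ∧ χ₂ y = 0) ∧
    (∀ y, 2 * η ≤ y → y ≤ Y → χ y = 1 ∧ χ₁ y = 0 ∧ χ₂ y = 0) ∧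
    ∀ y, |y * χ₁ y| ≤ B ∧ |y ^ 2 * χ₂ y| ≤ B := by
  obtain ⟨κ, κ₁, κ₂, B, hB, h1, h2, hc, h01, hlow, hhigh, hb⟩ := exists_smooth_step
  refine ⟨2 * B + 2 * B ^ 2, by positivity, fun η Y hη hηY => ?_⟩
  have hY : 0 < Y := by linarith
  have hdiv : ∀ c y : ℝ, HasDerivAt (fun y : ℝ => y / c) c⁻¹ y := fun c y => by
    simpa [div_eq_mul_inv] using (hasDerivAt_id y).mul_const c⁻¹
  have d1 : ∀ c y : ℝ, HasDerivAt (fun y : ℝ => κ (y / c)) (κ₁ (y / c) * c⁻¹) y := fun c y =>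
    HasDerivAt.comp y (h1 (y / c)) (hdiv c y)
  have d2 : ∀ c y : ℝ, HasDerivAt (fun y : ℝ => κ₁ (y / c) * c⁻¹) (κ₂ (y / c) * c⁻¹ * c⁻¹) y :=
    fun c y => (HasDerivAt.comp y (h2 (y / c)) (hdiv c y)).mul_const _
  have hk1 : Continuous κ₁ := continuous_iff_continuousAt.mpr fun u => (h2 u).continuousAt
  have hk : Continuous κ := continuous_iff_continuousAt.mpr fun u => (h1 u).continuousAt
  have hle1 : ∀ y, y ≤ η → y / η ≤ 1 := fun y hy => by rwa [div_le_one hη]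
  have hle2 : ∀ y, y ≤ Y → y / Y ≤ 1 := fun y hy => by rwa [div_le_one hY]
  have hge1 : ∀ y, 2 * η ≤ y → 2 ≤ y / η := fun y hy => by rwa [le_div_iff₀ hη]
  have hge2 : ∀ y, 2 * Y ≤ y → 2 ≤ y / Y := fun y hy => by rwa [le_div_iff₀ hY]
  refine ⟨fun y => κ (y / η) * (1 - κ (y / Y)),
    fun y => κ₁ (y / η) * η⁻¹ * (1 - κ (y / Y)) + κ (y / η) * (0 - κ₁ (y / Y) * Y⁻¹),
    fun y => (κ₂ (y / η) * η⁻¹ * η⁻¹ * (1 - κ (y / Y)) +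
      κ₁ (y / η) * η⁻¹ * (0 - κ₁ (y / Y) * Y⁻¹)) +
      (κ₁ (y / η) * η⁻¹ * (0 - κ₁ (y / Y) * Y⁻¹) + κ (y / η) * (0 - κ₂ (y / Y) * Y⁻¹ * Y⁻¹)),
    fun y => (d1 η y).mul ((hasDerivAt_const y 1).sub (d1 Y y)),
    fun y => ((d2 η y).mul ((hasDerivAt_const y 1).sub (d1 Y y))).add
      ((d1 η y).mul ((hasDerivAt_const y 0).sub (d2 Y y))),
    by fun_prop, fun y => ?_, fun y hy => ?_, fun y hy1 hy2 => ?_, fun y => ?_⟩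
  · have a := h01 (y / η)
    have b := h01 (y / Y)
    exact ⟨mul_nonneg a.1 (by linarith [b.2]),
      mul_le_one₀ a.2 (by linarith [b.2]) (by linarith [b.1])⟩
  · rcases hy with hy | hy
    · obtain ⟨a, b, c⟩ := hlow _ (hle1 y hy)
      simp [a, b, c]
    · obtain ⟨a, b, c⟩ := hhigh _ (hge2 y hy)
      simp [a, b, c]
  · obtain ⟨a, b, c⟩ := hhigh _ (hge1 y hy1)
    obtain ⟨a', b', c'⟩ := hlow _ (hle2 y hy2)
    simp [a, b, c, a', b', c']
  · obtain ⟨b1, b2⟩ := hb (y / η)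
    obtain ⟨b3, b4⟩ := hb (y / Y)
    have a := h01 (y / η)
    have b := h01 (y / Y)
    have a1 : |κ (y / η)| ≤ 1 := abs_le.mpr ⟨by linarith, by linarith⟩
    have a2 : |1 - κ (y / Y)| ≤ 1 := abs_le.mpr ⟨by linarith, by linarith⟩
    have hBB : 0 ≤ B ^ 2 := sq_nonneg B
    have m : ∀ {x u c d : ℝ}, |x| ≤ c → |u| ≤ d → |x * u| ≤ c * d := fun {x u c d} hx hu =>
      abs_mul x u ▸ mul_le_mul hx hu (abs_nonneg u) ((abs_nonneg x).trans hx)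
    constructor
    · have e : y * (κ₁ (y / η) * η⁻¹ * (1 - κ (y / Y)) + κ (y / η) * (0 - κ₁ (y / Y) * Y⁻¹)) =
          (y / η * κ₁ (y / η)) * (1 - κ (y / Y)) - κ (y / η) * (y / Y * κ₁ (y / Y)) := by ring
      rw [e]
      refine (abs_sub _ _).trans ?_
      linarith [m b1 a2, m a1 b3]
    · have e : y ^ 2 * ((κ₂ (y / η) * η⁻¹ * η⁻¹ * (1 - κ (y / Y)) +
          κ₁ (y / η) * η⁻¹ * (0 - κ₁ (y / Y) * Y⁻¹)) +
          (κ₁ (y / η) * η⁻¹ * (0 - κ₁ (y / Y) * Y⁻¹) + κ (y / η) * (0 - κ₂ (y / Y) * Y⁻¹ * Y⁻¹))) =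
          ((y / η) ^ 2 * κ₂ (y / η)) * (1 - κ (y / Y)) -
          (2 * ((y / η * κ₁ (y / η)) * (y / Y * κ₁ (y / Y))) +
            κ (y / η) * ((y / Y) ^ 2 * κ₂ (y / Y))) := by ring
      rw [e]
      refine (abs_sub _ _).trans ?_
      have c0 := abs_add_le (2 * ((y / η * κ₁ (y / η)) * (y / Y * κ₁ (y / Y))))
        (κ (y / η) * ((y / Y) ^ 2 * κ₂ (y / Y)))
      linarith [m b2 a2, m a1 b4, m (abs_two (α := ℝ)).le (m b1 b3)]

/-- The mass of the constant term outside the band `2η < y < Y`. -/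
def outsideMass (f : ℍ → ℂ) (δ η Y : ℝ) : ℝ :=
  ∫ y in Set.Ioi (0 : ℝ), {y | y ≤ 2 * η ∨ Y ≤ y}.indicator
    (fun y => ‖(y : ℂ) ^ ((δ : ℂ) - 1) • constantTerm f y‖) y

/-- Boundedness of `f` handles the part below `2η`, and rapid decay the part above `Y`. -/
lemma outsideMass_le {f : ℍ → ℂ} {C₀ C : ℝ} {N : ℕ} {δ η Y : ℝ} (hδ : 0 < δ) (hη : 0 < η)
    (hY : 0 < Y) (hN : δ < N) (h₀ : ∀ z, ‖f z‖ ≤ C₀) (h : ∀ z, ‖f z‖ * z.im ^ N ≤ C) :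
    outsideMass f δ η Y ≤ C₀ * (2 * η) ^ δ / δ + C * Y ^ (δ - N) / (N - δ) := by
  have i1 : IntegrableOn (fun y : ℝ => C₀ * y ^ (δ - 1)) (Set.Ioc 0 (2 * η)) :=
    (((intervalIntegral.intervalIntegrable_rpow' (by linarith)).1).const_mul _)
  have i2 : IntegrableOn (fun y : ℝ => C * y ^ (δ - 1 - N)) (Set.Ioi Y) :=
    (integrableOn_Ioi_rpow_of_lt (by linarith) hY).const_mul _
  have e1 : ∫ y in Set.Ioc 0 (2 * η), C₀ * y ^ (δ - 1) = C₀ * (2 * η) ^ δ / δ := by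
    rw [← intervalIntegral.integral_of_le (by positivity), intervalIntegral.integral_const_mul,
      integral_rpow (Or.inl (by linarith))]
    rw [sub_add_cancel, Real.zero_rpow hδ.ne', sub_zero, mul_div_assoc]
  have e2 : ∫ y in Set.Ioi Y, C * y ^ (δ - 1 - N) = C * Y ^ (δ - N) / (N - δ) := by
    rw [integral_const_mul, integral_Ioi_rpow_of_lt (by linarith) hY,
      show δ - 1 - N + 1 = δ - N by ring, mul_div_assoc, neg_div, ← div_neg, neg_sub]
  have i2' : IntegrableOn (fun y : ℝ => C * y ^ (δ - 1 - N)) (Set.Ici Y) :=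
    (integrableOn_Ici_iff_integrableOn_Ioi).mpr i2
  have e2' : ∫ y in Set.Ici Y, C * y ^ (δ - 1 - N) = C * Y ^ (δ - N) / (N - δ) := by
    rw [integral_Ici_eq_integral_Ioi, e2]
  rw [← e1, ← e2', ← integral_indicator measurableSet_Ioc, ← integral_indicator measurableSet_Ici,
    ← integral_add ((integrable_indicator_iff measurableSet_Ioc).mpr i1)
    ((integrable_indicator_iff measurableSet_Ici).mpr i2'), outsideMass,
    ← integral_indicator measurableSet_Ioi]
  have hC₀ : 0 ≤ C₀ := (norm_nonneg _).trans (h₀ UpperHalfPlane.I)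
  have hC : 0 ≤ C := le_trans (mul_nonneg (norm_nonneg _) (by simp)) (h UpperHalfPlane.I)
  refine integral_mono_of_nonneg (ae_of_all _ fun y => ?_)
    (((integrable_indicator_iff measurableSet_Ioc).mpr i1).add
      ((integrable_indicator_iff measurableSet_Ici).mpr i2')) (ae_of_all _ fun y => ?_)
  · exact Set.indicator_nonneg (fun y _ => Set.indicator_nonneg (fun _ _ => norm_nonneg _) _) _
  · simp only
    have n1 : 0 ≤ (Set.Ioc 0 (2 * η)).indicator (fun y : ℝ => C₀ * y ^ (δ - 1)) y :=
      Set.indicator_nonneg (fun y hy => mul_nonneg hC₀ (Real.rpow_nonneg hy.1.le _)) _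
    have n2 : 0 ≤ (Set.Ici Y).indicator (fun y : ℝ => C * y ^ (δ - 1 - N)) y :=
      Set.indicator_nonneg (fun y hy => mul_nonneg hC
        (Real.rpow_nonneg (hY.le.trans hy) _)) _
    by_cases hy : y ∈ Set.Ioi (0 : ℝ)
    swap
    · rw [Set.indicator_of_notMem hy]
      exact add_nonneg n1 n2
    have hy0 : 0 < y := hy
    rw [Set.indicator_of_mem hy]
    by_cases hJ : y ≤ 2 * η ∨ Y ≤ y
    swap
    · rw [Set.indicator_of_notMem (by exact hJ)]
      exact add_nonneg n1 n2
    rw [Set.indicator_of_mem (by exact hJ), norm_smul, Complex.norm_cpow_eq_rpow_re_of_pos hy0]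
    simp only [Complex.sub_re, Complex.ofReal_re, Complex.one_re]
    rcases hJ with hJ | hJ
    · refine le_add_of_le_of_nonneg ?_ n2
      rw [Set.indicator_of_mem (show y ∈ Set.Ioc 0 (2 * η) from ⟨hy0, hJ⟩), mul_comm]
      have := norm_constantTerm_mul_pow_le (N := 0) (by simpa using h₀) hy0
      rw [pow_zero, mul_one] at this
      gcongr
    · refine le_add_of_nonneg_of_le n1 ?_
      rw [Set.indicator_of_mem (by exact hJ), mul_comm]
      have := norm_constantTerm_mul_pow_le h hy0
      rw [← le_div_iff₀ (pow_pos hy0 N)] at this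
      calc ‖constantTerm f y‖ * y ^ (δ - 1) ≤ C / y ^ N * y ^ (δ - 1) := by gcongr
        _ = C * y ^ (δ - 1 - N) := by
          rw [Real.rpow_sub hy0 (δ - 1) N, Real.rpow_natCast]
          ring

lemma hasDerivAt_ofReal_cpow (s : ℂ) {y : ℝ} (hy : 0 < y) :
    HasDerivAt (fun y : ℝ => (y : ℂ) ^ s) (s * (y : ℂ) ^ (s - 1)) y := by
  have h := (hasDerivAt_id (y : ℂ)).cpow_const (c := s) (Complex.ofReal_mem_slitPlane.mpr hy)
  simpa using h.comp_ofReal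

/-- The Mellin transform of the constant term against the Laplacian, with cut-offs. -/
theorem exists_norm_mul_mellin_le {f : ℍ → ℂ} (hinv : IsModularInvariant f)
    (hdec : IsRapidDecay f) (hdiff : IsTwiceDifferentiable f)
    (hloc : LocallyIntegrable (hypLaplacian f) volume)
    (hlap : hypLaplacian f =O[atImInfty] fun z : ℍ => z.im ^ (1 / 4 : ℝ)) {δ : ℝ} (hδ : 0 < δ) :
    ∃ A, 0 ≤ A ∧ ∀ s : ℂ, s.re = 1 + δ → ∀ η Y : ℝ, 0 < η → 2 * η ≤ Y → 1 ≤ Y →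
      ‖s * (s - 1)‖ * ‖mellin (constantTerm f) (s - 1)‖ ≤
        A * Y ^ (1 + δ) + A * (1 + ‖s‖) ^ 2 * outsideMass f δ η Y := by
  obtain ⟨B, hB, hcut⟩ := exists_band_cutoff
  obtain ⟨C, hC, hstrip⟩ := exists_setIntegral_strip_le (hypLaplacian_invariant hinv hdiff)
    hloc hlap hδ
  have hf := hdiff.continuous
  obtain ⟨C₀, -, h₀⟩ := exists_norm_mul_pow_le hf hinv hdec 0
  simp only [pow_zero, mul_one] at h₀
  refine ⟨C * 2 ^ (1 + δ) + (1 + 2 * B), by positivity, fun s hs η Y hη hηY hY => ?_⟩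
  obtain ⟨χ, χ₁, χ₂, d1, d2, hχ₂, h01, hout, hin, hb⟩ := hcut η Y hη hηY
  have hχ₁ : Continuous χ₁ := continuous_iff_continuousAt.mpr fun u => (d2 u).continuousAt
  have hχ : Continuous χ := continuous_iff_continuousAt.mpr fun u => (d1 u).continuousAt
  -- Apart from the cut-off, `w'' = s(s-1) y^(s-2)`, so Green's formula relates `s(s-1)` times the
  -- Mellin transform to the integral of `Δf`. The discrepancy lives where `χ` is not identically
  -- `1`, and is bounded by `outsideMass`.
  set w : ℝ → ℂ := fun y => (y : ℂ) ^ s * χ y with hw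
  set w₁ : ℝ → ℂ := fun y => s * (y : ℂ) ^ (s - 1) * χ y + (y : ℂ) ^ s * χ₁ y with hw₁
  set w₂ : ℝ → ℂ := fun y => (s * ((s - 1) * (y : ℂ) ^ (s - 1 - 1)) * χ y +
    s * (y : ℂ) ^ (s - 1) * χ₁ y) + (s * (y : ℂ) ^ (s - 1) * χ₁ y + (y : ℂ) ^ s * χ₂ y) with hw₂
  have dw : ∀ y, 0 < y → HasDerivAt w (w₁ y) y := fun y hy =>
    (hasDerivAt_ofReal_cpow s hy).mul (d1 y).ofReal_comp
  have dw₁ : ∀ y, 0 < y → HasDerivAt w₁ (w₂ y) y := fun y hy =>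
    (((hasDerivAt_ofReal_cpow (s - 1) hy).const_mul s).mul (d1 y).ofReal_comp).add
      ((hasDerivAt_ofReal_cpow s hy).mul (d2 y).ofReal_comp)
  have hcpow : ∀ s : ℂ, ContinuousOn (fun y : ℝ => (y : ℂ) ^ s) (Set.Ioi 0) := fun s y hy =>
    (hasDerivAt_ofReal_cpow s hy).continuousAt.continuousWithinAt
  have cw₂ : ContinuousOn w₂ (Set.Ioi 0) := by
    have c0 := hcpow s
    have c1 := hcpow (s - 1)
    have c2 := hcpow (s - 1 - 1)
    have k0 : ContinuousOn (fun y => (χ y : ℂ)) (Set.Ioi 0) :=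
      (Complex.continuous_ofReal.comp hχ).continuousOn
    have k1 : ContinuousOn (fun y => (χ₁ y : ℂ)) (Set.Ioi 0) :=
      (Complex.continuous_ofReal.comp hχ₁).continuousOn
    have k2 : ContinuousOn (fun y => (χ₂ y : ℂ)) (Set.Ioi 0) :=
      (Complex.continuous_ofReal.comp hχ₂).continuousOn
    exact (((continuousOn_const.mul (continuousOn_const.mul c2)).mul k0).add
      ((continuousOn_const.mul c1).mul k1)).add
      (((continuousOn_const.mul c1).mul k1).add (c0.mul k2))
  have hη2Y : η ≤ 2 * Y := by linarith
  obtain ⟨z1, z2, -⟩ := hout η (Or.inl le_rfl)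
  obtain ⟨z3, z4, -⟩ := hout (2 * Y) (Or.inr le_rfl)
  have hlapint := integrableOn_laplacian_box hloc (b := 2 * Y) hη
  have green := integral_laplacian_mul_weight hinv hdiff hη hη2Y dw dw₁ cw₂
    (by simp [hw, z1]) (by simp [hw₁, z1, z2]) (by simp [hw, z3]) (by simp [hw₁, z3, z4]) hlapint
  -- the contribution of the Laplacian
  have hlapbound : ‖∫ q in Set.Icc (0 : ℝ) 1 ×ˢ Set.Icc η (2 * Y),
      Laplacian.laplacian (f ∘ ofComplex) (toComplex q) * w q.2‖ ≤ C * 2 ^ (1 + δ) * Y ^ (1 + δ) := by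
    obtain ⟨i1, i2⟩ := hstrip (2 * Y) (by linarith)
    have hbox : (Set.Icc (0 : ℝ) 1 ×ˢ Set.Icc η (2 * Y) : Set (ℝ × ℝ)) ≤ᵐ[volume]
        (Set.Ico (0 : ℝ) 1 ×ˢ Set.Ioc 0 (2 * Y) : Set (ℝ × ℝ)) := by
      have e : (Set.Ico (0 : ℝ) 1 ×ˢ Set.Icc η (2 * Y) : Set (ℝ × ℝ)) =ᵐ[volume]
          (Set.Icc (0 : ℝ) 1 ×ˢ Set.Icc η (2 * Y) : Set (ℝ × ℝ)) :=
        Measure.set_prod_ae_eq Ico_ae_eq_Icc (EventuallyEq.refl _ _)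
      refine e.symm.le.trans (LE.le.eventuallyLE ?_)
      exact Set.prod_mono (subset_refl _) fun y hy => ⟨lt_of_lt_of_le hη hy.1, hy.2⟩
    calc _ ≤ ∫ q in Set.Icc (0 : ℝ) 1 ×ˢ Set.Icc η (2 * Y),
          q.2 ^ (δ - 1) * ‖hypLaplacian f (ofReIm q)‖ := by
          refine norm_integral_le_of_norm_le (IntegrableOn.mono_set_ae i1 hbox)
            ((ae_restrict_iff' (measurableSet_Icc.prod measurableSet_Icc)).mpr
              (ae_of_all _ fun q hq => ?_))
          have hq0 : 0 < q.2 := lt_of_lt_of_le hη hq.2.1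
          rw [hypLaplacian_ofReIm f hq0, norm_mul, norm_smul, Real.norm_of_nonneg (by positivity)]
          have hwq : ‖w q.2‖ ≤ q.2 ^ (1 + δ) := by
            simp only [hw]
            rw [norm_mul, Complex.norm_cpow_eq_rpow_re_of_pos hq0, hs, Complex.norm_real,
              Real.norm_of_nonneg (h01 _).1]
            exact mul_le_of_le_one_right (Real.rpow_nonneg hq0.le _) (h01 _).2
          calc (q.2 ^ 2)⁻¹ * ‖hypLaplacian f (ofReIm q)‖ * ‖w q.2‖
              ≤ (q.2 ^ 2)⁻¹ * ‖hypLaplacian f (ofReIm q)‖ * q.2 ^ (1 + δ) := by gcongr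
            _ = q.2 ^ (δ - 1) * ‖hypLaplacian f (ofReIm q)‖ := by
              rw [show δ - 1 = (1 + δ) - (2 : ℕ) by push_cast; ring, Real.rpow_sub hq0 (1 + δ),
                Real.rpow_natCast]
              ring
      _ ≤ ∫ q in Set.Ico (0 : ℝ) 1 ×ˢ Set.Ioc 0 (2 * Y),
          q.2 ^ (δ - 1) * ‖hypLaplacian f (ofReIm q)‖ := by
          refine setIntegral_mono_set i1 ?_ hbox
          refine (ae_restrict_iff' (measurableSet_Ico.prod measurableSet_Ioc)).mpr
              (ae_of_all _ fun q hq => ?_)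
          exact mul_nonneg (Real.rpow_nonneg hq.2.1.le _) (norm_nonneg _)
      _ ≤ C * (2 * Y) ^ (1 + δ) := i2
      _ = _ := by rw [Real.mul_rpow (by norm_num) (by linarith)]; ring
  -- the contribution of the cut-offs
  set p := constantTerm f with hp
  have hpc : ContinuousOn p (Set.Ioi 0) := continuousOn_constantTerm hf h₀
  have i1 : IntegrableOn (fun y : ℝ => (y : ℂ) ^ (s - 1 - 1) • p y) (Set.Ioi 0) :=
    mellinConvergent_constantTerm hf hinv hdec (s := s - 1) (by simp [hs, hδ])
  have hIcc : Set.Icc η (2 * Y) ⊆ Set.Ioi 0 := fun y hy => lt_of_lt_of_le hη hy.1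
  have hzero : ∀ y ∈ Set.Ioi (0 : ℝ) \ Set.Icc η (2 * Y), p y * w₂ y = 0 := by
    intro y hy
    have : y ≤ η ∨ 2 * Y ≤ y := by
      by_contra! h
      exact hy.2 ⟨h.1.le, h.2.le⟩
    obtain ⟨a, b, c⟩ := hout y this
    simp [hw₂, a, b, c]
  have i2 : IntegrableOn (fun y : ℝ => p y * w₂ y) (Set.Ioi 0) := by
    have : IntegrableOn (fun y : ℝ => p y * w₂ y) (Set.Icc η (2 * Y)) :=
      ((hpc.mul cw₂).mono hIcc).integrableOn_compact isCompact_Icc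
    exact this.of_forall_sdiff_eq_zero measurableSet_Ioi hzero
  have e2 : ∫ y in Set.Icc η (2 * Y), p y * w₂ y = ∫ y in Set.Ioi (0 : ℝ), p y * w₂ y :=
    (setIntegral_eq_of_subset_of_forall_sdiff_eq_zero measurableSet_Ioi hIcc hzero).symm
  set J : Set ℝ := {y | y ≤ 2 * η ∨ Y ≤ y} with hJ
  have hJm : MeasurableSet J := measurableSet_Iic.union measurableSet_Ici
  set D := (1 + 2 * B) * (1 + ‖s‖) ^ 2
  have hD : ‖s * (s - 1)‖ + 2 * ‖s‖ * B + B ≤ D := by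
    have h1 : ‖s - 1‖ ≤ ‖s‖ + 1 := (norm_sub_le _ _).trans (by simp)
    rw [norm_mul]
    have h2 := mul_le_mul_of_nonneg_left h1 (norm_nonneg s)
    have h3 := norm_nonneg s
    nlinarith [mul_nonneg hB h3, mul_nonneg hB (sq_nonneg ‖s‖)]
  have hdiffbound : ∀ y ∈ Set.Ioi (0 : ℝ),
      ‖s * (s - 1) * ((y : ℂ) ^ (s - 1 - 1) • p y) - p y * w₂ y‖ ≤
        D * J.indicator (fun y => ‖(y : ℂ) ^ ((δ : ℂ) - 1) • p y‖) y := by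
    intro y hy
    have hy : 0 < y := hy
    have hy' : (y : ℂ) ≠ 0 := by exact_mod_cast hy.ne'
    have e : s * (s - 1) * ((y : ℂ) ^ (s - 1 - 1) • p y) - p y * w₂ y =
        ((y : ℂ) ^ (s - 1 - 1) * p y) * (s * (s - 1) * ((1 - χ y : ℝ) : ℂ) -
          2 * s * ((y * χ₁ y : ℝ) : ℂ) - ((y ^ 2 * χ₂ y : ℝ) : ℂ)) := by
      have a1 : (y : ℂ) ^ (s - 1) = (y : ℂ) ^ (s - 1 - 1) * y := by
        have := Complex.cpow_add (s - 1 - 1) 1 hy'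
        rwa [sub_add_cancel, Complex.cpow_one] at this
      have a2 : (y : ℂ) ^ s = (y : ℂ) ^ (s - 1) * y := by
        have := Complex.cpow_add (s - 1) 1 hy'
        rwa [sub_add_cancel, Complex.cpow_one] at this
      simp only [hw₂, smul_eq_mul]
      rw [a2, a1]
      push_cast
      ring
    rw [e]
    by_cases hyJ : y ∈ J
    · rw [Set.indicator_of_mem hyJ, norm_mul, norm_smul, norm_mul ((y : ℂ) ^ _),
        Complex.norm_cpow_eq_rpow_re_of_pos hy, Complex.norm_cpow_eq_rpow_re_of_pos hy,
        show (s - 1 - 1).re = δ - 1 by simp [hs], show ((δ : ℂ) - 1).re = δ - 1 by simp, mul_comm]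
      refine mul_le_mul_of_nonneg_right (le_trans ?_ hD) (by positivity)
      obtain ⟨b1, b2⟩ := hb y
      have c1 : ‖s * (s - 1) * ((1 - χ y : ℝ) : ℂ)‖ ≤ ‖s * (s - 1)‖ := by
        rw [norm_mul (s * (s - 1)), Complex.norm_real, Real.norm_of_nonneg (by linarith [(h01 y).2])]
        exact mul_le_of_le_one_right (norm_nonneg _) (by linarith [(h01 y).1])
      have c2 : ‖2 * s * ((y * χ₁ y : ℝ) : ℂ)‖ ≤ 2 * ‖s‖ * B := by
        rw [norm_mul, norm_mul, Complex.norm_two, Complex.norm_real, Real.norm_eq_abs]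
        gcongr
      have c3 : ‖((y ^ 2 * χ₂ y : ℝ) : ℂ)‖ ≤ B := by
        rw [Complex.norm_real, Real.norm_eq_abs]
        exact b2
      calc _ ≤ ‖s * (s - 1) * ((1 - χ y : ℝ) : ℂ)‖ + ‖2 * s * ((y * χ₁ y : ℝ) : ℂ)‖ +
            ‖((y ^ 2 * χ₂ y : ℝ) : ℂ)‖ := (norm_sub_le _ _).trans (by gcongr; exact norm_sub_le _ _)
        _ ≤ _ := by linarith
    · have hy1 : 2 * η ≤ y ∧ y ≤ Y := by
        simp only [hJ, Set.mem_ofPred_eq, not_or, not_le] at hyJ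
        exact ⟨hyJ.1.le, hyJ.2.le⟩
      obtain ⟨a, b, c⟩ := hin y hy1.1 hy1.2
      rw [Set.indicator_of_notMem hyJ, a, b, c]
      simp
  have i3 : IntegrableOn (fun y : ℝ => D * J.indicator (fun y => ‖(y : ℂ) ^ ((δ : ℂ) - 1) • p y‖) y)
      (Set.Ioi 0) := by
    refine Integrable.const_mul (Integrable.indicator ?_ hJm) _
    exact (mellinConvergent_constantTerm hf hinv hdec (s := δ) (by simpa using hδ)).norm
  -- The Mellin integral is compared with its cut-off version, and Green's formula converts the
  -- latter into an integral of the Laplacian.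
  have main : s * (s - 1) * mellin p (s - 1) = (∫ y in Set.Ioi (0 : ℝ),
      (s * (s - 1) * ((y : ℂ) ^ (s - 1 - 1) • p y) - p y * w₂ y)) +
      ∫ q in Set.Icc (0 : ℝ) 1 ×ˢ Set.Icc η (2 * Y),
        Laplacian.laplacian (f ∘ ofComplex) (toComplex q) * w q.2 := by
    rw [green, e2, integral_sub (i1.const_mul _) i2, integral_const_mul, mellin]
    ring
  rw [← norm_mul, main]
  refine (norm_add_le _ _).trans ?_
  have f1 := norm_integral_le_of_norm_le i3
    ((ae_restrict_iff' measurableSet_Ioi).mpr (ae_of_all _ hdiffbound))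
  rw [integral_const_mul] at f1
  change _ ≤ D * outsideMass f δ η Y at f1
  have hE : 0 ≤ outsideMass f δ η Y := integral_nonneg fun y =>
    Set.indicator_nonneg (fun _ _ => norm_nonneg _) _
  have t1 : 0 ≤ (1 + 2 * B) * Y ^ (1 + δ) := by positivity
  have t2 : 0 ≤ C * 2 ^ (1 + δ) * ((1 + ‖s‖) ^ 2 * outsideMass f δ η Y) := by positivity
  simp only [D] at f1
  linarith

/-- Decay of the Mellin transform of the constant term on vertical lines to the right of `0`. -/
theorem exists_norm_mellin_constantTerm_le {f : ℍ → ℂ} (hinv : IsModularInvariant f)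
    (hdec : IsRapidDecay f) (hdiff : IsTwiceDifferentiable f)
    (hloc : LocallyIntegrable (hypLaplacian f) volume)
    (hlap : hypLaplacian f =O[atImInfty] fun z : ℍ => z.im ^ (1 / 4 : ℝ)) {δ ε : ℝ} (hδ : 0 < δ)
    (hδ1 : δ ≤ 1) (hε : 0 < ε) :
    ∃ K, 0 ≤ K ∧ ∀ s : ℂ, s.re = δ → ‖mellin (constantTerm f) s‖ ≤ K * (1 + |s.im|) ^ (-2 + ε) := by
  obtain ⟨A, hA, hle⟩ := exists_norm_mul_mellin_le hinv hdec hdiff hloc hlap hδ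
  have hf := hdiff.continuous
  obtain ⟨C₀, hC₀, h₀⟩ := exists_norm_mul_pow_le hf hinv hdec 0
  simp only [pow_zero, mul_one] at h₀
  -- The heights will be `Y = T^e`, so that the Laplacian contributes `Y^(1+δ) = T^ε`, and `η =
  -- T^(-2/δ)/2`, so that `(2η)^δ = T⁻²`.
  set e := ε / (1 + δ) with he
  have he0 : 0 < e := by positivity
  -- This many powers of decay give `Y^(δ-N) ≤ T⁻²`; the mass outside the band then offsets the
  -- factor `(1 + |s|)²` coming from the cut-offs.
  obtain ⟨N, hN⟩ := exists_nat_gt (δ + 2 / e)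
  have hNδ : δ < N := by have : 0 < 2 / e := by positivity
                         linarith
  obtain ⟨C, hC, h⟩ := exists_norm_mul_pow_le hf hinv hdec N
  set M := C₀ / δ + C / (N - δ) with hM
  have hM0 : 0 ≤ M := by
    have : 0 < (N : ℝ) - δ := by linarith
    positivity
  refine ⟨(A + A * 9 * M) / δ ^ 2 * 4, by positivity, fun s hs => ?_⟩
  set T := 1 + |s.im| with hT
  have hT1 : 1 ≤ T := by simp [hT]
  have hT0 : 0 < T := by linarith
  have hη0 : 0 < T ^ (-2 / δ) / 2 := by positivity
  have hηle : 2 * (T ^ (-2 / δ) / 2) ≤ 1 := by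
    rw [mul_div_cancel₀ _ two_ne_zero]
    exact Real.rpow_le_one_of_one_le_of_nonpos hT1 (div_nonpos_of_nonpos_of_nonneg (by norm_num) hδ.le)
  have hY1 : 1 ≤ T ^ e := Real.one_le_rpow hT1 he0.le
  have h1 := hle (s + 1) (by simp [hs, add_comm]) _ _ hη0 (hηle.trans hY1) hY1
  rw [add_sub_cancel_right, ← Real.rpow_mul hT0.le, he, div_mul_cancel₀ _ (by positivity)] at h1
  rw [← he] at h1
  have h2 : outsideMass f δ (T ^ (-2 / δ) / 2) (T ^ e) ≤ M * (T ^ 2)⁻¹ := by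
    refine (outsideMass_le hδ hη0 (by positivity) hNδ h₀ h).trans ?_
    have a1 : (2 * (T ^ (-2 / δ) / 2)) ^ δ = (T ^ 2)⁻¹ := by
      rw [mul_div_cancel₀ _ two_ne_zero, ← Real.rpow_mul hT0.le, div_mul_cancel₀ _ hδ.ne',
        Real.rpow_neg hT0.le, Real.rpow_two]
    have a2 : (T ^ e) ^ (δ - N) ≤ (T ^ 2)⁻¹ := by
      rw [← Real.rpow_mul hT0.le, ← Real.rpow_two, ← Real.rpow_neg hT0.le]
      refine Real.rpow_le_rpow_of_exponent_le hT1 ?_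
      have : e * (2 / e) = 2 := by field_simp
      nlinarith
    have hNδ' : 0 < (N : ℝ) - δ := by linarith
    rw [a1]
    calc _ ≤ C₀ * (T ^ 2)⁻¹ / δ + C * (T ^ 2)⁻¹ / (N - δ) := by gcongr
      _ = _ := by rw [hM]; ring
  have hs0 : δ * T ≤ 2 * ‖s‖ := by
    have b1 := Complex.abs_re_le_norm s
    have b2 := Complex.abs_im_le_norm s
    rw [hs, abs_of_pos hδ] at b1
    have b3 := abs_nonneg s.im
    rw [hT]
    nlinarith
  have hs1 : ‖s‖ ≤ ‖s + 1‖ := by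
    rw [Complex.norm_def, Complex.norm_def]
    apply Real.sqrt_le_sqrt
    rw [Complex.normSq_apply, Complex.normSq_apply]
    simp only [Complex.add_re, Complex.add_im, Complex.one_re, Complex.one_im, hs]
    nlinarith
  have hs2 : 1 + ‖s + 1‖ ≤ 3 * T := by
    have b1 := Complex.norm_le_abs_re_add_abs_im (s + 1)
    simp only [Complex.add_re, Complex.add_im, Complex.one_re, Complex.one_im, hs, add_zero] at b1
    rw [abs_of_pos (by linarith)] at b1
    rw [hT]
    linarith [abs_nonneg s.im]
  set m := ‖mellin (constantTerm f) s‖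
  have hm : 0 ≤ m := norm_nonneg _
  have h3 : (δ * T / 2) ^ 2 * m ≤ ‖(s + 1) * s‖ * m := by
    refine mul_le_mul_of_nonneg_right ?_ hm
    rw [norm_mul]
    have : 0 ≤ δ * T := by positivity
    nlinarith [norm_nonneg s]
  have hE : 0 ≤ outsideMass f δ (T ^ (-2 / δ) / 2) (T ^ e) := integral_nonneg fun y =>
    Set.indicator_nonneg (fun _ _ => norm_nonneg _) _
  have h4 : A * (1 + ‖s + 1‖) ^ 2 * outsideMass f δ (T ^ (-2 / δ) / 2) (T ^ e) ≤ A * 9 * M := by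
    calc _ ≤ A * (3 * T) ^ 2 * (M * (T ^ 2)⁻¹) := by gcongr
      _ = _ := by field_simp; ring
  have hTε : 1 ≤ T ^ ε := Real.one_le_rpow hT1 hε.le
  have h5 : (δ * T / 2) ^ 2 * m ≤ (A + A * 9 * M) * T ^ ε := by
    have : 0 ≤ A * 9 * M := by positivity
    nlinarith
  rw [Real.rpow_add hT0, Real.rpow_neg hT0.le, Real.rpow_two]
  have : m = (δ * T / 2) ^ 2 * m * (4 / δ ^ 2 * (T ^ 2)⁻¹) := by field_simp; ring
  rw [this]
  calc _ ≤ (A + A * 9 * M) * T ^ ε * (4 / δ ^ 2 * (T ^ 2)⁻¹) := by gcongr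
    _ = _ := by ring

/-! ### Bounds for the Rankin–Selberg transform in the critical strip -/

lemma norm_le_two_mul {s : ℂ} (h1 : -1 ≤ s.re) (h2 : s.re ≤ 2) : ‖s‖ ≤ 2 * (1 + |s.im|) := by
  have := Complex.norm_le_abs_re_add_abs_im s
  have h3 : |s.re| ≤ 2 := abs_le.mpr ⟨by linarith, h2⟩
  linarith [abs_nonneg s.im]

/-- The value of the normalised transform to the right of the critical strip. -/
lemma completed_mul_pi_cpow_div_Gamma {N R : ℂ → ℂ}
    (hNR : ∀ s : ℂ, 1 < s.re → (2 * s - 1) * N s = (s - 1) * xiFun (2 * s) * R s) {s : ℂ}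
    (hs : 1 < s.re) :
    N s * (Real.pi : ℂ) ^ s * (Complex.Gamma s)⁻¹ = 2 * s * (s - 1) * riemannZeta (2 * s) * R s := by
  have hs0 : s ≠ 0 := by rintro rfl; simp at hs; linarith
  have h2s0 : 2 * s ≠ 0 := mul_ne_zero two_ne_zero hs0
  have h2s1 : 2 * s - 1 ≠ 0 := by
    intro h
    have := congrArg Complex.re h
    simp at this
    linarith
  have hΓ : Complex.Gamma s ≠ 0 := Complex.Gamma_ne_zero_of_re_pos (by linarith)
  have hpi : (Real.pi : ℂ) ≠ 0 := by exact_mod_cast Real.pi_ne_zero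
  have h := hNR s hs
  have hz := riemannZeta_def_of_ne_zero h2s0
  have hG : Complex.Gammaℝ (2 * s) = (Real.pi : ℂ) ^ (-s) * Complex.Gamma s := by
    rw [Complex.Gammaℝ_def]
    congr 2 <;> ring_nf
  have hG0 : (Real.pi : ℂ) ^ (-s) * Complex.Gamma s ≠ 0 :=
    mul_ne_zero (by simp [Complex.cpow_eq_zero_iff, hpi]) hΓ
  rw [hG, eq_div_iff hG0] at hz
  rw [xiFun_eq h2s0 (sub_ne_zero.mp h2s1), ← hz] at h
  have hN : N s = 2 * s * (s - 1) * riemannZeta (2 * s) * R s *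
      ((Real.pi : ℂ) ^ (-s) * Complex.Gamma s) := by
    refine mul_left_cancel₀ h2s1 (h.trans ?_)
    ring
  have hpp : (Real.pi : ℂ) ^ (-s) * (Real.pi : ℂ) ^ s = 1 := by
    rw [← Complex.cpow_add _ _ hpi]; simp
  rw [hN]
  calc _ = 2 * s * (s - 1) * riemannZeta (2 * s) * R s *
        (((Real.pi : ℂ) ^ (-s) * (Real.pi : ℂ) ^ s) * (Complex.Gamma s * (Complex.Gamma s)⁻¹)) := by ring
    _ = _ := by rw [hpp, mul_inv_cancel₀ hΓ]; ring

/-- Here the normalised transform is `2s(s-1) ζ(2s) R(s)`: the quadratic factor meets the decay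
`T^(-2+1/16)`, and `ζ(2s)` is bounded. -/
lemma exists_norm_transform_le_right {N R : ℂ → ℂ}
    (hNR : ∀ s : ℂ, 1 < s.re → (2 * s - 1) * N s = (s - 1) * xiFun (2 * s) * R s) {K : ℝ}
    (hR : ∀ s : ℂ, s.re = 17 / 16 → ‖R s‖ ≤ K * (1 + |s.im|) ^ (-2 + 1 / 16 : ℝ)) :
    ∃ C, 0 ≤ C ∧ ∀ s : ℂ, s.re = 17 / 16 →
      ‖N s * (Real.pi : ℂ) ^ s * (Complex.Gamma s)⁻¹‖ ≤ C * (1 + |s.im|) ^ (1 / 16 : ℝ) := by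
  set Z := ∑' n : ℕ, 1 / ((n : ℝ) + 1) ^ (3 / 2 : ℝ)
  have hZ : 0 ≤ Z := tsum_nonneg fun n => by positivity
  have hK : 0 ≤ K := by
    have := (norm_nonneg _).trans (hR (17 / 16 : ℝ) (Complex.ofReal_re _))
    simpa using this
  refine ⟨8 * Z * K, by positivity, fun s hs => ?_⟩
  set T := 1 + |s.im| with hT
  have hT0 : 0 < T := by positivity
  rw [completed_mul_pi_cpow_div_Gamma hNR (by rw [hs]; norm_num), norm_mul, norm_mul, norm_mul,
    norm_mul, Complex.norm_two]
  have h1 : ‖s‖ ≤ 2 * T := norm_le_two_mul (by rw [hs]; norm_num) (by rw [hs]; norm_num)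
  have h2 : ‖s - 1‖ ≤ 2 * T := by
    have := norm_le_two_mul (s := s - 1) (by simp [hs]; norm_num) (by simp [hs]; norm_num)
    simpa using this
  have h3 : ‖riemannZeta (2 * s)‖ ≤ Z := norm_zeta_le_of_three_halves_le (by simp [hs]; norm_num)
  calc 2 * ‖s‖ * ‖s - 1‖ * ‖riemannZeta (2 * s)‖ * ‖R s‖
      ≤ 2 * (2 * T) * (2 * T) * Z * (K * T ^ (-2 + 1 / 16 : ℝ)) := by
        gcongr
        exact hR s hs
    _ = _ := by
      rw [Real.rpow_add hT0, Real.rpow_neg hT0.le, Real.rpow_two]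
      field_simp
      ring

/-- Reflection to `Re s = 17/16` costs the quotient `Γ(1-s)/Γ(s)`, of size `T^(9/8)` on this line;
together with `T^(1/16)` this gives `19/16`. -/
lemma exists_norm_transform_le_left {N : ℂ → ℂ} (hsymm : ∀ s, N (1 - s) = N s) {C₁ : ℝ}
    (hC₁ : ∀ s : ℂ, s.re = 17 / 16 →
      ‖N s * (Real.pi : ℂ) ^ s * (Complex.Gamma s)⁻¹‖ ≤ C₁ * (1 + |s.im|) ^ (1 / 16 : ℝ)) :
    ∃ C, ∀ s : ℂ, s.re = -(1 / 16) →
      ‖N s * (Real.pi : ℂ) ^ s * (Complex.Gamma s)⁻¹‖ ≤ C * (1 + |s.im|) ^ (19 / 16 : ℝ) := by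
  obtain ⟨C₂, hC₂, h₂⟩ := exists_norm_Gamma_one_sub_le
  have hC₁0 : 0 ≤ C₁ := by
    have := (norm_nonneg _).trans (hC₁ (17 / 16 : ℝ) (Complex.ofReal_re _))
    simpa using this
  refine ⟨C₁ * C₂, fun s hs => ?_⟩
  have hre : (1 - s).re = 17 / 16 := by simp [hs]; norm_num
  have him : |(1 - s).im| = |s.im| := by simp
  have hΓ : Complex.Gamma (1 - s) ≠ 0 := Complex.Gamma_ne_zero_of_re_pos (by rw [hre]; norm_num)
  have hpi : (Real.pi : ℂ) ≠ 0 := by exact_mod_cast Real.pi_ne_zero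
  have e : N s * (Real.pi : ℂ) ^ s * (Complex.Gamma s)⁻¹ =
      (N (1 - s) * (Real.pi : ℂ) ^ (1 - s) * (Complex.Gamma (1 - s))⁻¹) *
        (Complex.Gamma (1 - s) * (Complex.Gamma s)⁻¹) * (Real.pi : ℂ) ^ (2 * s - 1) := by
    have : (Real.pi : ℂ) ^ s = (Real.pi : ℂ) ^ (1 - s) * (Real.pi : ℂ) ^ (2 * s - 1) := by
      rw [← Complex.cpow_add _ _ hpi]; ring_nf
    rw [hsymm, this]
    field_simp
  have h3 : ‖(Real.pi : ℂ) ^ (2 * s - 1)‖ ≤ 1 := by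
    rw [Complex.norm_cpow_eq_rpow_re_of_pos Real.pi_pos]
    refine Real.rpow_le_one_of_one_le_of_nonpos (by linarith [Real.pi_gt_three]) ?_
    simp [hs]
    norm_num
  have h4 := hC₁ _ hre
  have h5 := h₂ s (by rw [hs]; norm_num) (by rw [hs]; norm_num)
  rw [him] at h4
  rw [hs] at h5
  have hT0 : 0 < 1 + |s.im| := by positivity
  rw [e, norm_mul, norm_mul]
  calc _ ≤ C₁ * (1 + |s.im|) ^ (1 / 16 : ℝ) * (C₂ * (1 + |s.im|) ^ (1 - 2 * -(1 / 16) : ℝ)) * 1 := by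
        gcongr
    _ = C₁ * C₂ * ((1 + |s.im|) ^ (1 / 16 : ℝ) * (1 + |s.im|) ^ (1 - 2 * -(1 / 16) : ℝ)) := by ring
    _ = _ := by
      rw [← Real.rpow_add hT0]
      norm_num

/-- Convexity bound for the normalised transform. -/
lemma exists_norm_transform_le {N R : ℂ → ℂ} (hN : Differentiable ℂ N)
    (hsymm : ∀ s, N (1 - s) = N s) {B : ℝ}
    (hB : ∀ s : ℂ, -1 ≤ s.re → s.re ≤ 2 → ‖N s‖ ≤ B * (1 + |s.im|) ^ 2)
    (hNR : ∀ s : ℂ, 1 < s.re → (2 * s - 1) * N s = (s - 1) * xiFun (2 * s) * R s) {K : ℝ}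
    (hR : ∀ s : ℂ, s.re = 17 / 16 → ‖R s‖ ≤ K * (1 + |s.im|) ^ (-2 + 1 / 16 : ℝ)) :
    ∃ C, ∀ s : ℂ, -(1 / 16) ≤ s.re → s.re ≤ 17 / 16 →
      ‖N s * (Real.pi : ℂ) ^ s * (Complex.Gamma s)⁻¹‖ ≤ C * (1 + |s.im|) ^ (9 / 8 - s.re) := by
  obtain ⟨C₁, -, hC₁⟩ := exists_norm_transform_le_right hNR hR
  obtain ⟨C₂, hC₂⟩ := exists_norm_transform_le_left hsymm hC₁
  obtain ⟨A, hA, hA'⟩ := exists_norm_inv_Gamma_le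
  have hpi : (Real.pi : ℂ) ≠ 0 := by exact_mod_cast Real.pi_ne_zero
  have hB0 : 0 ≤ B := by
    have := (norm_nonneg _).trans (hB 0 (by simp) (by simp))
    simpa using this
  have hd : Differentiable ℂ fun s => N s * (Real.pi : ℂ) ^ s * (Complex.Gamma s)⁻¹ :=
    (hN.mul (fun s => (differentiableAt_id.const_cpow (Or.inl hpi)))).mul
      Complex.differentiable_one_div_Gamma
  have hgrowth : ∀ z : ℂ, -(1 / 16) ≤ z.re → z.re ≤ 17 / 16 →
      ‖N z * (Real.pi : ℂ) ^ z * (Complex.Gamma z)⁻¹‖ ≤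
        (B * Real.pi ^ 2 * A) * Real.exp ((2 + Real.pi) * |z.im|) := by
    intro z h1 h2
    have b1 := hB z (by linarith) (by linarith)
    have b2 : ‖(Real.pi : ℂ) ^ z‖ ≤ Real.pi ^ 2 := by
      rw [Complex.norm_cpow_eq_rpow_re_of_pos Real.pi_pos, ← Real.rpow_two]
      exact Real.rpow_le_rpow_of_exponent_le (by linarith [Real.pi_gt_three]) (by linarith)
    have b3 := hA' z (by linarith) (by linarith)
    have b4 : (1 + |z.im|) ^ 2 ≤ Real.exp (2 * |z.im|) := by
      rw [two_mul, Real.exp_add, ← sq]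
      exact pow_le_pow_left₀ (by positivity) (by linarith [Real.add_one_le_exp |z.im|]) 2
    rw [norm_mul, norm_mul]
    calc _ ≤ (B * Real.exp (2 * |z.im|)) * Real.pi ^ 2 * (A * Real.exp (Real.pi * |z.im|)) := by
          gcongr
          exact b1.trans (by gcongr)
      _ = _ := by rw [add_mul, Real.exp_add]; ring
  -- The exponent falls from `19/16` to `1/16` across a strip of width `9/8`, that is, with slope
  -- `-1`; hence `9/8 - Re s`.
  obtain ⟨C, hC⟩ := exists_norm_le_of_vertical_strip (by norm_num : (-(1 / 16) : ℝ) < 17 / 16)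
    (by norm_num : (0 : ℝ) ≤ 19 / 16) (by norm_num : (0 : ℝ) ≤ 1 / 16) hd.diffContOnCl hgrowth hC₂ hC₁
  refine ⟨C, fun s h1 h2 => (hC s h1 h2).trans (le_of_eq ?_)⟩
  congr 2
  ring

/-! ### Shifting the contour -/

/-- The origin of the constant `3/π`: the value at `s = 1` of the factor `xiFun (2s)` by which the
transform is divided. -/
lemma xiFun_two : xiFun 2 = Real.pi / 3 := by
  have h := riemannZeta_def_of_ne_zero (s := 2) two_ne_zero
  have hG : Complex.Gammaℝ 2 = (Real.pi : ℂ)⁻¹ := by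
    rw [Complex.Gammaℝ_def]
    norm_num [Complex.cpow_neg_one]
  have hpi : (Real.pi : ℂ) ≠ 0 := by exact_mod_cast Real.pi_ne_zero
  rw [riemannZeta_two, hG, div_inv_eq_mul] at h
  rw [xiFun_eq two_ne_zero (by norm_num)]
  have : completedRiemannZeta 2 = Real.pi / 6 := by
    refine mul_right_cancel₀ hpi (h.symm.trans ?_)
    ring
  rw [this]
  ring

/-- Used to subtract the pole at `s = 1`. Compared with the indicator of `(0, 1]`, this function is
continuous, as pointwise Mellin inversion requires, and its transform decays quadratically; the
price is an error linear in `y`. -/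
lemma hasMellin_max_one_sub {s : ℂ} (hs : 0 < s.re) :
    HasMellin (fun y : ℝ => ((max (1 - y) 0 : ℝ) : ℂ)) s (1 / (s * (s + 1))) := by
  have h1 := hasMellin_one_Ioc hs
  have h2 := hasMellin_cpow_Ioc 1 (s := s) (by simp; linarith)
  have h := hasMellin_sub h1.1 h2.1
  rw [h1.2, h2.2] at h
  have e : (fun t : ℝ => (Set.Ioc 0 1).indicator (fun _ => (1 : ℂ)) t -
      (Set.Ioc 0 1).indicator (fun t : ℝ => (t : ℂ) ^ (1 : ℂ)) t) =
      (Set.Ioi (0 : ℝ)).indicator fun y : ℝ => ((max (1 - y) 0 : ℝ) : ℂ) := by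
    funext t
    by_cases h0 : 0 < t
    · by_cases h1 : t ≤ 1
      · have hm : t ∈ Set.Ioc (0 : ℝ) 1 := ⟨h0, h1⟩
        rw [Set.indicator_of_mem hm, Set.indicator_of_mem hm, Set.indicator_of_mem (by exact h0),
          max_eq_left (by linarith)]
        simp
      · rw [Set.indicator_of_notMem (fun h => h1 h.2), Set.indicator_of_notMem (fun h => h1 h.2),
          Set.indicator_of_mem (by exact h0), max_eq_right (by linarith)]
        simp
    · rw [Set.indicator_of_notMem (fun h => h0 h.1), Set.indicator_of_notMem (fun h => h0 h.1),
          Set.indicator_of_notMem (by exact h0)]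
      simp
  have hs0 : s ≠ 0 := by rintro rfl; simp at hs
  have hs1 : s + 1 ≠ 0 := by
    intro h
    have := congrArg Complex.re h
    simp at this
    linarith
  rw [e] at h
  have key : ∀ t ∈ Set.Ioi (0 : ℝ), (t : ℂ) ^ (s - 1) •
      (Set.Ioi (0 : ℝ)).indicator (fun y : ℝ => ((max (1 - y) 0 : ℝ) : ℂ)) t =
      (t : ℂ) ^ (s - 1) • ((max (1 - t) 0 : ℝ) : ℂ) := fun t ht => by
    rw [Set.indicator_of_mem ht]
  refine ⟨(integrableOn_congr_fun key measurableSet_Ioi).mp h.1, ?_⟩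
  have h3 := h.2
  rw [mellin, setIntegral_congr_fun measurableSet_Ioi key] at h3
  rw [mellin, h3]
  field_simp
  ring

/-- Decay of the transform divided by the completed zeta function, away from the zeros. -/
lemma exists_norm_quotient_le {N : ℂ → ℂ} {C : ℝ}
    (hG : ∀ s : ℂ, -(1 / 16) ≤ s.re → s.re ≤ 17 / 16 →
      ‖N s * (Real.pi : ℂ) ^ s * (Complex.Gamma s)⁻¹‖ ≤ C * (1 + |s.im|) ^ (9 / 8 - s.re))
    {σ₀ : ℝ} (hσ₀ : supRealPart / 2 < σ₀) :
    ∃ K, 0 ≤ K ∧ ∀ s : ℂ, σ₀ ≤ s.re → s.re ≤ 17 / 16 → 3 ≤ |s.im| →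
      ‖N s * (2 * s - 1) / xiFun (2 * s)‖ ≤ K * (1 + |s.im|) ^ (-(1 / 16) : ℝ) := by
  have hΘ := half_le_supRealPart
  obtain ⟨C₁, hC₁, hz⟩ := exists_norm_zeta_le_of_zero_free (Θ₀ := supRealPart) (by linarith)
    supRealPart_le_one (fun s h1 h2 => zeta_ne_zero_of_supRealPart_lt h1 (by
      rintro rfl
      simp at h2
      linarith)) (δ := 2 * σ₀ - supRealPart) (ε := 1 / 16) (by linarith) (by norm_num)
  have hC : 0 ≤ C := by
    have := (norm_nonneg _).trans (hG 0 (by norm_num) (by norm_num))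
    simpa using this
  refine ⟨C * (2 * C₁), by positivity, fun s h1 h2 h3 => ?_⟩
  have hs0 : s ≠ 0 := by
    rintro rfl
    simp at h3
    linarith
  have h2s0 : 2 * s ≠ 0 := mul_ne_zero two_ne_zero hs0
  have him : |(2 * s).im| = 2 * |s.im| := by simp [abs_mul]
  have hre : (2 * s).re = 2 * s.re := by simp
  have h2s1 : 2 * s ≠ 1 := by
    intro h
    rw [h] at him
    simp at him
    rw [him, abs_zero] at h3
    linarith
  have hΓ : Complex.Gamma s ≠ 0 := Complex.Gamma_ne_zero_of_re_pos (by linarith)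
  have hpi : (Real.pi : ℂ) ≠ 0 := by exact_mod_cast Real.pi_ne_zero
  have hz' := riemannZeta_def_of_ne_zero h2s0
  have hGr : Complex.Gammaℝ (2 * s) = (Real.pi : ℂ) ^ (-s) * Complex.Gamma s := by
    rw [Complex.Gammaℝ_def]
    congr 2 <;> ring_nf
  have hps : (Real.pi : ℂ) ^ s ≠ 0 := by simp [Complex.cpow_eq_zero_iff, hpi]
  rw [Complex.cpow_neg] at hGr
  have hG0 : ((Real.pi : ℂ) ^ s)⁻¹ * Complex.Gamma s ≠ 0 := mul_ne_zero (inv_ne_zero hps) hΓ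
  rw [hGr, eq_div_iff hG0] at hz'
  have hζ := (hz (2 * s) (by rw [hre]; linarith) (by rw [hre]; linarith) (by rw [him]; linarith)).2
  have hζ0 : riemannZeta (2 * s) ≠ 0 := zeta_ne_zero_of_supRealPart_lt (by rw [hre]; linarith) h2s1
  have h2s1' : 2 * s - 1 ≠ 0 := sub_ne_zero.mpr h2s1
  -- Cancelling the archimedean factors leaves only `1/ζ(2s)`, to which Littlewood's bound applies,
  -- and a factor `1/(2s)`.
  have e : N s * (2 * s - 1) / xiFun (2 * s) =
      (N s * (Real.pi : ℂ) ^ s * (Complex.Gamma s)⁻¹) * (2 * s)⁻¹ * (riemannZeta (2 * s))⁻¹ := by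
    rw [xiFun_eq h2s0 h2s1, ← hz']
    field_simp
  set T := 1 + |s.im| with hT
  have hT0 : 0 < T := by positivity
  have hT1 : 1 ≤ T := by linarith [abs_nonneg s.im]
  have h4 : ‖(2 * s)⁻¹‖ ≤ T⁻¹ := by
    rw [norm_inv]
    refine inv_anti₀ hT0 ?_
    have := Complex.abs_im_le_norm (2 * s)
    rw [him] at this
    linarith
  have h5 : (1 + 2 * |s.im|) ^ (1 / 16 : ℝ) ≤ 2 * T ^ (1 / 16 : ℝ) := by
    calc (1 + 2 * |s.im|) ^ (1 / 16 : ℝ) ≤ (2 * T) ^ (1 / 16 : ℝ) := by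
          refine Real.rpow_le_rpow (by positivity) (by linarith) (by norm_num)
      _ = 2 ^ (1 / 16 : ℝ) * T ^ (1 / 16 : ℝ) := Real.mul_rpow (by norm_num) hT0.le
      _ ≤ 2 ^ (1 : ℝ) * T ^ (1 / 16 : ℝ) := by
          gcongr <;> norm_num
      _ = _ := by rw [Real.rpow_one]
  rw [him] at hζ
  rw [e, norm_mul, norm_mul]
  calc _ ≤ C * T ^ (9 / 8 - s.re) * T⁻¹ * (C₁ * (2 * T ^ (1 / 16 : ℝ))) := by
        gcongr
        · exact hG s (by linarith) h2
        · exact hζ.trans (by gcongr)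
    _ = C * (2 * C₁) * (T ^ (9 / 8 - s.re) * T ^ (-1 : ℝ) * T ^ (1 / 16 : ℝ)) := by
        rw [Real.rpow_neg_one]; ring
    -- The exponents add up to `3/16 - Re s`, and `Re s ≥ σ₀ > Θ/2 ≥ 1/4`. This is where the
    -- existence of a nontrivial zero is used.
    _ ≤ C * (2 * C₁) * T ^ (-(1 / 16) : ℝ) := by
        rw [← Real.rpow_add hT0, ← Real.rpow_add hT0]
        gcongr
        linarith

/-- From the analytic properties of the Rankin–Selberg transform to the behaviour of the original
function near zero. -/
theorem exists_norm_sub_le_rpow {p : ℝ → ℂ} {N : ℂ → ℂ} (hp : ContinuousOn p (Set.Ioi 0))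
    (hmell : ∀ s : ℂ, 0 < s.re → MellinConvergent p s) (hN : Differentiable ℂ N)
    (hNR : ∀ s : ℂ, 1 < s.re → (2 * s - 1) * N s = (s - 1) * xiFun (2 * s) * mellin p (s - 1))
    {C : ℝ} (hG : ∀ s : ℂ, -(1 / 16) ≤ s.re → s.re ≤ 17 / 16 →
      ‖N s * (Real.pi : ℂ) ^ s * (Complex.Gamma s)⁻¹‖ ≤ C * (1 + |s.im|) ^ (9 / 8 - s.re))
    {σ₀ : ℝ} (hσ₀ : supRealPart / 2 < σ₀) (hσ₁ : σ₀ < 1) :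
    ∃ K, ∀ y : ℝ, 0 < y → y < 1 → ‖p y - ((3 / Real.pi : ℝ) : ℂ) * N 1‖ ≤ K * y ^ (1 - σ₀) := by
  have hΘ := half_le_supRealPart
  obtain ⟨K, hK, hKle⟩ := exists_norm_quotient_le hG hσ₀
  set c : ℂ := ((3 / Real.pi : ℝ) : ℂ) * N 1 with hc
  -- To the right of `1` the transform is `Q(s)/(s - 1)`, so `Q` continues it to `Re s > Θ/2` and
  -- `Q(1)` is its residue.
  set Q : ℂ → ℂ := fun s => N s * (2 * s - 1) / xiFun (2 * s) with hQ
  have hQ1 : Q 1 = c := by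
    have hpi : (Real.pi : ℂ) ≠ 0 := by exact_mod_cast Real.pi_ne_zero
    simp only [hQ, mul_one, xiFun_two, hc]
    push_cast
    field_simp
    ring
  set U : Set ℂ := {s | supRealPart / 2 < s.re} with hU
  have hUo : IsOpen U := isOpen_lt continuous_const Complex.continuous_re
  have h1U : (1 : ℂ) ∈ U := by
    have := supRealPart_le_one
    simp only [hU, Set.mem_ofPred_eq, Complex.one_re]
    linarith
  have hUξ : ∀ s ∈ U, xiFun (2 * s) ≠ 0 := fun s hs => by
    have : supRealPart / 2 < s.re := hs
    exact xiFun_ne_zero (by simp; linarith)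
  have hU0 : ∀ s ∈ U, s ≠ 0 := by
    rintro s hs rfl
    have : supRealPart / 2 < (0 : ℂ).re := hs
    simp at this
    linarith
  have hQd : DifferentiableOn ℂ Q U := by
    refine DifferentiableOn.div ?_ ?_ hUξ
    · exact (hN.mul (by fun_prop)).differentiableOn
    · exact (differentiable_xiFun.comp (by fun_prop : Differentiable ℂ fun s : ℂ => 2 * s)).differentiableOn
  -- This is `(s Q(s) - Q(1)) / (s(s - 1))`, the continued transform minus that of `c max(1 - y,
  -- 0)`; the divided difference fills in the removable singularity at `s = 1`.
  set H : ℂ → ℂ := fun s => dslope (fun s => s * Q s) 1 s / s with hH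
  have hHd : DifferentiableOn ℂ H U := by
    refine DifferentiableOn.div ?_ differentiableOn_id hU0
    exact (Complex.differentiableOn_dslope (hUo.mem_nhds h1U)).mpr (differentiableOn_id.mul hQd)
  have hHeq : ∀ s, s ≠ 0 → s ≠ 1 → H s = Q s / (s - 1) - c / (s * (s - 1)) := by
    intro s h0 h1
    have : s - 1 ≠ 0 := sub_ne_zero.mpr h1
    simp only [hH]
    rw [dslope_of_ne _ h1, slope_def_field, one_mul, hQ1]
    field_simp
  have hHbound : ∃ C', ∀ s : ℂ, σ₀ ≤ s.re → s.re ≤ 17 / 16 →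
      ‖H s‖ ≤ C' * (1 + |s.im|) ^ (-1 - 1 / 16 : ℝ) := by
    set S : Set ℂ := Set.Icc σ₀ (17 / 16) ×ℂ Set.Icc (-3) 3 with hS
    have hSc : IsCompact S := isCompact_Icc.reProdIm isCompact_Icc
    have hSU : S ⊆ U := fun s hs => lt_of_lt_of_le hσ₀ hs.1.1
    obtain ⟨D, hD⟩ := hSc.exists_bound_of_continuousOn (hHd.continuousOn.mono hSU)
    refine ⟨max D 0 * 4 ^ (1 + 1 / 16 : ℝ) + (K + ‖c‖) * 2, fun s h1 h2 => ?_⟩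
    set T := 1 + |s.im| with hT
    have hT0 : 0 < T := by positivity
    have hT1 : 1 ≤ T := by linarith [abs_nonneg s.im]
    have t1 : 0 ≤ max D 0 * 4 ^ (1 + 1 / 16 : ℝ) * T ^ (-1 - 1 / 16 : ℝ) := by positivity
    have t2 : 0 ≤ (K + ‖c‖) * 2 * T ^ (-1 - 1 / 16 : ℝ) := by positivity
    rw [add_mul]
    rcases le_total |s.im| 3 with h3 | h3
    · have b1 : ‖H s‖ ≤ max D 0 := (hD s ⟨⟨h1, h2⟩, abs_le.mp h3⟩).trans (le_max_left _ _)
      have b2 : 1 ≤ 4 ^ (1 + 1 / 16 : ℝ) * T ^ (-1 - 1 / 16 : ℝ) := by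
        rw [show (-1 - 1 / 16 : ℝ) = -(1 + 1 / 16) by ring, Real.rpow_neg hT0.le, ← div_eq_mul_inv,
          one_le_div (by positivity)]
        exact Real.rpow_le_rpow hT0.le (by linarith) (by norm_num)
      have b3 := mul_le_mul_of_nonneg_left b2 (le_max_right D 0)
      linarith
    · have hs0 : s ≠ 0 := by
        rintro rfl
        simp at h3
        linarith
      have hs1 : s ≠ 1 := by
        rintro rfl
        simp at h3
        linarith
      have b1 := hKle s h1 h2 h3
      have b2 : ‖(s - 1)⁻¹‖ ≤ 2 * T⁻¹ := by
        rw [norm_inv, ← inv_inv (2 : ℝ), ← mul_inv]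
        refine inv_anti₀ (by positivity) ?_
        have := Complex.abs_im_le_norm (s - 1)
        simp only [Complex.sub_im, Complex.one_im, sub_zero] at this
        linarith
      have b3 : ‖s⁻¹‖ ≤ T ^ (-(1 / 16) : ℝ) := by
        rw [norm_inv, Real.rpow_neg hT0.le]
        refine inv_anti₀ (by positivity) (le_trans ?_ (Complex.abs_im_le_norm s))
        calc T ^ (1 / 16 : ℝ) ≤ T ^ (1 / 2 : ℝ) :=
              Real.rpow_le_rpow_of_exponent_le hT1 (by norm_num)
          _ = √T := (Real.sqrt_eq_rpow T).symm
          _ ≤ |s.im| := Real.sqrt_le_iff.mpr ⟨abs_nonneg _, by nlinarith⟩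
      have e : H s = (Q s - c * s⁻¹) * (s - 1)⁻¹ := by
        rw [hHeq s hs0 hs1]
        have : s - 1 ≠ 0 := sub_ne_zero.mpr hs1
        field_simp
      have b4 : ‖H s‖ ≤ (K + ‖c‖) * 2 * T ^ (-1 - 1 / 16 : ℝ) := by
        rw [e, norm_mul]
        calc _ ≤ (K * T ^ (-(1 / 16) : ℝ) + ‖c‖ * T ^ (-(1 / 16) : ℝ)) * (2 * T⁻¹) := by
              gcongr
              refine (norm_sub_le _ _).trans ?_
              rw [norm_mul]
              gcongr
          _ = _ := by
              rw [show (-1 - 1 / 16 : ℝ) = -1 + -(1 / 16) by ring, Real.rpow_add hT0,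
                Real.rpow_neg_one]
              ring
      linarith
  obtain ⟨C', hC'⟩ := hHbound
  set α : ℝ → ℂ := fun y => p y - c * ((max (1 - y) 0 : ℝ) : ℂ) with hα
  have hmax : ∀ s : ℂ, 0 < s.re →
      HasMellin (fun y : ℝ => c * ((max (1 - y) 0 : ℝ) : ℂ)) s (c * (1 / (s * (s + 1)))) :=
    fun s hs => by
      have := hasMellin_max_one_sub hs
      exact ⟨by simpa using this.1.const_smul c, by
        rw [← this.2, ← smul_eq_mul, ← mellin_const_smul]; rfl⟩
  have hαM : ∀ s : ℂ, 0 < s.re → HasMellin α s (mellin p s - c * (1 / (s * (s + 1)))) := fun s hs => by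
    have := hasMellin_sub (hmell s hs) (hmax s hs).1
    rwa [(hmax s hs).2] at this
  -- The Mellin variable is `u = s - 1`: the contour moves from `Re u = 1/16` to `Re u = σ₀ - 1`,
  -- which produces `y^(1-σ₀)`.
  obtain ⟨K', hK'⟩ := exists_norm_le_of_mellin_continuation (α := α) (H := fun u => H (u + 1))
    (σ₀ := σ₀ - 1) (σ₁ := 1 / 16) (C := C') (η := 1 / 16) (by linarith) (by norm_num)
    (hp.sub (continuousOn_const.mul (by fun_prop)))
    (hαM _ (by simp)).1
    (by
      refine hHd.comp (by fun_prop) fun u hu => ?_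
      have h1 : σ₀ - 1 ≤ u.re := hu.1
      change supRealPart / 2 < (u + 1).re
      simp
      linarith)
    (fun s hs => by
      have hs0 : 0 < s.re := by rw [hs]; norm_num
      rw [(hαM s hs0).2]
      have h := hNR (s + 1) (by simp [hs])
      have hmem : s + 1 ∈ U := by
        have := supRealPart_le_one
        change supRealPart / 2 < (s + 1).re
        simp [hs]
        linarith
      have hne1 : s + 1 ≠ 1 := by
        intro h
        have := congrArg Complex.re h
        simp [hs] at this
      have hs' : s ≠ 0 := fun h => hne1 (by simp [h])
      rw [hHeq _ (hU0 _ hmem) hne1]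
      have hξ := hUξ _ hmem
      have hs1 := hU0 _ hmem
      simp only [hQ, add_sub_cancel_right] at h ⊢
      have e : N (s + 1) * (2 * (s + 1) - 1) / xiFun (2 * (s + 1)) / s = mellin p s := by
        rw [div_div, div_eq_iff (mul_ne_zero hξ hs')]
        linear_combination h
      rw [e, mul_one_div, mul_comm s])
    (fun s h1 h2 => by
      have := hC' (s + 1) (by simp; linarith) (by simp; linarith)
      simpa using this)
  refine ⟨K' + ‖c‖, fun y hy hy1 => ?_⟩
  have e : p y - c = α y - c * y := by
    simp only [hα]
    rw [max_eq_left (by linarith)]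
    push_cast
    ring
  have h1 := hK' y hy
  have h2 : y ≤ y ^ (1 - σ₀) := by
    calc y = y ^ (1 : ℝ) := (Real.rpow_one y).symm
      _ ≤ _ := Real.rpow_le_rpow_of_exponent_ge hy hy1.le (by linarith)
  rw [neg_sub] at h1
  rw [e, add_mul]
  refine (norm_sub_le _ _).trans (add_le_add h1 ?_)
  rw [norm_mul, Complex.norm_real, Real.norm_of_nonneg hy.le]
  gcongr

/-! ### The asymptotics of the constant term -/

section Transform

variable {f : ℍ → ℂ} (hf : Continuous f) (hinv : IsModularInvariant f) (hdec : IsRapidDecay f)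

/-- The completed Rankin–Selberg transform, with its poles at `0` and `1` removed. -/
def rankinSelberg (s : ℂ) : ℂ :=
  s * (s - 1) * (thetaPair hf hinv hdec).Λ₀ s + ∫ z in ModularGroup.fd, f z

lemma differentiable_rankinSelberg : Differentiable ℂ (rankinSelberg hf hinv hdec) := by
  have := (thetaPair hf hinv hdec).differentiable_Λ₀
  unfold rankinSelberg
  fun_prop

/-- The added integral turns `s(s-1)Λ₀` into `s(s-1)Λ`, so the value at `1` is the residue of the
completed transform there. -/
lemma rankinSelberg_one :
    rankinSelberg hf hinv hdec 1 = ∫ z in ModularGroup.fd, f z := by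
  simp [rankinSelberg]

lemma rankinSelberg_one_sub (s : ℂ) :
    rankinSelberg hf hinv hdec (1 - s) = rankinSelberg hf hinv hdec s := by
  have h := (thetaPair hf hinv hdec).functional_equation₀ s
  have hs : (thetaPair hf hinv hdec).symm = thetaPair hf hinv hdec := by
    simp [WeakFEPair.symm, thetaPair]
  rw [hs] at h
  simp only [thetaPair, Complex.ofReal_one, one_smul] at h
  simp only [rankinSelberg, thetaPair]
  rw [h]
  ring

lemma exists_norm_rankinSelberg_le : ∃ B, ∀ s : ℂ, -1 ≤ s.re → s.re ≤ 2 →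
    ‖rankinSelberg hf hinv hdec s‖ ≤ B * (1 + |s.im|) ^ 2 := by
  obtain ⟨C, hC⟩ := exists_norm_completed_le (thetaPair hf hinv hdec) (-1) 2
  have hC0 : 0 ≤ C := (norm_nonneg _).trans (hC 0 (by simp) (by simp))
  refine ⟨6 * C + ‖∫ z in ModularGroup.fd, f z‖, fun s h1 h2 => ?_⟩
  have n1 := norm_le_two_mul h1 h2
  have hT : 1 ≤ 1 + |s.im| := by linarith [abs_nonneg s.im]
  have n2 : ‖s - 1‖ ≤ 3 * (1 + |s.im|) := by
    have := norm_sub_le s 1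
    rw [norm_one] at this
    linarith
  rw [rankinSelberg]
  calc _ ≤ 2 * (1 + |s.im|) * (3 * (1 + |s.im|)) * C + ‖∫ z in ModularGroup.fd, f z‖ * 1 := by
        rw [mul_one]
        refine (norm_add_le _ _).trans ?_
        rw [norm_mul, norm_mul]
        gcongr
        exact hC s h1 h2
    _ ≤ 2 * (1 + |s.im|) * (3 * (1 + |s.im|)) * C +
        ‖∫ z in ModularGroup.fd, f z‖ * (1 + |s.im|) ^ 2 := by
        gcongr
        exact one_le_pow₀ hT
    _ = _ := by ring

/-- Since `ξ(2s) = 2s(2s-1) ζ*(2s)`, this is the Rankin–Selberg identity with the denominators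
cleared; apart from the Mellin transform only entire functions occur. -/
lemma rankinSelberg_eq {s : ℂ} (hs : 1 < s.re) :
    (2 * s - 1) * rankinSelberg hf hinv hdec s =
      (s - 1) * xiFun (2 * s) * mellin (constantTerm f) (s - 1) := by
  have hs0 : s ≠ 0 := by rintro rfl; simp at hs; linarith
  have hs1 : 1 - s ≠ 0 := by
    intro h
    have := congrArg Complex.re h
    simp at this
    linarith
  have h2s1 : 2 * s ≠ 1 := by
    intro h
    have := congrArg Complex.re h
    simp at this
    linarith
  set P := thetaPair hf hinv hdec with hP
  have h := (P.hasMellin (s := s) hs).2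
  have e : (fun x => P.f x - P.f₀) = thetaTransform f := by
    funext t
    simp [hP, thetaPair]
  rw [e, mellin_thetaTransform hf hinv hdec hs] at h
  have hΛ : P.Λ₀ s = P.Λ s + (1 / s) * (∫ z in ModularGroup.fd, f z) +
      (1 / (1 - s)) * ∫ z in ModularGroup.fd, f z := by
    rw [WeakFEPair.Λ]
    simp [hP, thetaPair]
    ring
  rw [rankinSelberg, ← hP, hΛ, ← h, xiFun_eq (mul_ne_zero two_ne_zero hs0) h2s1]
  field_simp
  ring

end Transform

/-- The asymptotics of the constant term, in the range where the error term tends to zero. -/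
theorem exists_norm_constantTerm_sub_le {f : ℍ → ℂ} (hinv : IsModularInvariant f)
    (hdec : IsRapidDecay f) (hdiff : IsTwiceDifferentiable f)
    (hloc : LocallyIntegrable (hypLaplacian f) volume)
    (hlap : hypLaplacian f =O[atImInfty] fun z : ℍ => z.im ^ (1 / 4 : ℝ))
    {σ₀ : ℝ} (hσ₀ : supRealPart / 2 < σ₀) (hσ₁ : σ₀ < 1) :
    ∃ K, ∀ y : ℝ, 0 < y → y < 1 →
      ‖constantTerm f y - ((3 / Real.pi : ℝ) : ℂ) * ∫ z in ModularGroup.fd, f z‖ ≤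
        K * y ^ (1 - σ₀) := by
  have hf := hdiff.continuous
  obtain ⟨C₀, -, h₀⟩ := exists_norm_mul_pow_le hf hinv hdec 0
  simp only [pow_zero, mul_one] at h₀
  obtain ⟨B, hB⟩ := exists_norm_rankinSelberg_le hf hinv hdec
  obtain ⟨K, -, hK⟩ := exists_norm_mellin_constantTerm_le hinv hdec hdiff hloc hlap
    (δ := 1 / 16) (ε := 1 / 16) (by norm_num) (by norm_num) (by norm_num)
  obtain ⟨C, hC⟩ := exists_norm_transform_le (differentiable_rankinSelberg hf hinv hdec)
    (rankinSelberg_one_sub hf hinv hdec) hB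
    (R := fun s => mellin (constantTerm f) (s - 1)) (K := K)
    (fun s hs => rankinSelberg_eq hf hinv hdec hs)
    (fun s hs => by
      have := hK (s - 1) (by rw [Complex.sub_re, hs, Complex.one_re]; norm_num)
      simpa using this)
  have := exists_norm_sub_le_rpow (continuousOn_constantTerm hf h₀)
    (fun s hs => mellinConvergent_constantTerm hf hinv hdec hs)
    (differentiable_rankinSelberg hf hinv hdec)
    (fun s hs => rankinSelberg_eq hf hinv hdec hs) hC hσ₀ hσ₁
  rwa [rankinSelberg_one] at this

/-- When `Θ/2 + ε ≥ 1` the exponent is not positive and boundedness of the constant term suffices;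
otherwise `σ₀ = Θ/2 + ε` is an admissible abscissa. -/
theorem isBigO_constantTerm_sub {f : ℍ → ℂ} (hinv : IsModularInvariant f)
    (hdec : IsRapidDecay f) (hdiff : IsTwiceDifferentiable f)
    (hloc : LocallyIntegrable (hypLaplacian f) volume)
    (hlap : hypLaplacian f =O[atImInfty] fun z : ℍ => z.im ^ (1 / 4 : ℝ)) {ε : ℝ} (hε : 0 < ε) :
    (fun y : ℝ => constantTerm f y -
      ((3 / Real.pi : ℝ) : ℂ) * ∫ z in ModularGroup.fd, f z) =O[𝓝[>] (0 : ℝ)]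
        fun y : ℝ => y ^ (1 - supRealPart / 2 - ε) := by
  have key : ∃ K, ∀ y : ℝ, 0 < y → y < 1 →
      ‖constantTerm f y - ((3 / Real.pi : ℝ) : ℂ) * ∫ z in ModularGroup.fd, f z‖ ≤
        K * y ^ (1 - supRealPart / 2 - ε) := by
    rw [sub_sub]
    rcases lt_or_ge (supRealPart / 2 + ε) 1 with h | h
    · exact exists_norm_constantTerm_sub_le hinv hdec hdiff hloc hlap (by linarith) h
    · obtain ⟨C₀, hC₀, h₀⟩ := exists_norm_mul_pow_le hdiff.continuous hinv hdec 0
      refine ⟨C₀ + ‖((3 / Real.pi : ℝ) : ℂ) * ∫ z in ModularGroup.fd, f z‖, fun y hy hy1 => ?_⟩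
      have h1 := norm_constantTerm_mul_pow_le h₀ hy
      rw [pow_zero, mul_one] at h1
      refine ((norm_sub_le _ _).trans (add_le_add_left h1 _)).trans
        (le_mul_of_one_le_right (by positivity) ?_)
      exact Real.one_le_rpow_of_pos_of_le_one_of_nonpos hy hy1.le (by linarith)
  obtain ⟨K, hK⟩ := key
  refine IsBigO.of_bound K ?_
  filter_upwards [Ioo_mem_nhdsGT one_pos] with y hy
  rw [Real.norm_of_nonneg (Real.rpow_nonneg hy.1.le _)]
  exact hK y hy.1 hy.2

end Horocycle

end

theorem mainTheorem7 (f : ℍ → ℂ)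
    (hmod : Horocycle.IsModularInvariant f)
    (hdecay : Horocycle.IsRapidDecay f)
    (hdiff : Horocycle.IsTwiceDifferentiable f)
    (hloc : LocallyIntegrable (Horocycle.hypLaplacian f) volume)
    (hlap : Horocycle.hypLaplacian f =O[atImInfty] fun z : ℍ => z.im ^ (1 / 4 : ℝ)) :
    ∀ ε : ℝ, 0 < ε →
      (fun y : ℝ => Horocycle.constantTerm f y -
          ((3 / Real.pi : ℝ) : ℂ) * ∫ z in ModularGroup.fd, f z) =O[𝓝[>] (0 : ℝ)]
        fun y : ℝ => y ^ (1 - Horocycle.supRealPart / 2 - ε) := by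
  exact fun ε hε => Horocycle.isBigO_constantTerm_sub hmod hdecay hdiff hloc hlap hε
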